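/- **Setting.** Let $H$ (resp. $\hat H$) be the group of isometries of $\mathbb R^2$ generated by the $\pi$-rotations around the points of $\mathbb Z^2$ (resp. of $(\frac12\mathbb Z)^2$). Let $S=(\mathbb R^2-\mathbb Z^2)/H$ be the 4-punctured Conway sphere and $\mathcal O=(\mathbb R^2-\mathbb Z^2)/\hat H$ the quotient orbifold, so that $\pi_1(S)\subset\pi_1(\mathcal O)$ has index 4. For $s\in\mathbb Q\cup\{\infty\}$ let $\alpha_s$ be the (unoriented) simple loop in $S$ that is the image of a line of slope $s$ in $\mathbb R^2-\mathbb Z^2$, and let $\beta_s\in\pi_1(\mathcal O)$ be represented by the image of the same line in $\mathcal O$, run through one primitive lattice vector (so $\alpha_s=\beta_s^2$). Let $r\in\mathbb Q$ and let $n>1$ be an integer or a half-integer; put $m=2n$. The fundamental group of the Heckoid orbifold $\boldsymbol S(r;n)$ is the Heckoid group: for $n$ an integer it is $\pi_1(S)/\langle\langle\alpha_\infty,\alpha_r^n\rangle\rangle$; for $n$ a non-integral half-integer it is the image of $\pi_1(S)$ in $\pi_1(\mathcal O)/\langle\langle\beta_\infty^2,\beta_r^m\rangle\rangle$. Two loops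 $\alpha_s,\alpha_{s'}$ are homotopic in $\boldsymbol S(r;n)$ if their images in this group are conjugate up to inversion, and $\alpha_s$ is null-homotopic if its image is trivial. Let $\Gamma_\infty$ be the group generated by the reflections in the edges of the Farey tessellation with an endpoint $\infty$, let $C_r(m)$ be the infinite cyclic group generated by the parabolic automorphism of the tessellation that fixes $r$ and shifts by $m$ units (the conjugate of $z\mapsto z+m$ by an orientation-preserving automorphism of the tessellation carrying $\infty$ to $r$), and let $\Gamma(r;n)$ be the group generated by $\Gamma_\infty$ and $C_r(2n)$. For non-integral $r$, take any rationals $r_1<r<r_2$ joined to $r$ by Farey edges such that one of $r_1,r_2$ is the image of the other under a generator of $C_r(2n)$ (such a pair exists), and let $I(r;n)$ be the set $[\lfloor r\rfloor,r_1]\cup[r_2,\lfloor r\rfloor+1]$ with one of the two points $r_1,r_2$ (either one) removed. **Theorem.** Suppose that $r$ is a non-integral rational number and that $n>1$ is an integer or a half-integer. Then for every $s\in\mathbb Q\cup\{\infty\}$ there is a unique $s_0\in (I(r;n)\cap\mathbb Q)\cup\{\infty,r\}$ such that $s$ lies in the $\Gamma(r;n)$-orbit of $s_0$. Moreover, $\alpha_s$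 is homotopic to $\alpha_{s_0}$ in $\boldsymbol S(r;n)$. In particular, if $s_0=\infty$, then $\alpha_s$ is null-homotopic in $\boldsymbol S(r;n)$. -/

import Mathlib

open scoped OnePoint MatrixGroups

noncomputable section

/-! ## Slopes and the Farey tessellation -/

/-- Numerator of a slope in `ℚ ∪ {∞}`, where `∞ = 1/0`. -/
def slopeNum (s : OnePoint ℚ) : ℤ := s.elim 1 Rat.num

/-- Denominator of a slope in `ℚ ∪ {∞}`, where `∞ = 1/0`. -/
def slopeDen (s : OnePoint ℚ) : ℤ := s.elim 0 (fun q => (q.den : ℤ))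

/-- Two ideal vertices span an edge of the Farey tessellation. -/
def FareyAdj (u v : OnePoint ℚ) : Prop :=
  |slopeNum u * slopeDen v - slopeNum v * slopeDen u| = 1

/-- The reflections in the Farey edges with endpoint `r`, as matrices in `GL(2,ℤ)` acting on
`ℚ ∪ {∞}`: such a reflection is an orientation-reversing automorphism of the tessellation that
fixes both endpoints of the edge. (The matrix is determined up to sign.) -/
def fareyReflections (r : OnePoint ℚ) : Set (GL (Fin 2) ℚ) :=
  {g | (∃ A : GL (Fin 2) ℤ, A.det = -1 ∧
          g = Matrix.GeneralLinearGroup.map (Int.castRingHom ℚ) A) ∧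
        g • r = r ∧ ∃ v : OnePoint ℚ, FareyAdj r v ∧ g • v = v}

/-- The group generated by the reflections in the Farey edges with endpoint `r`. -/
def reflectionGroup (r : OnePoint ℚ) : Subgroup (GL (Fin 2) ℚ) :=
  Subgroup.closure (fareyReflections r)

/-- The parabolic transformation centred at `r` by `m` units: the conjugate of `z ↦ z + m` by an
orientation-preserving automorphism of the tessellation that carries `∞` to `r`. -/
def parabolicShift (r : OnePoint ℚ) (m : ℕ) : Set (GL (Fin 2) ℚ) :=
  {g | ∃ A : SL(2, ℤ), Matrix.SpecialLinearGroup.mapGL ℚ A • (∞ : OnePoint ℚ) = r ∧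
        g = Matrix.SpecialLinearGroup.mapGL ℚ (A * ModularGroup.T ^ m * A⁻¹)}

/-- The infinite cyclic group `C_r(m)`. -/
def parabolicGroup (r : OnePoint ℚ) (m : ℕ) : Subgroup (GL (Fin 2) ℚ) :=
  Subgroup.closure (parabolicShift r m)

/-- The group `Γ(r;n)`, with `m = 2n`, acting on `ℚ ∪ {∞}`. -/
def heckoidFareyGroup (r : ℚ) (m : ℕ) : Subgroup (GL (Fin 2) ℚ) :=
  reflectionGroup ∞ ⊔ parabolicGroup (r : OnePoint ℚ) m

/-- The Farey edges `⟨r, r₁⟩` and `⟨r, r₂⟩` cut off a region containing `∞` (that is,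
`r₁ < r < r₂`), and one is the image of the other by a generator of `C_r(m)`. -/
structure IsHeckoidPair (r : ℚ) (m : ℕ) (r₁ r₂ : ℚ) : Prop where
  left_lt : r₁ < r
  lt_right : r < r₂
  adj_left : FareyAdj r r₁
  adj_right : FareyAdj r r₂
  paired : ∃ g ∈ parabolicShift (r : OnePoint ℚ) m,
    g • (r₁ : OnePoint ℚ) = r₂ ∨ g • (r₂ : OnePoint ℚ) = r₁

/-- Such pairs of edges exist. -/
theorem exists_isHeckoidPair (r : ℚ) (hr : ∀ k : ℤ, r ≠ k) (m : ℕ) (hm : 0 < m) :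
    ∃ r₁ r₂ : ℚ, IsHeckoidPair r m r₁ r₂ := by
  obtain ⟨a, ha⟩ : ∃ a : ℤ, a = r.num := ⟨_, rfl⟩
  obtain ⟨b, hbd⟩ : ∃ b : ℤ, b = r.den := ⟨_, rfl⟩
  have hb : 1 < b := by
    have h0 := r.den_pos
    have h1 : r.den ≠ 1 := fun h => hr r.num ((Rat.den_eq_one_iff r).1 h).symm
    omega
  have hcop : IsCoprime a b := by rw [ha, hbd]; exact Rat.isCoprime_num_den r
  obtain ⟨w₀, u₀, huw⟩ := hcop
  have hra : r = (a : ℚ) / (b : ℚ) := by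
    rw [ha, hbd]; exact_mod_cast (Rat.num_div_den r).symm
  obtain ⟨u, w, hdet, hw0, hwb⟩ : ∃ u w : ℤ, a * w - u * b = 1 ∧ 0 < w ∧ w < b := by
    refine ⟨-u₀ - a * (w₀ / b), w₀ % b, ?_, ?_, Int.emod_lt_of_pos _ (by omega)⟩
    · have := Int.emod_add_mul_ediv w₀ b
      have h2 : w₀ % b = w₀ - b * (w₀ / b) := by omega
      rw [h2]; linarith [huw, mul_comm w₀ a]
    · rcases (Int.emod_nonneg w₀ (show b ≠ 0 by omega)).lt_or_eq with h | h
      · exact h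
      · exfalso
        obtain ⟨k, hk⟩ := Int.dvd_of_emod_eq_zero h.symm
        have : b * (k * a + u₀) = 1 := by rw [← huw, hk]; ring
        have := Int.eq_one_or_neg_one_of_mul_eq_one this
        omega
  have num_den : ∀ x y : ℤ, 0 < y → ∀ z t : ℤ, x * t - z * y = 1 →
      ((x : ℚ) / y).num = x ∧ (((x : ℚ) / y).den : ℤ) = y := by
    intro x y hy z t h
    have hc : IsCoprime x y := ⟨t, -z, by linarith [mul_comm t x]⟩
    exact ⟨Rat.num_div_eq_of_coprime hy (Int.isCoprime_iff_nat_coprime.1 hc),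
      Rat.den_div_eq_of_coprime hy (Int.isCoprime_iff_nat_coprime.1 hc)⟩
  have hm' : (1 : ℤ) ≤ m := by exact_mod_cast hm
  have hy2 : 0 < b * m - w := by nlinarith
  have hdq : (a : ℚ) * w - u * b = 1 := by exact_mod_cast hdet
  have hwq : (0 : ℚ) < w := by exact_mod_cast hw0
  have hbq : (0 : ℚ) < b := by exact_mod_cast (by omega : 0 < b)
  have hyq : (0 : ℚ) < (b * m - w : ℤ) := by exact_mod_cast hy2
  obtain ⟨n1, d1⟩ := num_den u w hw0 (-a) (-b) (by linarith)
  obtain ⟨n2, d2⟩ := num_den (a * m - u) (b * m - w) hy2 a b (by linarith)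
  refine ⟨(u : ℚ) / w, ((a * m - u : ℤ) : ℚ) / (b * m - w : ℤ), ?_, ?_, ?_, ?_, ?_⟩
  · rw [hra, div_lt_div_iff₀ hwq hbq]; linarith
  · rw [hra, div_lt_div_iff₀ hbq hyq]; push_cast; linarith
  · simp only [FareyAdj, slopeNum, slopeDen, OnePoint.elim_some]
    rw [n1, d1, ← ha, ← hbd, hdet]; simp
  · simp only [FareyAdj, slopeNum, slopeDen, OnePoint.elim_some]
    rw [n2, d2, ← ha, ← hbd, show a * (b * m - w) - (a * m - u) * b = -1 by linarith]; simp
  · let A : SL(2, ℤ) := ⟨!![a, u; b, w], by rw [Matrix.det_fin_two_of]; linarith⟩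
    have smul_zero : ∀ B : SL(2, ℤ), B 1 1 ≠ 0 →
        Matrix.SpecialLinearGroup.mapGL ℚ B • ((0 : ℚ) : OnePoint ℚ) =
          ((B 0 1 / B 1 1 : ℚ) : OnePoint ℚ) := by
      intro B hB
      have hB' : (B 1 1 : ℚ) ≠ 0 := by exact_mod_cast hB
      rw [OnePoint.smul_some_eq_ite]
      simp [Matrix.SpecialLinearGroup.mapGL_coe_matrix, hB]
    have hC : ((A * ModularGroup.T ^ (-(m : ℤ)) : SL(2, ℤ)) : Matrix (Fin 2) (Fin 2) ℤ) =
        !![a, u - a * m; b, w - b * m] := by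
      rw [Matrix.SpecialLinearGroup.coe_mul, ModularGroup.coe_T_zpow]
      ext i j
      fin_cases i <;> fin_cases j <;> simp [A, Matrix.mul_apply, Fin.sum_univ_two] <;> ring
    have h1 : ((u : ℚ) / w : ℚ) = (A 0 1 / A 1 1 : ℚ) := by simp [A]
    have h2 : (((a * m - u : ℤ) : ℚ) / (b * m - w : ℤ) : ℚ) =
        (((A * ModularGroup.T ^ (-(m : ℤ)) : SL(2, ℤ)) 0 1 : ℚ) /
          ((A * ModularGroup.T ^ (-(m : ℤ)) : SL(2, ℤ)) 1 1 : ℚ)) := by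
      rw [hC]
      simp only [Matrix.of_apply, Matrix.cons_val', Matrix.cons_val_zero, Matrix.cons_val_one,
        Matrix.cons_val_fin_one]
      rw [← neg_div_neg_eq]
      push_cast
      congr 1 <;> ring
    refine ⟨_, ⟨A, ?_, rfl⟩, Or.inr ?_⟩
    · have hb0 : b ≠ 0 := by omega
      have hinf : ∀ B : SL(2, ℤ), B 1 0 ≠ 0 →
          Matrix.SpecialLinearGroup.mapGL ℚ B • (∞ : OnePoint ℚ) =
            ((B 0 0 / B 1 0 : ℚ) : OnePoint ℚ) := by
        intro B hB
        rw [OnePoint.smul_infty_eq_ite]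
        simp [Matrix.SpecialLinearGroup.mapGL_coe_matrix, hB]
      rw [hinf A (by simpa [A] using hb0), hra]
      simp [A]
    · rw [h1, h2, ← smul_zero, ← smul_zero, ← mul_smul, ← map_mul]
      · congr 2
        rw [zpow_neg, zpow_natCast]
        group
      · simp [A]; omega
      · rw [hC]; simp; omega

/-- The rational points of `I(r;n)`: the fundamental domain bounded by the edges
`⟨∞, ⌊r⌋⟩`, `⟨∞, ⌊r⌋ + 1⟩`, `⟨r, r₁⟩`, `⟨r, r₂⟩` meets the boundary of the hyperbolic plane in
`[⌊r⌋, r₁] ∪ [r₂, ⌊r⌋ + 1]` (and `∞`, `r`); one endpoint `e ∈ {r₁, r₂}` is removed. -/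
def heckoidInterval (r r₁ r₂ e : ℚ) : Set (OnePoint ℚ) :=
  (fun q : ℚ => (q : OnePoint ℚ)) ''
    ((Set.Icc (⌊r⌋ : ℚ) r₁ ∪ Set.Icc r₂ ((⌊r⌋ : ℚ) + 1)) \ {e})

/-! ## The orbifold fundamental group of a quotient `X / G` -/

/-- The orbifold fundamental group of `X / G`, based at the image of `x₀`: pairs of an element `g`
of `G` and a homotopy class of paths in `X` from `x₀` to `g • x₀`. -/
structure OrbifoldPi1 (G : Type*) {X : Type*} [Group G] [TopologicalSpace X] [MulAction G X]
    (x₀ : X) where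
  elt : G
  path : Path.Homotopic.Quotient x₀ (elt • x₀)

namespace OrbifoldPi1

variable {G X : Type*} [Group G] [TopologicalSpace X] [MulAction G X] {x₀ : X}

theorem ext' {a b : OrbifoldPi1 G x₀} (h : a.elt = b.elt)
    (h' : a.path = b.path.cast rfl (congrArg (· • x₀) h)) : a = b := by
  obtain ⟨g, γ⟩ := a
  obtain ⟨g', γ'⟩ := b
  obtain rfl : g = g' := h
  simpa using h'

variable [ContinuousConstSMul G X]

/-- The translate of a path by a group element. -/
def movePath (g : G) {x y : X} (γ : Path x y) : Path (g • x) (g • y) :=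
  γ.map (continuous_const_smul g)

/-- The translate of a homotopy class of paths by a group element. -/
def moveClass (g : G) {x y : X} (γ : Path.Homotopic.Quotient x y) :
    Path.Homotopic.Quotient (g • x) (g • y) :=
  γ.map ⟨fun z => g • z, continuous_const_smul g⟩

theorem moveClass_mk (g : G) {x y : X} (γ : Path x y) :
    moveClass g (Path.Homotopic.Quotient.mk γ) = Path.Homotopic.Quotient.mk (movePath g γ) :=
  rfl

/-- `(g, γ) * (h, δ) = (g h, γ · g δ)`. -/
instance : Mul (OrbifoldPi1 G x₀) where
  mul a b := ⟨a.elt * b.elt, (a.path.trans (moveClass a.elt b.path)).cast rfl (mul_smul _ _ _)⟩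

instance : One (OrbifoldPi1 G x₀) where
  one := ⟨1, (Path.Homotopic.Quotient.refl x₀).cast rfl (one_smul _ _)⟩

instance : Inv (OrbifoldPi1 G x₀) where
  inv a := ⟨a.elt⁻¹, (moveClass a.elt⁻¹ a.path).symm.cast (inv_smul_smul a.elt x₀).symm rfl⟩

theorem cast_trans_comm {Y : Type*} [TopologicalSpace Y] {w x y y' z : Y} (hw : w = x) (h : y = y')
    (γ : Path.Homotopic.Quotient x y') (δ : Path.Homotopic.Quotient y z) :
    (γ.cast hw h).trans δ = (γ.trans (δ.cast h.symm rfl)).cast hw rfl := by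
  subst h; subst hw; simp

theorem trans_cast_comm {Y : Type*} [TopologicalSpace Y] {x y z z' : Y} (h : z' = z)
    (γ : Path.Homotopic.Quotient x y) (δ : Path.Homotopic.Quotient y z) :
    γ.trans (δ.cast rfl h) = (γ.trans δ).cast rfl h := by
  subst h; simp

theorem moveClass_trans (g : G) {x y z : X}
    (γ : Path.Homotopic.Quotient x y) (δ : Path.Homotopic.Quotient y z) :
    moveClass g (γ.trans δ) = (moveClass g γ).trans (moveClass g δ) := by
  induction γ with | mk γ => ?_
  induction δ with | mk δ => ?_
  rw [← Path.Homotopic.Quotient.mk_trans, moveClass_mk, moveClass_mk, moveClass_mk,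
    ← Path.Homotopic.Quotient.mk_trans]
  exact congrArg _ (Path.map_trans γ δ (continuous_const_smul g))

theorem moveClass_cast (g : G) {x y x' y' : X} (γ : Path.Homotopic.Quotient x y)
    (hx : x' = x) (hy : y' = y) :
    moveClass g (γ.cast hx hy) =
      (moveClass g γ).cast (congrArg (g • ·) hx) (congrArg (g • ·) hy) := by
  subst hx; subst hy; simp

theorem moveClass_mul {x y : X} (g h : G) (γ : Path.Homotopic.Quotient x y) :
    moveClass (g * h) γ =
      (moveClass g (moveClass h γ)).cast (mul_smul g h x) (mul_smul g h y) := by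
  induction γ with | mk γ => ?_
  rw [moveClass_mk, moveClass_mk, moveClass_mk, ← Path.Homotopic.Quotient.mk_cast]
  congr 1
  ext t
  exact mul_smul g h (γ t)

theorem moveClass_one {x y : X} (γ : Path.Homotopic.Quotient x y) :
    moveClass (1 : G) γ = γ.cast (one_smul G x) (one_smul G y) := by
  induction γ with | mk γ => ?_
  rw [moveClass_mk, ← Path.Homotopic.Quotient.mk_cast]
  congr 1
  ext t
  exact one_smul G (γ t)

instance : Group (OrbifoldPi1 G x₀) := by
  refine Group.ofLeftAxioms ?_ ?_ ?_
  · intro a b c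
    refine ext' (mul_assoc a.elt b.elt c.elt) ?_
    change (((a.path.trans (moveClass a.elt b.path)).cast rfl (mul_smul _ _ _)).trans
        (moveClass (a.elt * b.elt) c.path)).cast rfl (mul_smul _ _ _) =
      ((a.path.trans (moveClass a.elt ((b.path.trans (moveClass b.elt c.path)).cast rfl
        (mul_smul _ _ _)))).cast rfl (mul_smul _ _ _)).cast rfl _
    rw [cast_trans_comm, moveClass_mul, moveClass_cast, moveClass_trans]
    simp only [Path.Homotopic.Quotient.cast_cast]
    rw [trans_cast_comm, trans_cast_comm, Path.Homotopic.Quotient.trans_assoc]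
    simp only [Path.Homotopic.Quotient.cast_cast]
  · intro a
    refine ext' (one_mul a.elt) ?_
    change (((Path.Homotopic.Quotient.refl x₀).cast rfl (one_smul _ _)).trans
      (moveClass (1 : G) a.path)).cast rfl (mul_smul _ _ _) = a.path.cast rfl _
    rw [cast_trans_comm, moveClass_one]
    simp only [Path.Homotopic.Quotient.cast_cast]
    rw [trans_cast_comm, Path.Homotopic.Quotient.refl_trans]
    simp only [Path.Homotopic.Quotient.cast_cast]
  · intro a
    refine ext' (inv_mul_cancel a.elt) ?_
    change (((moveClass a.elt⁻¹ a.path).symm.cast (inv_smul_smul a.elt x₀).symm rfl).trans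
      (moveClass a.elt⁻¹ a.path)).cast rfl (mul_smul _ _ _) =
      ((Path.Homotopic.Quotient.refl x₀).cast rfl (one_smul _ _)).cast rfl _
    rw [cast_trans_comm, Path.Homotopic.Quotient.cast_rfl_rfl, Path.Homotopic.Quotient.symm_trans]
    simp only [Path.Homotopic.Quotient.cast_cast]
    have key : ∀ y (h : x₀ = y) (z) (h₁ : z = y) (h₂ : z = x₀),
        (Path.Homotopic.Quotient.refl y).cast h h₁ =
          (Path.Homotopic.Quotient.refl x₀).cast rfl h₂ := by
      rintro y rfl z rfl _; rfl
    exact key _ _ _ _ _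

end OrbifoldPi1

/-! ## The Conway sphere -/

/-- The lattice `ℤ²` in the Euclidean plane `ℂ = ℝ²`. -/
def planeLattice : AddSubgroup ℂ where
  carrier := {z | ∃ a b : ℤ, z = a + b * Complex.I}
  zero_mem' := ⟨0, 0, by simp⟩
  add_mem' := by
    rintro _ _ ⟨a, b, rfl⟩ ⟨c, d, rfl⟩
    exact ⟨a + c, b + d, by push_cast; ring⟩
  neg_mem' := by
    rintro _ ⟨a, b, rfl⟩
    exact ⟨-a, -b, by push_cast; ring⟩

/-- The punctured plane `ℝ² - ℤ²`. -/
abbrev PuncturedPlane : Type := {z : ℂ // z ∉ planeLattice}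

/-- The isometries of the plane that preserve `ℤ²`. -/
def latticeIsometries : Subgroup (ℂ ≃ᵃⁱ[ℝ] ℂ) where
  carrier := {f | ∀ z, f z ∈ planeLattice ↔ z ∈ planeLattice}
  one_mem' := fun _ => Iff.rfl
  mul_mem' := fun {f g} hf hg z => (hf (g z)).trans (hg z)
  inv_mem' := fun {f} hf z => by
    have h := hf (f⁻¹ z)
    rw [show f (f⁻¹ z) = z from f.apply_symm_apply z] at h
    exact h.symm

instance : MulAction latticeIsometries PuncturedPlane where
  smul f x := ⟨f.1 x.1, fun h => x.2 ((f.2 x.1).1 h)⟩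
  one_smul _ := rfl
  mul_smul _ _ _ := rfl

instance : ContinuousConstSMul latticeIsometries PuncturedPlane where
  continuous_const_smul f :=
    (f.1.continuous.comp continuous_subtype_val).subtype_mk _

instance (K : Subgroup latticeIsometries) : ContinuousConstSMul K PuncturedPlane where
  continuous_const_smul k := continuous_const_smul (k : latticeIsometries)

/-- The `π`-rotation `z ↦ 2c - z` around a point `c` with `2c ∈ ℤ²`. -/
def halfTurn (c : ℂ) (hc : c + c ∈ planeLattice) : latticeIsometries :=
  ⟨AffineIsometryEquiv.pointReflection ℝ c, fun z => by
    have h : AffineIsometryEquiv.pointReflection ℝ c z = (c + c) - z := by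
      rw [AffineIsometryEquiv.pointReflection_apply, vsub_eq_sub, vadd_eq_add]; ring
    rw [h]
    refine ⟨fun hz => ?_, fun hz => planeLattice.sub_mem hc hz⟩
    simpa using planeLattice.sub_mem hc hz⟩

/-- The group `H` generated by the `π`-rotations around the points of `ℤ²`. -/
def conwayGroup : Subgroup latticeIsometries :=
  Subgroup.closure {f | ∃ (c : ℂ) (hc : c ∈ planeLattice),
    f = halfTurn c (planeLattice.add_mem hc hc)}

/-- The group `Ĥ` generated by the `π`-rotations around the points of `(½ℤ)²`. -/
def bigConwayGroup : Subgroup latticeIsometries :=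
  Subgroup.closure {f | ∃ (c : ℂ) (hc : c + c ∈ planeLattice), f = halfTurn c hc}

/-- The four-punctured Conway sphere `(ℝ² - ℤ²) / H`. -/
abbrev ConwaySphere : Type := MulAction.orbitRel.Quotient conwayGroup PuncturedPlane

/-- The covering projection `ℝ² - ℤ² → (ℝ² - ℤ²) / H`. -/
def conwayProj : C(PuncturedPlane, ConwaySphere) :=
  ⟨Quotient.mk _, continuous_quotient_mk'⟩

theorem conwayProj_smul {h : latticeIsometries} (hh : h ∈ conwayGroup) (x : PuncturedPlane) :
    conwayProj (h • x) = conwayProj x :=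
  Quotient.sound ⟨⟨h, hh⟩, rfl⟩

/-! ## Simple loops of slope `s` -/

/-- The primitive lattice vector of slope `s`. -/
def slopeVec (s : OnePoint ℚ) : ℂ := slopeDen s + slopeNum s * Complex.I

theorem slopeVec_mem (s : OnePoint ℚ) : slopeVec s ∈ planeLattice :=
  ⟨slopeDen s, slopeNum s, rfl⟩

/-- The translation by the primitive lattice vector of slope `s`. -/
def slopeTranslation (s : OnePoint ℚ) : latticeIsometries :=
  halfTurn (slopeVec s / 2) (by rw [add_halves]; exact slopeVec_mem s) *
    halfTurn 0 (by rw [add_zero]; exact planeLattice.zero_mem)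

theorem slopeTranslation_smul (s : OnePoint ℚ) (x : PuncturedPlane) :
    ((slopeTranslation s • x : PuncturedPlane) : ℂ) = x + slopeVec s := by
  change AffineIsometryEquiv.pointReflection ℝ (slopeVec s / 2)
    (AffineIsometryEquiv.pointReflection ℝ 0 (x : ℂ)) = x + slopeVec s
  simp only [AffineIsometryEquiv.pointReflection_apply, vsub_eq_sub, vadd_eq_add]
  ring

theorem slopeTranslation_mem (s : OnePoint ℚ) : slopeTranslation s ∈ bigConwayGroup :=
  mul_mem (Subgroup.subset_closure ⟨_, _, rfl⟩) (Subgroup.subset_closure ⟨_, _, rfl⟩)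

theorem slopeTranslation_sq_mem (s : OnePoint ℚ) : slopeTranslation s ^ 2 ∈ conwayGroup := by
  have h : slopeTranslation s ^ 2 =
      halfTurn (slopeVec s) (planeLattice.add_mem (slopeVec_mem s) (slopeVec_mem s)) *
        halfTurn 0 (planeLattice.add_mem planeLattice.zero_mem planeLattice.zero_mem) := by
    rw [pow_two]
    apply Subtype.ext
    ext z
    change AffineIsometryEquiv.pointReflection ℝ (slopeVec s / 2)
      (AffineIsometryEquiv.pointReflection ℝ 0
        (AffineIsometryEquiv.pointReflection ℝ (slopeVec s / 2)
          (AffineIsometryEquiv.pointReflection ℝ 0 z))) =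
      AffineIsometryEquiv.pointReflection ℝ (slopeVec s)
        (AffineIsometryEquiv.pointReflection ℝ 0 z)
    simp only [AffineIsometryEquiv.pointReflection_apply, vsub_eq_sub, vadd_eq_add]
    ring
  rw [h]
  exact mul_mem (Subgroup.subset_closure ⟨_, slopeVec_mem s, rfl⟩)
    (Subgroup.subset_closure ⟨_, planeLattice.zero_mem, rfl⟩)

/-- A line of slope `s` in `ℝ² - ℤ²`, with a starting point. -/
structure SlopeLine (s : OnePoint ℚ) where
  pt : ℂ
  avoids : ∀ t : ℝ, pt + t * slopeVec s ∉ planeLattice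

theorem slopeVec_ne_zero (s : OnePoint ℚ) : slopeVec s ≠ 0 := by
  intro h
  have h1 := congrArg Complex.re h
  have h2 := congrArg Complex.im h
  simp [slopeVec] at h1 h2
  induction s using OnePoint.rec with
  | infty => simp [slopeNum] at h2
  | coe q => simp [slopeDen] at h1

/-- Lines of every slope exist. -/
instance (s : OnePoint ℚ) : Nonempty (SlopeLine s) := by
  have hv := slopeVec_ne_zero s
  have hn : Complex.normSq (slopeVec s) ≠ 0 := by simpa using hv
  refine ⟨⟨Complex.I * slopeVec s / (2 * Complex.normSq (slopeVec s) : ℝ), ?_⟩⟩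
  rintro t ⟨a, b, h⟩
  have key : ((slopeDen s : ℝ) * b - slopeNum s * a) = 1 / 2 := by
    have h1 := congrArg Complex.re h
    have h2 := congrArg Complex.im h
    rw [Complex.add_re, Complex.div_ofReal_re] at h1
    rw [Complex.add_im, Complex.div_ofReal_im] at h2
    simp only [slopeVec, Complex.normSq_apply] at h1 h2 hn
    simp at h1 h2 hn
    rw [← h1, ← h2]
    generalize (slopeDen s : ℝ) = D at *
    generalize (slopeNum s : ℝ) = N at *
    have hn' : D * D + N * N ≠ 0 := hn
    have e1 : D * (D / (2 * (D * D + N * N)) + t * N) - N * (-N / (2 * (D * D + N * N)) + t * D)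
        = (D * D + N * N) / (2 * (D * D + N * N)) := by ring
    rw [e1, div_eq_div_iff (mul_ne_zero two_ne_zero hn') two_ne_zero]
    ring
  have : (2 * (slopeDen s * b - slopeNum s * a) : ℤ) = 1 := by
    have : (2 * ((slopeDen s : ℝ) * b - slopeNum s * a)) = 1 := by rw [key]; norm_num
    exact_mod_cast this
  omega

namespace SlopeLine

variable {s : OnePoint ℚ} (ℓ : SlopeLine s)

/-- The point of the line at parameter `t`. -/
def at' (t : ℝ) : PuncturedPlane := ⟨ℓ.pt + t * slopeVec s, ℓ.avoids t⟩

theorem continuous_at' : Continuous ℓ.at' :=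
  Continuous.subtype_mk (by fun_prop) _

/-- The segment of the line from parameter `0` to parameter `c`. -/
def segment (c : ℝ) : Path (ℓ.at' 0) (ℓ.at' c) where
  toFun t := ℓ.at' (t * c)
  continuous_toFun := ℓ.continuous_at'.comp (by fun_prop)
  source' := by simp
  target' := by simp

theorem translate_at' : slopeTranslation s • ℓ.at' 0 = ℓ.at' 1 := by
  apply Subtype.ext
  rw [slopeTranslation_smul]
  simp [at']

theorem translate_sq_at' : slopeTranslation s ^ 2 • ℓ.at' 0 = ℓ.at' 2 := by
  apply Subtype.ext
  rw [pow_two, mul_smul, slopeTranslation_smul, slopeTranslation_smul]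
  simp [at']
  ring

theorem proj_at' : conwayProj (ℓ.at' 0) = conwayProj (ℓ.at' 2) := by
  rw [← ℓ.translate_sq_at', conwayProj_smul (slopeTranslation_sq_mem s)]

/-- The simple loop `α_s` in the Conway sphere: the image of the line, run through once. -/
def alphaLoop : Path (conwayProj (ℓ.at' 0)) (conwayProj (ℓ.at' 0)) :=
  ((ℓ.segment 2).map conwayProj.continuous).cast rfl ℓ.proj_at'

/-- The elements of `π₁` of the Conway sphere represented by the loop `α_s` by means of a path
from the base point to the loop. -/
def alphaClass (x₀ : PuncturedPlane) : Set (FundamentalGroup ConwaySphere (conwayProj x₀)) :=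
  {a | ∃ δ : Path (conwayProj x₀) (conwayProj (ℓ.at' 0)),
    a = FundamentalGroup.fromPath
      (Path.Homotopic.Quotient.mk ((δ.trans ℓ.alphaLoop).trans δ.symm))}

/-- The elements of the orbifold fundamental group of `(ℝ² - ℤ²) / Ĥ` represented by the loop
`β_s`, the image of the line run through once, by means of a path `δ` in `ℝ² - ℤ²` from the base
point to the line: go along `δ`, then along the line as far as its translate, then back along the
translate of `δ`. -/
def betaClass (x₀ : PuncturedPlane) : Set (OrbifoldPi1 bigConwayGroup x₀) :=
  {b | ∃ δ : Path x₀ (ℓ.at' 0),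
    b = ⟨⟨slopeTranslation s, slopeTranslation_mem s⟩, Path.Homotopic.Quotient.mk
      ((δ.trans (ℓ.segment 1)).trans
        ((OrbifoldPi1.movePath (slopeTranslation s) δ).symm.cast
          ℓ.translate_at'.symm rfl))⟩}

end SlopeLine

/-! ## Heckoid groups -/

/-- `⟨⟨β_∞², β_r^m⟩⟩`: the orbifold fundamental group of `(ℝ² - ℤ²) / Ĥ` modulo this subgroup is
the fundamental group of the quotient orbifold `O(r;m)`. -/
def quotientOrbifoldRelators (r : ℚ) (m : ℕ) (x₀ : PuncturedPlane) :
    Subgroup (OrbifoldPi1 bigConwayGroup x₀) :=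
  Subgroup.normalClosure
    ({b | ∃ ℓ : SlopeLine ∞, ∃ a ∈ ℓ.betaClass x₀, b = a ^ 2} ∪
     {b | ∃ ℓ : SlopeLine (r : OnePoint ℚ), ∃ a ∈ ℓ.betaClass x₀, b = a ^ m})

/-- The relators of the even Heckoid group: `α_∞` and `α_r^n`. -/
def evenRelators (r : ℚ) (n : ℕ) (x₀ : PuncturedPlane) :
    Set (FundamentalGroup ConwaySphere (conwayProj x₀)) :=
  {b | ∃ ℓ : SlopeLine ∞, b ∈ ℓ.alphaClass x₀} ∪
  {b | ∃ ℓ : SlopeLine (r : OnePoint ℚ), ∃ a ∈ ℓ.alphaClass x₀, b = a ^ n}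

/-- The relators of the odd Heckoid group: the elements of `π₁` of the Conway sphere that become
trivial in `π₁(O(r;m))`. (An element of `π₁` of the Conway sphere is regarded as an element of the
orbifold fundamental group of `(ℝ² - ℤ²) / Ĥ` by lifting loops to paths in `ℝ² - ℤ²`.) -/
def oddRelators (r : ℚ) (m : ℕ) (x₀ : PuncturedPlane) :
    Set (FundamentalGroup ConwaySphere (conwayProj x₀)) :=
  {a | ∃ (h : bigConwayGroup) (hh : (h : latticeIsometries) ∈ conwayGroup) (γ : Path x₀ (h • x₀)),
    (⟨h, Path.Homotopic.Quotient.mk γ⟩ : OrbifoldPi1 bigConwayGroup x₀) ∈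
      quotientOrbifoldRelators r m x₀ ∧
    a = FundamentalGroup.fromPath (Path.Homotopic.Quotient.mk
      ((γ.map conwayProj.continuous).cast rfl (conwayProj_smul hh x₀).symm))}

/-- The kernel of the homomorphism from `π₁` of the Conway sphere onto the Heckoid group
of index `n = m/2`. -/
def heckoidKernel (r : ℚ) (m : ℕ) (x₀ : PuncturedPlane) :
    Subgroup (FundamentalGroup ConwaySphere (conwayProj x₀)) :=
  Subgroup.normalClosure (if Even m then evenRelators r (m / 2) x₀ else oddRelators r m x₀)

instance (r : ℚ) (m : ℕ) (x₀ : PuncturedPlane) : (heckoidKernel r m x₀).Normal :=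
  Subgroup.normalClosure_normal

/-- The Heckoid group `π₁` of the Heckoid orbifold of index `n = m/2`: for even `m` it is
`π₁(S) / ⟨⟨α_∞, α_r^n⟩⟩`, with `S` the Conway sphere; for odd `m` it is the image of `π₁(S)` in
`π₁(O(r;m))`, a subgroup of index two. -/
abbrev HeckoidGroup (r : ℚ) (m : ℕ) (x₀ : PuncturedPlane) : Type :=
  FundamentalGroup ConwaySphere (conwayProj x₀) ⧸ heckoidKernel r m x₀

/-- The unoriented loops `α_s` and `α_{s'}` are homotopic in the Heckoid orbifold: their classes
in the Heckoid group are conjugate, up to orientation. -/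
def HomotopicInHeckoid (r : ℚ) (m : ℕ) (x₀ : PuncturedPlane) (s s' : OnePoint ℚ) : Prop :=
  ∀ (ℓ : SlopeLine s) (ℓ' : SlopeLine s'), ∃ a ∈ ℓ.alphaClass x₀, ∃ b ∈ ℓ'.alphaClass x₀,
    IsConj (QuotientGroup.mk a : HeckoidGroup r m x₀) (QuotientGroup.mk b) ∨
    IsConj (QuotientGroup.mk a : HeckoidGroup r m x₀) (QuotientGroup.mk b)⁻¹

/-- The loop `α_s` is null-homotopic in the Heckoid orbifold. -/
def NullHomotopicInHeckoid (r : ℚ) (m : ℕ) (x₀ : PuncturedPlane) (s : OnePoint ℚ) : Prop :=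
  ∀ ℓ : SlopeLine s, ∃ a ∈ ℓ.alphaClass x₀, (QuotientGroup.mk a : HeckoidGroup r m x₀) = 1

end

noncomputable section

/-! ## Conjugation of loops along paths in the orbifold fundamental group -/

namespace OrbifoldPi1

section Cast

variable {Y : Type*} [TopologicalSpace Y]

/-! There are two independent halves: the generators of Γ(r;n) preserve the loops, and the given set
meets every orbit exactly once.

Loops. For a basis v, w of ℤ², the half turns about o + v/2, o + w/2 and o + (v + w)/2 give an
elliptic triple (a, b, c) in π₁(𝒪) with b² = c² = 1, and c b represents β for the slope of v
(`IsTriple.mul_mem_betaClass`). Swapping the basis, negating v and adding v to w change the triple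
by fixed words. Hence two bases with triples congruent modulo a normal subgroup keep this property
under the same change of basis in SL(2,ℤ) (`TripleCongr.specialLinear`), and vectors with equal
coordinates in the two bases have congruent β up to inversion. The basis -v, w has the triple (a, (c
b)² b, c), and v, w + m v has the triple (a, (c b)^m b, (c b)^m c). So for v of slope ∞ the relator
β_∞² makes v, w congruent to -v, w, which is the reflection in an edge at ∞; for v of slope r the
relator β_r^m makes v, w congruent to v, w + m v, which is the parabolic shift. Squaring turns β_s
into α_s, and relations in π₁(𝒪) between elements over H descend to the Heckoid group
(`projElt_mem_heckoidKernel`). For even m this holds because a conjugate of β_s in the larger group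
is β_s or its inverse for another line of slope s.

Domain. Let φ and ψ be the retractions onto the fundamental domains F of Γ_∞ and J of C_r(2n),
constant on the orbits of these groups. The complement of F lies in J, because Farey edges do not
cross. It follows that x, φ x and ψ x have coinciding iterates under φ ∘ ψ, hence so do any two
points of one Γ(r;n)-orbit. The points of F ∩ J are fixed by φ ∘ ψ, which gives uniqueness
(`IsHeckoidPair.eq_of_mem_domain`). Existence is a descent on the determinant of the vectors of s
and r, which ψ preserves and φ decreases off F (`IsHeckoidPair.exists_domain_mem`). -/

theorem cast_trans_cast {x y z x' y' z' : Y} (hx : x' = x) (hy hy' : y' = y) (hz : z' = z)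
    (γ : Path.Homotopic.Quotient x y) (δ : Path.Homotopic.Quotient y z) :
    (γ.cast hx hy).trans (δ.cast hy' hz) = (γ.trans δ).cast hx hz := by
  subst hx hy hz; simp

theorem symm_cast {x y x' y' : Y} (hx : x' = x) (hy : y' = y)
    (γ : Path.Homotopic.Quotient x y) : (γ.cast hx hy).symm = γ.symm.cast hy hx := by
  subst hx hy; simp

theorem trans_refl_cast {x y z w : Y} (h : z = y) (h' : w = y)
    (γ : Path.Homotopic.Quotient x z) :
    γ.trans ((Path.Homotopic.Quotient.refl y).cast h h') = γ.cast rfl (h'.trans h.symm) := by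
  subst h h'; simp

theorem symm_symm {x y : Y} (γ : Path.Homotopic.Quotient x y) : γ.symm.symm = γ := by
  induction γ with | mk γ => ?_
  rw [← Path.Homotopic.Quotient.mk_symm, ← Path.Homotopic.Quotient.mk_symm, Path.symm_symm]

theorem symm_trans_rev {x y z : Y}
    (γ : Path.Homotopic.Quotient x y) (δ : Path.Homotopic.Quotient y z) :
    (γ.trans δ).symm = δ.symm.trans γ.symm := by
  induction γ with | mk γ => ?_
  induction δ with | mk δ => ?_
  rw [← Path.Homotopic.Quotient.mk_trans, ← Path.Homotopic.Quotient.mk_symm, Path.trans_symm]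
  rfl

theorem symm_trans_cancel_left {x y z : Y}
    (γ : Path.Homotopic.Quotient x y) (δ : Path.Homotopic.Quotient y z) :
    γ.symm.trans (γ.trans δ) = δ := by
  rw [← Path.Homotopic.Quotient.trans_assoc, Path.Homotopic.Quotient.symm_trans,
    Path.Homotopic.Quotient.refl_trans]

end Cast

variable {G X : Type*} [Group G] [TopologicalSpace X] [MulAction G X] [ContinuousConstSMul G X]
  {x₀ p q : X}

theorem moveClass_symm (g : G) {x y : X} (γ : Path.Homotopic.Quotient x y) :
    moveClass g γ.symm = (moveClass g γ).symm := by
  induction γ with | mk γ => ?_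
  rfl

theorem mul_def (a b : OrbifoldPi1 G x₀) :
    a * b = ⟨a.elt * b.elt, (a.path.trans (moveClass a.elt b.path)).cast rfl (mul_smul _ _ _)⟩ :=
  rfl

omit [ContinuousConstSMul G X] in
theorem mk_congr {k k' : G} (h : k = k') {γ : Path.Homotopic.Quotient x₀ (k • x₀)}
    {γ' : Path.Homotopic.Quotient x₀ (k' • x₀)} (h' : γ = γ'.cast rfl (congrArg (· • x₀) h)) :
    (⟨k, γ⟩ : OrbifoldPi1 G x₀) = ⟨k', γ'⟩ :=
  ext' h h'

/-- The element that goes along `δ`, then along `ε` from `p` to its translate `k • p`, and back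
along the translate of `δ`. -/
def conjPath (δ : Path.Homotopic.Quotient x₀ p) (k : G)
    (ε : Path.Homotopic.Quotient p (k • p)) : OrbifoldPi1 G x₀ :=
  ⟨k, (δ.trans ε).trans (moveClass k δ).symm⟩

theorem conjPath_congr (δ : Path.Homotopic.Quotient x₀ p) {k k' : G} (h : k = k')
    {ε : Path.Homotopic.Quotient p (k • p)} {ε' : Path.Homotopic.Quotient p (k' • p)}
    (h' : ε = ε'.cast rfl (congrArg (· • p) h)) : conjPath δ k ε = conjPath δ k' ε' := by
  subst h; subst h'; simp

/-- The return along the translate of `δ` in the first factor cancels against the outward translate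
of `δ` in the second. -/
theorem conjPath_mul (δ : Path.Homotopic.Quotient x₀ p) (k k' : G)
    (ε : Path.Homotopic.Quotient p (k • p)) (ε' : Path.Homotopic.Quotient p (k' • p)) :
    conjPath δ k ε * conjPath δ k' ε' =
      conjPath δ (k * k') ((ε.trans (moveClass k ε')).cast rfl (mul_smul k k' p)) := by
  rw [mul_def]
  refine mk_congr rfl ?_
  simp only [conjPath, moveClass_trans, moveClass_symm, moveClass_mul k k', symm_cast,
    trans_cast_comm, Path.Homotopic.Quotient.trans_assoc, symm_trans_cancel_left, cast_trans_cast]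
  simp

theorem conjPath_one (δ : Path.Homotopic.Quotient x₀ p) :
    conjPath δ (1 : G) ((Path.Homotopic.Quotient.refl p).cast rfl (one_smul G p)) = 1 := by
  change (⟨_, _⟩ : OrbifoldPi1 G x₀) = ⟨_, _⟩
  refine mk_congr rfl ?_
  simp only [moveClass_one, symm_cast, trans_cast_comm, cast_trans_cast,
    Path.Homotopic.Quotient.trans_refl, Path.Homotopic.Quotient.trans_symm]
  simp

theorem conjPath_trans (δ : Path.Homotopic.Quotient x₀ p) (η : Path.Homotopic.Quotient p q) (k : G)
    (ε : Path.Homotopic.Quotient q (k • q)) :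
    conjPath (δ.trans η) k ε = conjPath δ k ((η.trans ε).trans (moveClass k η).symm) := by
  refine mk_congr rfl ?_
  simp only [moveClass_trans, symm_trans_rev, Path.Homotopic.Quotient.trans_assoc]
  simp

theorem moveClass_comm {a g k : G} (h : a * g = g * k) {x y : X}
    (γ : Path.Homotopic.Quotient x y) :
    moveClass a (moveClass g γ) = (moveClass g (moveClass k γ)).cast
      (by rw [← mul_smul, h, mul_smul]) (by rw [← mul_smul, h, mul_smul]) := by
  induction γ with | mk γ => ?_
  simp only [moveClass_mk]
  rw [← Path.Homotopic.Quotient.mk_cast]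
  congr 1
  ext t
  change a • g • γ t = g • k • γ t
  rw [← mul_smul, h, mul_smul]

/-- The conjugated group part enters through the relation `k' * g.elt = g.elt * k`, so that `k'` can
be a recognisable isometry such as a translation or its inverse. -/
theorem conj_conjPath (g : OrbifoldPi1 G x₀) (δ : Path.Homotopic.Quotient x₀ p) {k k' : G}
    (hk : k' * g.elt = g.elt * k) (ε : Path.Homotopic.Quotient p (k • p)) :
    g * conjPath δ k ε * g⁻¹ = conjPath (g.path.trans (moveClass g.elt δ)) k'
      ((moveClass g.elt ε).cast rfl (by rw [← mul_smul, hk, mul_smul])) := by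
  rw [mul_inv_eq_iff_eq_mul, mul_def, mul_def]
  refine mk_congr hk.symm ?_
  simp only [conjPath, moveClass_trans, moveClass_symm, symm_trans_rev, moveClass_comm hk,
    symm_cast, trans_cast_comm, cast_trans_comm, Path.Homotopic.Quotient.trans_assoc,
    Path.Homotopic.Quotient.symm_trans, trans_refl_cast,
    Path.Homotopic.Quotient.cast_cast, Path.Homotopic.Quotient.cast_rfl_rfl]
  exact ((Path.Homotopic.Quotient.cast_cast (X := X) _ _ _ _ _).trans
    (Path.Homotopic.Quotient.cast_cast (X := X) _ _ _ _ _)).symm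

end OrbifoldPi1
end

noncomputable section

/-! ## Straight paths in the punctured plane -/

open OrbifoldPi1

/-- The straight-line homotopy stays in `C`. The sets used below are open strips between lattice
lines, and lines. -/
theorem homotopic_of_mem_convex {C : Set ℂ} (hC : Convex ℝ C)
    (hL : ∀ z ∈ C, z ∉ planeLattice) {x y : PuncturedPlane} (γ γ' : Path x y)
    (h : ∀ t, (γ t : ℂ) ∈ C) (h' : ∀ t, (γ' t : ℂ) ∈ C) : γ.Homotopic γ' := by
  refine ⟨⟨⟨⟨fun z => ⟨AffineMap.lineMap (γ z.2 : ℂ) (γ' z.2 : ℂ) (z.1 : ℝ),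
    hL _ (hC.lineMap_mem (h _) (h' _) z.1.2)⟩, ?_⟩, ?_, ?_⟩, ?_⟩⟩
  · refine Continuous.subtype_mk ?_ _
    simp only [AffineMap.lineMap_apply_module]
    fun_prop
  · intro t; apply Subtype.ext; simp
  · intro t; apply Subtype.ext; simp
  · intro s t ht
    apply Subtype.ext
    rcases ht with rfl | rfl <;> simp

/-- The straight segment between two points avoids the lattice. -/
def SegAvoids (x y : PuncturedPlane) : Prop :=
  ∀ t ∈ Set.Icc (0 : ℝ) 1, AffineMap.lineMap (x : ℂ) (y : ℂ) t ∉ planeLattice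

theorem SegAvoids.of_convex {C : Set ℂ} (hC : Convex ℝ C)
    (hL : ∀ z ∈ C, z ∉ planeLattice) {x y : PuncturedPlane} (hx : (x : ℂ) ∈ C)
    (hy : (y : ℂ) ∈ C) : SegAvoids x y :=
  fun _ ht => hL _ (hC.lineMap_mem hx hy ht)

/-- The straight path between two points. -/
def segPath {x y : PuncturedPlane} (h : SegAvoids x y) : Path x y where
  toFun t := ⟨AffineMap.lineMap (x : ℂ) (y : ℂ) (t : ℝ), h t t.2⟩
  continuous_toFun := by
    refine Continuous.subtype_mk ?_ _
    simp only [AffineMap.lineMap_apply_module]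
    fun_prop
  source' := by apply Subtype.ext; simp
  target' := by apply Subtype.ext; simp

/-- The homotopy class of the straight path between two points. -/
def segClass {x y : PuncturedPlane} (h : SegAvoids x y) : Path.Homotopic.Quotient x y :=
  Path.Homotopic.Quotient.mk (segPath h)

theorem segClass_cast {x y x' y' : PuncturedPlane} (h : SegAvoids x y) (hx : x' = x)
    (hy : y' = y) : (segClass h).cast hx hy = segClass (hx ▸ hy ▸ h : SegAvoids x' y') := by
  subst hx hy; simp

theorem segAvoids_smul {x y : PuncturedPlane} (h : SegAvoids x y) (k : latticeIsometries) :
    SegAvoids (k • x) (k • y) := by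
  intro t ht
  have := h t ht
  rw [← k.2] at this
  convert this using 2
  exact (AffineMap.apply_lineMap k.1.toAffineEquiv.toAffineMap (x : ℂ) (y : ℂ) t).symm

theorem segAvoids_smul_sub {x y : PuncturedPlane} (h : SegAvoids x y) (k : bigConwayGroup) :
    SegAvoids (k • x) (k • y) :=
  segAvoids_smul h k

theorem moveClass_segClass {x y : PuncturedPlane} (h : SegAvoids x y) (k : bigConwayGroup) :
    moveClass k (segClass h) = segClass (segAvoids_smul_sub h k) := by
  rw [segClass, moveClass_mk]
  refine congrArg _ ?_
  ext t
  exact AffineMap.apply_lineMap k.1.1.toAffineEquiv.toAffineMap (x : ℂ) (y : ℂ) (t : ℝ)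

theorem segPath_mem {C : Set ℂ} (hC : Convex ℝ C) {x y : PuncturedPlane} (h : SegAvoids x y)
    (hx : (x : ℂ) ∈ C) (hy : (y : ℂ) ∈ C) (t : unitInterval) : (segPath h t : ℂ) ∈ C :=
  hC.lineMap_mem hx hy t.2

theorem segClass_trans {C : Set ℂ} (hC : Convex ℝ C)
    (hL : ∀ z ∈ C, z ∉ planeLattice) {x y z : PuncturedPlane} (hx : (x : ℂ) ∈ C)
    (hy : (y : ℂ) ∈ C) (hz : (z : ℂ) ∈ C) (hxy : SegAvoids x y) (hyz : SegAvoids y z)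
    (hxz : SegAvoids x z) : (segClass hxy).trans (segClass hyz) = segClass hxz := by
  rw [segClass, segClass, ← Path.Homotopic.Quotient.mk_trans]
  refine Path.Homotopic.Quotient.eq.2 (homotopic_of_mem_convex hC hL _ _ (fun t => ?_)
    (segPath_mem hC _ hx hz))
  rw [Path.trans_apply]
  split_ifs
  · exact segPath_mem hC _ hx hy _
  · exact segPath_mem hC _ hy hz _

theorem segClass_symm {x y : PuncturedPlane} (h : SegAvoids x y) (h' : SegAvoids y x) :
    (segClass h).symm = segClass h' := by
  rw [segClass, ← Path.Homotopic.Quotient.mk_symm]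
  refine congrArg _ ?_
  ext t
  change AffineMap.lineMap (x : ℂ) (y : ℂ) (1 - (t : ℝ)) = AffineMap.lineMap (y : ℂ) (x : ℂ) (t : ℝ)
  rw [AffineMap.lineMap_apply_one_sub]

theorem SegAvoids.refl (x : PuncturedPlane) : SegAvoids x x := fun t _ => by
  rw [AffineMap.lineMap_same_apply]; exact x.2

theorem segClass_self {x : PuncturedPlane} (h : SegAvoids x x) :
    segClass h = Path.Homotopic.Quotient.refl x := by
  rw [segClass, ← Path.Homotopic.Quotient.mk_refl]
  refine congrArg _ ?_
  ext t
  simp [segPath]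

theorem segClass_congr {x y y' : PuncturedPlane} (h : SegAvoids x y) (h' : SegAvoids x y')
    (e : y = y') : segClass h = (segClass h').cast rfl e := by
  subst e; simp

/-- The element that goes along `δ`, along the straight path from `p` to its translate, and back
along the translate of `δ`. -/
def straightElt {x₀ p : PuncturedPlane} (δ : Path.Homotopic.Quotient x₀ p) (k : bigConwayGroup)
    (h : SegAvoids p (k • p)) : OrbifoldPi1 bigConwayGroup x₀ :=
  conjPath δ k (segClass h)

section Straight

variable {x₀ p q : PuncturedPlane} {C : Set ℂ}

theorem straightElt_congr (δ : Path.Homotopic.Quotient x₀ p) {k k' : bigConwayGroup} (e : k = k')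
    (h : SegAvoids p (k • p)) (h' : SegAvoids p (k' • p)) :
    straightElt δ k h = straightElt δ k' h' := by
  subst e; rfl

/-- The product follows p, k p, k k' p. As all three points lie in the lattice-free convex set `C`,
the broken path straightens. -/
theorem straightElt_mul (hC : Convex ℝ C) (hL : ∀ z ∈ C, z ∉ planeLattice)
    (δ : Path.Homotopic.Quotient x₀ p) {k k' : bigConwayGroup}
    (h : SegAvoids p (k • p)) (h' : SegAvoids p (k' • p)) (h'' : SegAvoids p ((k * k') • p))
    (hp : (p : ℂ) ∈ C) (hkp : ((k • p : PuncturedPlane) : ℂ) ∈ C)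
    (hkkp : (((k * k') • p : PuncturedPlane) : ℂ) ∈ C) :
    straightElt δ k h * straightElt δ k' h' = straightElt δ (k * k') h'' := by
  rw [straightElt, straightElt, conjPath_mul]
  refine conjPath_congr δ rfl ?_
  rw [moveClass_segClass, segClass_trans hC hL hp hkp (by rwa [← mul_smul]) _ _
    (by rwa [← mul_smul]), segClass_cast]
  simp

theorem straightElt_one (δ : Path.Homotopic.Quotient x₀ p)
    (h : SegAvoids p ((1 : bigConwayGroup) • p)) : straightElt δ 1 h = 1 := by
  rw [← conjPath_one δ, straightElt]
  refine conjPath_congr δ rfl ?_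
  rw [Path.Homotopic.Quotient.cast_cast, ← segClass_self (SegAvoids.refl p), segClass_cast]

/-- The quadrilateral p, q, k q, k p lies in `C`, so the end point of `δ` can slide from p to q. -/
theorem straightElt_trans (hC : Convex ℝ C) (hL : ∀ z ∈ C, z ∉ planeLattice)
    (δ : Path.Homotopic.Quotient x₀ p) (hpq : SegAvoids p q) {k : bigConwayGroup}
    (h : SegAvoids p (k • p)) (h' : SegAvoids q (k • q))
    (hp : (p : ℂ) ∈ C) (hq : (q : ℂ) ∈ C) (hkp : ((k • p : PuncturedPlane) : ℂ) ∈ C)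
    (hkq : ((k • q : PuncturedPlane) : ℂ) ∈ C) :
    straightElt (δ.trans (segClass hpq)) k h' = straightElt δ k h := by
  have hC' := fun {x y : PuncturedPlane} (hx : (x : ℂ) ∈ C) (hy : (y : ℂ) ∈ C) =>
    SegAvoids.of_convex hC hL hx hy
  rw [straightElt, straightElt, conjPath_trans, moveClass_segClass,
    segClass_symm _ (hC' hkq hkp), segClass_trans hC hL hp hq hkq _ _ (hC' hp hkq),
    segClass_trans hC hL hp hkq hkp _ _ h]

theorem conj_straightElt (g : OrbifoldPi1 bigConwayGroup x₀)
    (δ : Path.Homotopic.Quotient x₀ p) {k k' : bigConwayGroup} (hk : k' * g.elt = g.elt * k)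
    (h : SegAvoids p (k • p)) (h' : SegAvoids (g.elt • p) (k' • g.elt • p)) :
    g * straightElt δ k h * g⁻¹ = straightElt (g.path.trans (moveClass g.elt δ)) k' h' := by
  rw [straightElt, conj_conjPath g δ hk, straightElt, moveClass_segClass, segClass_cast]

end Straight
end

noncomputable section

/-! ## Half turns and strips -/

open OrbifoldPi1

theorem isPathConnected_compl_planeLattice : IsPathConnected {z : ℂ | z ∉ planeLattice} := by
  refine Set.Countable.isPathConnected_compl_of_one_lt_rank (by simp) ?_ (s := (planeLattice : Set ℂ))
  refine (Set.countable_range (fun p : ℤ × ℤ => (p.1 + p.2 * Complex.I : ℂ))).mono ?_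
  rintro _ ⟨a, b, rfl⟩
  exact ⟨(a, b), rfl⟩

instance : PathConnectedSpace PuncturedPlane :=
  isPathConnected_iff_pathConnectedSpace.1 isPathConnected_compl_planeLattice

theorem bigConwayGroup_ext {k k' : bigConwayGroup}
    (h : ∀ z : ℂ, (k : latticeIsometries).1 z = (k' : latticeIsometries).1 z) : k = k' :=
  Subtype.ext (Subtype.ext (AffineIsometryEquiv.ext h))

/-- The half turn `z ↦ a - z` for a lattice vector `a`. -/
def halfRot (a : planeLattice) : bigConwayGroup :=
  ⟨halfTurn ((a : ℂ) / 2) (by rw [add_halves]; exact a.2), Subgroup.subset_closure ⟨_, _, rfl⟩⟩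

theorem halfTurn_apply (c : ℂ) (hc : c + c ∈ planeLattice) (z : ℂ) :
    (halfTurn c hc).1 z = c + c - z := by
  change AffineIsometryEquiv.pointReflection ℝ c z = _
  rw [AffineIsometryEquiv.pointReflection_apply, vsub_eq_sub, vadd_eq_add]; ring

theorem halfRot_apply (a : planeLattice) (z : ℂ) :
    (halfRot a : latticeIsometries).1 z = a - z := by
  have := halfTurn_apply ((a : ℂ) / 2) (by rw [add_halves]; exact a.2) z
  exact this.trans (by rw [add_halves])

theorem halfRot_smul (a : planeLattice) (x : PuncturedPlane) :
    ((halfRot a • x : PuncturedPlane) : ℂ) = a - x :=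
  halfRot_apply a x

theorem halfRot_mul_self (a : planeLattice) : halfRot a * halfRot a = 1 :=
  bigConwayGroup_ext fun z => by
    change (halfRot a : latticeIsometries).1 ((halfRot a : latticeIsometries).1 z) = z
    rw [halfRot_apply, halfRot_apply]; ring

theorem halfRot_mul_mul (a b c d : planeLattice) (h : d = a - b + c) :
    halfRot a * halfRot b * halfRot c = halfRot d :=
  bigConwayGroup_ext fun z => by
    change (halfRot a : latticeIsometries).1 ((halfRot b : latticeIsometries).1
      ((halfRot c : latticeIsometries).1 z)) = _
    simp only [halfRot_apply, h, AddSubgroup.coe_add, AddSubgroup.coe_sub]; ring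

theorem slopeTranslation_apply (s : OnePoint ℚ) (z : ℂ) :
    (slopeTranslation s).1 z = z + slopeVec s := by
  change AffineIsometryEquiv.pointReflection ℝ (slopeVec s / 2)
    (AffineIsometryEquiv.pointReflection ℝ 0 z) = _
  simp only [AffineIsometryEquiv.pointReflection_apply, vsub_eq_sub, vadd_eq_add]; ring

theorem halfRot_mul_eq_slopeTranslation (a b : planeLattice) (s : OnePoint ℚ)
    (h : (a : ℂ) - b = slopeVec s) :
    halfRot a * halfRot b = ⟨slopeTranslation s, slopeTranslation_mem s⟩ :=
  bigConwayGroup_ext fun z => by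
    change (halfRot a : latticeIsometries).1 ((halfRot b : latticeIsometries).1 z) =
      (slopeTranslation s).1 z
    rw [slopeTranslation_apply, halfRot_apply, halfRot_apply, ← h]; ring

/-- The determinant of two plane vectors. -/
def planeDet (z w : ℂ) : ℝ := z.re * w.im - z.im * w.re

theorem planeDet_int {z w : ℂ} (hz : z ∈ planeLattice) (hw : w ∈ planeLattice) :
    ∃ n : ℤ, planeDet z w = n := by
  obtain ⟨a, b, rfl⟩ := hz
  obtain ⟨c, d, rfl⟩ := hw
  exact ⟨a * d - b * c, by simp [planeDet]⟩

/-- The open strip of the points `o + α v + β w` with `0 < β < 1`, where `D` is the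
determinant `±1` of `v` and `w`. -/
def strip (v o : ℂ) (D : ℝ) : Set ℂ :=
  {z | 0 < D * planeDet v (z - o) ∧ D * planeDet v (z - o) < 1}

theorem convex_strip (v o : ℂ) (D : ℝ) : Convex ℝ (strip v o D) := by
  rintro x ⟨hx, hx'⟩ y ⟨hy, hy'⟩ a b ha hb hab
  have e : D * planeDet v (a • x + b • y - o) =
      a * (D * planeDet v (x - o)) + b * (D * planeDet v (y - o)) := by
    obtain rfl : a = 1 - b := by linarith
    simp [planeDet]; ring
  constructor
  · rw [e]
    rcases ha.eq_or_lt with rfl | ha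
    · rw [zero_add] at hab; subst hab; simpa using hy
    · nlinarith [mul_pos ha hx, mul_nonneg hb hy.le]
  · rw [e]
    rcases ha.eq_or_lt with rfl | ha
    · rw [zero_add] at hab; subst hab; simpa using hy'
    · nlinarith [mul_lt_mul_of_pos_left hx' ha, mul_le_mul_of_nonneg_left hy'.le hb]

/-- At a lattice point the transverse coordinate `D * planeDet v (z - o)` is an integer, and no
integer lies strictly between 0 and 1. -/
theorem strip_avoids {v o : ℂ} {D : ℝ} (hv : v ∈ planeLattice) (ho : o ∈ planeLattice)
    (hD : D = 1 ∨ D = -1) : ∀ z ∈ strip v o D, z ∉ planeLattice := by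
  rintro z ⟨h0, h1⟩ hz
  obtain ⟨n, hn⟩ := planeDet_int hv (planeLattice.sub_mem hz ho)
  rw [hn] at h0 h1
  rcases hD with rfl | rfl
  · rw [one_mul] at h0 h1
    have h0' : 0 < n := by exact_mod_cast h0
    have h1' : n < 1 := by exact_mod_cast h1
    omega
  · have h0' : 0 < -n := by
      have : (0 : ℝ) < ((-n : ℤ) : ℝ) := by push_cast; linarith
      exact_mod_cast this
    have h1' : -n < 1 := by
      have : ((-n : ℤ) : ℝ) < 1 := by push_cast; linarith
      exact_mod_cast this
    omega

theorem mem_strip {v w o z : ℂ} {α β : ℝ} (hD : planeDet v w = 1 ∨ planeDet v w = -1)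
    (hz : z = o + α * v + β * w) (h0 : 0 < β) (h1 : β < 1) : z ∈ strip v o (planeDet v w) := by
  have e : planeDet v w * planeDet v (z - o) = β := by
    have : planeDet v (z - o) = β * planeDet v w := by
      subst hz; simp [planeDet]; ring
    rw [this]
    rcases hD with h | h <;> rw [h] <;> ring
  exact ⟨by rwa [e], by rwa [e]⟩

theorem mem_strip' {v w o z : ℂ} {α β : ℝ} (hD : planeDet v w = 1 ∨ planeDet v w = -1)
    (hz : z = o + α * v + β * w) (h0 : 0 < α) (h1 : α < 1) : z ∈ strip w o (planeDet w v) :=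
  mem_strip (α := β) (β := α) (by
    have : planeDet w v = - planeDet v w := by simp [planeDet]; ring
    rw [this]
    rcases hD with h | h <;> rw [h] <;> simp) (by rw [hz]; ring) h0 h1

/-! ## Elliptic triples -/

/-- `v`, `w` is a basis of the lattice `ℤ²`. -/
def IsUnimodular (v w : ℂ) : Prop := planeDet v w = 1 ∨ planeDet v w = -1

theorem IsUnimodular.swap {v w : ℂ} (h : IsUnimodular v w) : IsUnimodular w v := by
  have : planeDet w v = - planeDet v w := by simp [planeDet]; ring
  rw [IsUnimodular, this]
  rcases h with h | h <;> rw [h] <;> simp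

theorem IsUnimodular.neg_left {v w : ℂ} (h : IsUnimodular v w) : IsUnimodular (-v) w := by
  have : planeDet (-v) w = - planeDet v w := by simp [planeDet]; ring
  rw [IsUnimodular, this]
  rcases h with h | h <;> rw [h] <;> simp

theorem IsUnimodular.add_right {v w : ℂ} (h : IsUnimodular v w) : IsUnimodular v (v + w) := by
  have : planeDet v (v + w) = planeDet v w := by simp [planeDet]; ring
  rwa [IsUnimodular, this]

/-- The half turns about `o + v/2`, `o + w/2`, `o + (v + w)/2`, as elements of the orbifold
fundamental group, by means of a path `δ` to the point `x = o + α v + β w` of the open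
parallelogram at `o` and of straight paths from `x`. -/
structure IsTripleAt {x₀ : PuncturedPlane} (v w o : planeLattice) (α β : ℝ) (x : PuncturedPlane)
    (δ : Path.Homotopic.Quotient x₀ x) (a b c : OrbifoldPi1 bigConwayGroup x₀) : Prop where
  unimodular : IsUnimodular v w
  left_pos : 0 < α
  left_lt : α < 1
  right_pos : 0 < β
  right_lt : β < 1
  coe_eq : (x : ℂ) = o + α * v + β * w
  fst : ∃ h, a = straightElt δ (halfRot (o + o + v)) h
  snd : ∃ h, b = straightElt δ (halfRot (o + o + w)) h
  thd : ∃ h, c = straightElt δ (halfRot (o + o + v + w)) h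

/-- The elliptic triples associated with a basis of the lattice. -/
def IsTriple {x₀ : PuncturedPlane} (v w : planeLattice) (a b c : OrbifoldPi1 bigConwayGroup x₀) :
    Prop :=
  ∃ (o : planeLattice) (α β : ℝ) (x : PuncturedPlane) (δ : Path.Homotopic.Quotient x₀ x),
    IsTripleAt v w o α β x δ a b c

section Triple

variable {x₀ : PuncturedPlane} {v w o : planeLattice} {a b c : OrbifoldPi1 bigConwayGroup x₀}

theorem exists_coord (h : IsUnimodular v w) (o : planeLattice) {α β : ℝ} (h0 : 0 < β)
    (h1 : β < 1) : ∃ x : PuncturedPlane, (x : ℂ) = o + α * v + β * w :=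
  ⟨⟨o + α * v + β * w, strip_avoids v.2 o.2 h _ (mem_strip h rfl h0 h1)⟩, rfl⟩

/-- The half turns about o + w/2 and o + (v + w)/2 send β to 1 - β and so preserve the strip along
v; the one about o + v/2 sends α to 1 - α and preserves the strip along w. This is why computations
with b and c use the first strip and those with a use the second. -/
theorem halfRot_snd_smul {x : PuncturedPlane} {α β : ℝ} (hx : (x : ℂ) = o + α * v + β * w) :
    ((halfRot (o + o + w) • x : PuncturedPlane) : ℂ) =
      o + ((-α : ℝ) : ℂ) * v + ((1 - β : ℝ) : ℂ) * w := by
  rw [halfRot_smul, hx]; push_cast; ring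

theorem halfRot_thd_smul {x : PuncturedPlane} {α β : ℝ} (hx : (x : ℂ) = o + α * v + β * w) :
    ((halfRot (o + o + v + w) • x : PuncturedPlane) : ℂ) =
      o + ((1 - α : ℝ) : ℂ) * v + ((1 - β : ℝ) : ℂ) * w := by
  rw [halfRot_smul, hx]; push_cast; ring

theorem halfRot_fst_smul {x : PuncturedPlane} {α β : ℝ} (hx : (x : ℂ) = o + α * v + β * w) :
    ((halfRot (o + o + v) • x : PuncturedPlane) : ℂ) =
      o + ((1 - α : ℝ) : ℂ) * v + ((-β : ℝ) : ℂ) * w := by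
  rw [halfRot_smul, hx]; push_cast; ring

theorem exists_isTriple (x₀ : PuncturedPlane) {v w : planeLattice} (h : IsUnimodular v w) :
    ∃ a b c : OrbifoldPi1 bigConwayGroup x₀, IsTriple v w a b c := by
  obtain ⟨x, hx⟩ := exists_coord h 0 (α := 1 / 2) (β := 1 / 2) (by norm_num) (by norm_num)
  obtain ⟨δ⟩ := PathConnectedSpace.joined x₀ x
  have hC := @SegAvoids.of_convex _ (convex_strip v (0 : planeLattice) (planeDet v w))
    (strip_avoids v.2 (0 : planeLattice).2 h)
  have hC' := @SegAvoids.of_convex _ (convex_strip w (0 : planeLattice) (planeDet w v))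
    (strip_avoids w.2 (0 : planeLattice).2 h.swap)
  exact ⟨_, _, _, 0, 1 / 2, 1 / 2, x, Path.Homotopic.Quotient.mk δ, h, by norm_num, by norm_num,
    by norm_num, by norm_num, hx,
    ⟨hC' (mem_strip' h hx (by norm_num) (by norm_num))
      (mem_strip' h (halfRot_fst_smul hx) (by norm_num) (by norm_num)), rfl⟩,
    ⟨hC (mem_strip h hx (by norm_num) (by norm_num))
      (mem_strip h (halfRot_snd_smul hx) (by norm_num) (by norm_num)), rfl⟩,
    ⟨hC (mem_strip h hx (by norm_num) (by norm_num))
      (mem_strip h (halfRot_thd_smul hx) (by norm_num) (by norm_num)), rfl⟩⟩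

/-- Sliding inside the open parallelogram does not change the triple: the paths for a stay in the
strip along w, those for b and c in the strip along v. -/
theorem IsTripleAt.exists_at {α β : ℝ} {x : PuncturedPlane} {δ : Path.Homotopic.Quotient x₀ x}
    (t : IsTripleAt v w o α β x δ a b c) {α' β' : ℝ} (hα : 0 < α') (hα' : α' < 1) (hβ : 0 < β')
    (hβ' : β' < 1) : ∃ (y : PuncturedPlane) (η : Path.Homotopic.Quotient x₀ y),
      IsTripleAt v w o α' β' y η a b c := by
  obtain ⟨h, h1, h2, h3, h4, hx, ⟨ka, ea⟩, ⟨kb, eb⟩, ⟨kc, ec⟩⟩ := t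
  obtain ⟨y, hy⟩ := exists_coord h o (α := α') hβ hβ'
  have hS := convex_strip v o (planeDet v w)
  have hL := strip_avoids v.2 o.2 h
  have hS' := convex_strip w o (planeDet w v)
  have hL' := strip_avoids w.2 o.2 h.swap
  have mx := mem_strip h hx h3 h4
  have my := mem_strip h hy hβ hβ'
  have mx' := mem_strip' h hx h1 h2
  have my' := mem_strip' h hy hα hα'
  have hxy := SegAvoids.of_convex hS hL mx my
  have ax := mem_strip' h (halfRot_fst_smul hx) (by linarith) (by linarith)
  have ay := mem_strip' h (halfRot_fst_smul hy) (by linarith) (by linarith)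
  have bx := mem_strip h (halfRot_snd_smul hx) (by linarith) (by linarith)
  have by' := mem_strip h (halfRot_snd_smul hy) (by linarith) (by linarith)
  have cx := mem_strip h (halfRot_thd_smul hx) (by linarith) (by linarith)
  have cy := mem_strip h (halfRot_thd_smul hy) (by linarith) (by linarith)
  refine ⟨y, δ.trans (segClass hxy), h, hα, hα', hβ, hβ', hy, ⟨.of_convex hS' hL' my' ay, ?_⟩,
    ⟨.of_convex hS hL my by', ?_⟩, ⟨.of_convex hS hL my cy, ?_⟩⟩
  · rw [ea, straightElt_trans hS' hL' δ hxy ka _ mx' my' ax ay]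
  · rw [eb, straightElt_trans hS hL δ hxy kb _ mx my bx by']
  · rw [ec, straightElt_trans hS hL δ hxy kc _ mx my cx cy]

/-- The path visits the points with coordinates (α, β), (1 - α, 1 - β), (1 + α, β), (2 - α, 1 - β),
all in the strip along v, so it straightens to the path of the half turn about o + v + w/2. -/
theorem IsTripleAt.exists_thd_mul_snd_mul_thd {α β : ℝ} {x : PuncturedPlane}
    {δ : Path.Homotopic.Quotient x₀ x} (t : IsTripleAt v w o α β x δ a b c) :
    ∃ h, c * b * c = straightElt δ (halfRot (o + o + v + v + w)) h := by
  obtain ⟨h, h1, h2, h3, h4, hx, ⟨ka, ea⟩, ⟨kb, eb⟩, ⟨kc, ec⟩⟩ := t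
  have hS := convex_strip v o (planeDet v w)
  have hL := strip_avoids v.2 o.2 h
  have mx := mem_strip h hx h3 h4
  have cx := mem_strip h (halfRot_thd_smul hx) (by linarith) (by linarith)
  have cbx := mem_strip h (z := ((halfRot (o + o + v + w) * halfRot (o + o + w)) • x :
    PuncturedPlane)) (o := o) (α := 1 + α) (β := β) (by
      rw [mul_smul, halfRot_smul, halfRot_smul, hx]; push_cast; ring) h3 h4
  have e : halfRot (o + o + v + w) * halfRot (o + o + w) * halfRot (o + o + v + w) =
      halfRot (o + o + v + v + w) := halfRot_mul_mul _ _ _ _ (by abel)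
  have cbcx := mem_strip h (z := ((halfRot (o + o + v + w) * halfRot (o + o + w) *
    halfRot (o + o + v + w)) • x : PuncturedPlane)) (o := o) (α := 2 - α) (β := 1 - β) (by
      rw [e, halfRot_smul, hx]; push_cast; ring) (by linarith) (by linarith)
  rw [eb, ec, straightElt_mul hS hL δ kc kb (.of_convex hS hL mx cbx) mx cx cbx,
    straightElt_mul hS hL δ _ kc (.of_convex hS hL mx cbcx) mx cbx cbcx]
  exact ⟨_, straightElt_congr δ e _ (by rw [← e]; exact .of_convex hS hL mx cbcx)⟩

theorem IsTripleAt.sq_eq_one {α β : ℝ} {x : PuncturedPlane}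
    {δ : Path.Homotopic.Quotient x₀ x} (t : IsTripleAt v w o α β x δ a b c) :
    b * b = 1 ∧ c * c = 1 := by
  obtain ⟨h, h1, h2, h3, h4, hx, ⟨ka, ea⟩, ⟨kb, eb⟩, ⟨kc, ec⟩⟩ := t
  have hS := convex_strip v o (planeDet v w)
  have hL := strip_avoids v.2 o.2 h
  have mx := mem_strip h hx h3 h4
  have cx := mem_strip h (halfRot_thd_smul hx) (by linarith) (by linarith)
  have bx := mem_strip h (halfRot_snd_smul hx) (by linarith) (by linarith)
  have key : ∀ (d : planeLattice) (k : SegAvoids x (halfRot d • x)),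
      ((halfRot d • x : PuncturedPlane) : ℂ) ∈ strip v o (planeDet v w) →
      straightElt δ (halfRot d) k * straightElt δ (halfRot d) k = 1 := by
    intro d k m
    have e := halfRot_mul_self d
    have m1 : (((halfRot d * halfRot d) • x : PuncturedPlane) : ℂ) ∈ strip v o (planeDet v w) := by
      rw [e, one_smul]; exact mx
    rw [straightElt_mul hS hL δ k k (.of_convex hS hL mx m1) mx m m1,
      straightElt_congr δ e _ (by rw [one_smul]; exact .refl x), straightElt_one]
  exact ⟨eb ▸ key _ kb bx, ec ▸ key _ kc cx⟩

theorem IsTriple.sq_eq_one (t : IsTriple v w a b c) : b * b = 1 ∧ c * c = 1 := by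
  obtain ⟨o, α, β, x, δ, t⟩ := t
  exact t.sq_eq_one

theorem IsTriple.swap (t : IsTriple v w a b c) : IsTriple w v b a c := by
  obtain ⟨o, α, β, x, δ, t⟩ := t
  refine ⟨o, β, α, x, δ, t.unimodular.swap, t.right_pos, t.right_lt, t.left_pos, t.left_lt, ?_,
    t.snd, t.fst, ?_⟩
  · rw [t.coe_eq]; ring
  · rw [add_right_comm]; exact t.thd

/-- The parallelogram is the same one, seen from its corner o + v. The midpoint of its side along w
there is o + v + w/2, the centre of c b c. -/
theorem IsTriple.neg_left (t : IsTriple v w a b c) : IsTriple (-v) w a (c * b * c) c := by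
  obtain ⟨o, α, β, x, δ, t⟩ := t
  refine ⟨o + v, 1 - α, β, x, δ, t.unimodular.neg_left, by linarith [t.left_lt],
    by linarith [t.left_pos], t.right_pos, t.right_lt, ?_, ?_, ?_, ?_⟩
  · rw [t.coe_eq]; push_cast; ring
  · rw [show o + v + (o + v) + -v = o + o + v by abel]; exact t.fst
  · rw [show o + v + (o + v) + w = o + o + v + v + w by abel]
    exact t.exists_thd_mul_snd_mul_thd
  · rw [show o + v + (o + v) + -v + w = o + o + v + w by abel]; exact t.thd

/-- The half turns of the sheared parallelogram at o are about o + v/2, o + (v + w)/2 and o + v +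
w/2. -/
theorem IsTriple.add_right (t : IsTriple v w a b c) : IsTriple v (v + w) a c (c * b * c) := by
  obtain ⟨o, α, β, x, δ, t⟩ := t
  -- The base point must lie in both parallelograms: 3/4 v + 1/4 w = 1/2 v + 1/4 (v + w).
  obtain ⟨y, η, t⟩ := t.exists_at (α' := 3 / 4) (β' := 1 / 4) (by norm_num) (by norm_num)
    (by norm_num) (by norm_num)
  refine ⟨o, 1 / 2, 1 / 4, y, η, t.unimodular.add_right, by norm_num, by norm_num, by norm_num,
    by norm_num, ?_, t.fst, ?_, ?_⟩
  · rw [t.coe_eq]; push_cast; ring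
  · rw [← add_assoc]; exact t.thd
  · rw [← add_assoc]; exact t.exists_thd_mul_snd_mul_thd

end Triple
end

noncomputable section

/-! ## Loops of slope `s` from elliptic triples -/

open OrbifoldPi1

theorem slopeLine_segAvoids {s : OnePoint ℚ} (ℓ : SlopeLine s) (c d : ℝ) :
    SegAvoids (ℓ.at' c) (ℓ.at' d) := by
  intro t _
  have := ℓ.avoids (c + t * (d - c))
  convert this using 2
  simp only [AffineMap.lineMap_apply, vsub_eq_sub, vadd_eq_add, SlopeLine.at', Complex.real_smul]
  push_cast; ring

theorem mk_segment {s : OnePoint ℚ} (ℓ : SlopeLine s) (c : ℝ) :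
    Path.Homotopic.Quotient.mk (ℓ.segment c) = segClass (slopeLine_segAvoids ℓ 0 c) := by
  rw [segClass]
  refine congrArg _ ?_
  ext t
  change ℓ.pt + ((t * c : ℝ) : ℂ) * slopeVec s = AffineMap.lineMap (ℓ.pt + ((0 : ℝ) : ℂ) * slopeVec s)
    (ℓ.pt + (c : ℂ) * slopeVec s) (t : ℝ)
  simp only [AffineMap.lineMap_apply, vsub_eq_sub, vadd_eq_add, Complex.real_smul]
  push_cast; ring

/-- Translates the definition of β into straight elements, with the starting point allowed to be any
x whose complex coordinate is `ℓ.pt`. -/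
theorem mem_betaClass_iff {x₀ : PuncturedPlane} {s : OnePoint ℚ} (ℓ : SlopeLine s)
    (b : OrbifoldPi1 bigConwayGroup x₀) :
    b ∈ ℓ.betaClass x₀ ↔ ∃ (x : PuncturedPlane) (_ : (x : ℂ) = ℓ.pt)
      (δ : Path.Homotopic.Quotient x₀ x) (h : _),
      b = straightElt δ ⟨slopeTranslation s, slopeTranslation_mem s⟩ h := by
  have key : ∀ δ : Path x₀ (ℓ.at' 0), ∀ h,
      (⟨⟨slopeTranslation s, slopeTranslation_mem s⟩, Path.Homotopic.Quotient.mk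
      ((δ.trans (ℓ.segment 1)).trans
        ((OrbifoldPi1.movePath (slopeTranslation s) δ).symm.cast
          ℓ.translate_at'.symm rfl))⟩ : OrbifoldPi1 bigConwayGroup x₀) =
      straightElt (Path.Homotopic.Quotient.mk δ)
        ⟨slopeTranslation s, slopeTranslation_mem s⟩ h := by
    intro δ h
    refine mk_congr rfl ?_
    have e : segClass h = (Path.Homotopic.Quotient.mk (ℓ.segment 1)).cast rfl ℓ.translate_at' := by
      rw [mk_segment, segClass_cast]
    rw [e, moveClass_mk, Path.Homotopic.Quotient.mk_trans, Path.Homotopic.Quotient.mk_trans,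
      Path.Homotopic.Quotient.mk_cast, Path.Homotopic.Quotient.mk_symm]
    rw [trans_cast_comm, cast_trans_comm, Path.Homotopic.Quotient.cast_cast]
    rfl
  have h0 : SegAvoids (ℓ.at' 0) ((⟨slopeTranslation s, slopeTranslation_mem s⟩ : bigConwayGroup) •
      ℓ.at' 0) := by
    have := slopeLine_segAvoids ℓ 0 1
    rw [← ℓ.translate_at'] at this
    exact this
  constructor
  · rintro ⟨δ, rfl⟩
    exact ⟨ℓ.at' 0, by simp [SlopeLine.at'], _, h0, key δ h0⟩
  · rintro ⟨x, hx, δ, h, rfl⟩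
    obtain rfl : x = ℓ.at' 0 := Subtype.ext (by simp [SlopeLine.at', hx])
    induction δ with | mk δ => ?_
    exact ⟨δ, (key δ h).symm⟩

/-- The line of slope `s` through a point of a strip in the direction of `s`. -/
theorem exists_slopeLine {s : OnePoint ℚ} {v w o : planeLattice} (h : IsUnimodular v w) {ε : ℝ}
    (hv : slopeVec s = ε * v) {x : ℂ} {α β : ℝ} (hx : x = o + α * v + β * w) (h0 : 0 < β)
    (h1 : β < 1) : ∃ ℓ : SlopeLine s, ℓ.pt = x :=
  ⟨⟨x, fun t => strip_avoids v.2 o.2 h _ (mem_strip h (α := α + t * ε) (β := β)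
    (by rw [hx, hv]; push_cast; ring) h0 h1)⟩, rfl⟩

section

variable {x₀ : PuncturedPlane} {v w : planeLattice} {a b c : OrbifoldPi1 bigConwayGroup x₀}

/-- The two half turns have centres differing by v/2, so they compose to the translation by v, and
the path from x to x + v straightens in the strip along v. -/
theorem IsTriple.mul_mem_betaClass (t : IsTriple v w a b c) {s : OnePoint ℚ}
    (hv : slopeVec s = v) : ∃ ℓ : SlopeLine s, c * b ∈ ℓ.betaClass x₀ := by
  obtain ⟨o, α, β, x, δ, h, h1, h2, h3, h4, hx, ⟨ka, ea⟩, ⟨kb, eb⟩, ⟨kc, ec⟩⟩ := t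
  obtain ⟨ℓ, hℓ⟩ := exists_slopeLine (s := s) h (ε := 1) (by rw [hv]; simp) hx h3 h4
  refine ⟨ℓ, (mem_betaClass_iff _ _).2 ⟨x, hℓ.symm, δ, ?_⟩⟩
  have hS := convex_strip v o (planeDet v w)
  have hL := strip_avoids v.2 o.2 h
  have mx := mem_strip h hx h3 h4
  have cx := mem_strip h (halfRot_thd_smul hx) (by linarith) (by linarith)
  have cbx := mem_strip h (z := ((halfRot (o + o + v + w) * halfRot (o + o + w)) • x :
    PuncturedPlane)) (o := o) (α := 1 + α) (β := β) (by
      rw [mul_smul, halfRot_smul, halfRot_smul, hx]; push_cast; ring) h3 h4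
  have e := halfRot_mul_eq_slopeTranslation (o + o + v + w) (o + o + w) s
    (by rw [hv]; push_cast; ring)
  rw [eb, ec, straightElt_mul hS hL δ kc kb (.of_convex hS hL mx cbx) mx cx cbx]
  exact ⟨_, straightElt_congr δ e _ (by rw [← e]; exact .of_convex hS hL mx cbx)⟩

theorem IsTriple.mul_mem_betaClass_neg (t : IsTriple v w a b c) {s : OnePoint ℚ}
    (hv : slopeVec s = -v) : ∃ ℓ : SlopeLine s, b * c ∈ ℓ.betaClass x₀ := by
  have t' := t.neg_left
  obtain ⟨hb, hc⟩ := t.sq_eq_one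
  obtain ⟨ℓ, h⟩ := t'.mul_mem_betaClass (s := s) (by rw [hv]; simp)
  refine ⟨ℓ, ?_⟩
  -- For the basis -v, w the product is c (c b c), which is b c.
  rwa [mul_assoc c b c, ← mul_assoc c c, hc, one_mul] at h

/-- Two lattice bases have elliptic triples that are congruent modulo `N`. -/
def TripleCongr (N : Subgroup (OrbifoldPi1 bigConwayGroup x₀)) (v w v' w' : planeLattice) : Prop :=
  ∃ a b c a' b' c' : OrbifoldPi1 bigConwayGroup x₀, IsTriple v w a b c ∧ IsTriple v' w' a' b' c' ∧
    (a : OrbifoldPi1 bigConwayGroup x₀ ⧸ N) = a' ∧ (b : OrbifoldPi1 bigConwayGroup x₀ ⧸ N) = b' ∧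
    (c : OrbifoldPi1 bigConwayGroup x₀ ⧸ N) = c'

/-! ### Congruent triples under change of basis -/

namespace TripleCongr

variable {N : Subgroup (OrbifoldPi1 bigConwayGroup x₀)} [N.Normal] {v' w' : planeLattice}

omit [N.Normal] in
theorem swap (h : TripleCongr N v w v' w') : TripleCongr N w v w' v' := by
  obtain ⟨a, b, c, a', b', c', t, t', ha, hb, hc⟩ := h
  exact ⟨_, _, _, _, _, _, t.swap, t'.swap, hb, ha, hc⟩

theorem neg_left (h : TripleCongr N v w v' w') : TripleCongr N (-v) w (-v') w' := by
  obtain ⟨a, b, c, a', b', c', t, t', ha, hb, hc⟩ := h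
  refine ⟨_, _, _, _, _, _, t.neg_left, t'.neg_left, ha, ?_, hc⟩
  rw [QuotientGroup.mk_mul, QuotientGroup.mk_mul, hb, hc]; rfl

theorem add_right (h : TripleCongr N v w v' w') : TripleCongr N v (v + w) v' (v' + w') := by
  obtain ⟨a, b, c, a', b', c', t, t', ha, hb, hc⟩ := h
  refine ⟨_, _, _, _, _, _, t.add_right, t'.add_right, ha, hc, ?_⟩
  rw [QuotientGroup.mk_mul, QuotientGroup.mk_mul, hb, hc]; rfl

/-- Negating v conjugates the shear w ↦ v + w to its inverse. -/
theorem sub_right (h : TripleCongr N v w v' w') : TripleCongr N v (w - v) v' (w' - v') := by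
  have := h.neg_left.add_right.neg_left
  simpa [neg_add_eq_sub] using this

/-- SL(2,ℤ) is generated by S and T: T is the shear, S a sign change followed by a swap. The columns
of X are the coordinates of the new basis, so a product acts by its left factor first, and the
induction runs over all bases at once. -/
theorem specialLinear (h : TripleCongr N v w v' w') (X : SL(2, ℤ)) :
    TripleCongr N (X 0 0 • v + X 1 0 • w) (X 0 1 • v + X 1 1 • w)
      (X 0 0 • v' + X 1 0 • w') (X 0 1 • v' + X 1 1 • w') := by
  have hX : X ∈ Subgroup.closure {ModularGroup.S, ModularGroup.T} := by
    rw [SpecialLinearGroup.SL2Z_generators]; trivial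
  have mul_aux : ∀ (Y Z : SL(2, ℤ)) (v w : planeLattice) (j : Fin 2),
      (Y * Z) 0 j • v + (Y * Z) 1 j • w =
        Z 0 j • (Y 0 0 • v + Y 1 0 • w) + Z 1 j • (Y 0 1 • v + Y 1 1 • w) := by
    intro Y Z v w j
    rw [Matrix.SpecialLinearGroup.coe_mul]
    simp only [Matrix.mul_apply, Fin.sum_univ_two]
    module
  induction hX using Subgroup.closure_induction'' generalizing v w v' w' with
  | one => simpa using h
  | mem x hx =>
    rcases hx with rfl | rfl
    · simpa [ModularGroup.S] using h.neg_left.swap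
    · simpa [ModularGroup.T] using h.add_right
  | inv_mem x hx =>
    rcases hx with rfl | rfl
    · rw [Matrix.SpecialLinearGroup.SL2_inv_expl]
      simpa [ModularGroup.S] using h.swap.neg_left
    · rw [Matrix.SpecialLinearGroup.SL2_inv_expl]
      simpa [ModularGroup.T, neg_add_eq_sub] using h.sub_right
  | mul x y _ _ hx hy =>
    simp only [mul_aux]
    exact hy (hx h)

/-- A slope determines its vector only up to sign; reversing v replaces c b by b c = (c b)⁻¹, whence
the inverse in the conclusion. -/
theorem exists_betaClass (h : TripleCongr N v w v' w') {s s' : OnePoint ℚ}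
    (hs : slopeVec s = v ∨ slopeVec s = -v) (hs' : slopeVec s' = v' ∨ slopeVec s' = -v') :
    ∃ (ℓ : SlopeLine s) (ℓ' : SlopeLine s'), ∃ x ∈ ℓ.betaClass x₀, ∃ y ∈ ℓ'.betaClass x₀,
      (x : OrbifoldPi1 bigConwayGroup x₀ ⧸ N) = y ∨
      (x : OrbifoldPi1 bigConwayGroup x₀ ⧸ N) = (y : OrbifoldPi1 bigConwayGroup x₀ ⧸ N)⁻¹ := by
  obtain ⟨a, b, c, a', b', c', t, t', ha, hb, hc⟩ := h
  have inv_aux : ∀ {b c : OrbifoldPi1 bigConwayGroup x₀}, b * b = 1 → c * c = 1 →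
      (b * c)⁻¹ = c * b := by
    intro b c hb hc
    rw [mul_inv_rev, inv_eq_of_mul_eq_one_right hb, inv_eq_of_mul_eq_one_right hc]
  obtain ⟨hb2, hc2⟩ := t'.sq_eq_one
  have e1 : ((c * b : OrbifoldPi1 bigConwayGroup x₀) : OrbifoldPi1 bigConwayGroup x₀ ⧸ N) =
      (c' * b' : OrbifoldPi1 bigConwayGroup x₀) := by
    rw [QuotientGroup.mk_mul, hb, hc]; rfl
  have e2 : ((b * c : OrbifoldPi1 bigConwayGroup x₀) : OrbifoldPi1 bigConwayGroup x₀ ⧸ N) =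
      (b' * c' : OrbifoldPi1 bigConwayGroup x₀) := by
    rw [QuotientGroup.mk_mul, hb, hc]; rfl
  rcases hs with hs | hs <;> rcases hs' with hs' | hs'
  · obtain ⟨ℓ, h⟩ := t.mul_mem_betaClass hs
    obtain ⟨ℓ', h'⟩ := t'.mul_mem_betaClass hs'
    exact ⟨ℓ, ℓ', _, h, _, h', .inl e1⟩
  · obtain ⟨ℓ, h⟩ := t.mul_mem_betaClass hs
    obtain ⟨ℓ', h'⟩ := t'.mul_mem_betaClass_neg hs'
    exact ⟨ℓ, ℓ', _, h, _, h', .inr (by rw [e1, ← QuotientGroup.mk_inv, inv_aux hb2 hc2])⟩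
  · obtain ⟨ℓ, h⟩ := t.mul_mem_betaClass_neg hs
    obtain ⟨ℓ', h'⟩ := t'.mul_mem_betaClass hs'
    exact ⟨ℓ, ℓ', _, h, _, h', .inr (by rw [e2, ← QuotientGroup.mk_inv, inv_aux hc2 hb2])⟩
  · obtain ⟨ℓ, h⟩ := t.mul_mem_betaClass_neg hs
    obtain ⟨ℓ', h'⟩ := t'.mul_mem_betaClass_neg hs'
    exact ⟨ℓ, ℓ', _, h, _, h', .inl e2⟩

/-- If `(c b)² ∈ N` then the bases `v, w` and `-v, w` have congruent triples. -/
theorem of_sq_mem (t : IsTriple v w a b c) (h : (c * b) ^ 2 ∈ N) :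
    TripleCongr N v w (-v) w := by
  refine ⟨_, _, _, _, _, _, t, t.neg_left, rfl, ?_, rfl⟩
  rw [← QuotientGroup.eq_one_iff] at h
  obtain ⟨hb, hc⟩ := t.sq_eq_one
  have : c * b * c = (c * b) ^ 2 * b := by
    rw [pow_two, mul_assoc (c * b), mul_assoc c b b, hb, mul_one]
  rw [this, QuotientGroup.mk_mul, h, one_mul]

end TripleCongr

/-- With t = c b, one shear replaces (b, c) by (c, c b c) = (t b, t c), and the new product of third
and second element is again t. -/
theorem IsTriple.add_nsmul_right (t : IsTriple v w a b c) (k : ℕ) :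
    IsTriple v (w + k • v) a ((c * b) ^ k * b) ((c * b) ^ k * c) := by
  obtain ⟨hb, hc⟩ := t.sq_eq_one
  induction k with
  | zero => simpa using t
  | succ k ih =>
    have h := ih.add_right
    have e1 : (c * b) ^ (k + 1) * b = (c * b) ^ k * c := by
      rw [pow_succ, mul_assoc, mul_assoc c, hb, mul_one]
    -- Since t^k b is an involution, it equals b t^(-k), and t^k (c b) t^(-k) = t.
    have e2 : (c * b) ^ k * c * ((c * b) ^ k * b) = c * b := by
      obtain ⟨hb', hc'⟩ := ih.sq_eq_one
      have e3 : (c * b) ^ k * b = b * ((c * b) ^ k)⁻¹ := by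
        have := inv_eq_of_mul_eq_one_right hb'
        rw [mul_inv_rev, inv_eq_of_mul_eq_one_right hb] at this
        exact this.symm
      have e4 : (c * b) ^ k * (c * b) * ((c * b) ^ k)⁻¹ = c * b := by
        rw [← pow_succ, pow_succ', mul_inv_cancel_right]
      rw [e3, mul_assoc, ← mul_assoc c, ← mul_assoc, e4]
    rw [e1, pow_succ' (c * b), mul_assoc (c * b), ← e2, succ_nsmul]
    rw [e2]
    rw [e2] at h
    rwa [add_comm v, add_assoc] at h

/-- If `(c b)ᵐ ∈ N` then the bases `v, w` and `v, w + m v` have congruent triples. -/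
theorem TripleCongr.of_pow_mem {N : Subgroup (OrbifoldPi1 bigConwayGroup x₀)} [N.Normal]
    (t : IsTriple v w a b c) {m : ℕ} (h : (c * b) ^ m ∈ N) :
    TripleCongr N v w v (w + m • v) := by
  refine ⟨_, _, _, _, _, _, t, t.add_nsmul_right m, rfl, ?_, ?_⟩ <;>
  · rw [← QuotientGroup.eq_one_iff] at h
    rw [QuotientGroup.mk_mul, h, one_mul]

end
end

noncomputable section

/-! ## From the orbifold group to the fundamental group of the Conway sphere -/

open OrbifoldPi1

theorem map_quotient_trans {X Y : Type*} [TopologicalSpace X] [TopologicalSpace Y] (f : C(X, Y))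
    {x y z : X} (γ : Path.Homotopic.Quotient x y) (δ : Path.Homotopic.Quotient y z) :
    (γ.trans δ).map f = (γ.map f).trans (δ.map f) := by
  induction γ with | mk γ => ?_
  induction δ with | mk δ => ?_
  rw [← Path.Homotopic.Quotient.mk_trans, ← Path.Homotopic.Quotient.mk_map,
    ← Path.Homotopic.Quotient.mk_map, ← Path.Homotopic.Quotient.mk_map,
    ← Path.Homotopic.Quotient.mk_trans, Path.map_trans]

theorem map_quotient_symm {X Y : Type*} [TopologicalSpace X] [TopologicalSpace Y] (f : C(X, Y))
    {x y : X} (γ : Path.Homotopic.Quotient x y) : γ.symm.map f = (γ.map f).symm := by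
  induction γ with | mk γ => ?_
  rfl

theorem trans_cast_cast {Y : Type*} [TopologicalSpace Y] {x y y' z z' w : Y}
    (γ : Path.Homotopic.Quotient x y) (δ : Path.Homotopic.Quotient y' z) (h : y = y')
    (hz : z' = z) (hw : w = z') (h' : y' = y) (hw' : w = z) :
    (γ.trans (δ.cast h hz)).cast rfl hw = (γ.cast rfl h').trans (δ.cast rfl hw') := by
  subst h hz hw; simp

theorem trans_trans_cast_cast {Y : Type*} [TopologicalSpace Y] {x y z z' w w' : Y}
    (γ : Path.Homotopic.Quotient x y) (ε : Path.Homotopic.Quotient y z)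
    (δ : Path.Homotopic.Quotient z' w') (hz : z = z') (hw : w = w') (hw' : w' = w)
    (hz' : z' = z) :
    ((γ.trans ε).trans (δ.cast hz hw)).cast rfl hw' = (γ.trans (ε.cast rfl hz')).trans δ := by
  subst hz hw; simp

theorem conwayProj_smul_sub {k : bigConwayGroup} (hk : (k : latticeIsometries) ∈ conwayGroup)
    (x : PuncturedPlane) : conwayProj (k • x) = conwayProj x :=
  conwayProj_smul hk x

theorem moveClass_map_conwayProj {k : bigConwayGroup}
    (hk : (k : latticeIsometries) ∈ conwayGroup) {x y : PuncturedPlane}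
    (γ : Path.Homotopic.Quotient x y) : (moveClass k γ).map conwayProj =
      (γ.map conwayProj).cast (conwayProj_smul_sub hk x) (conwayProj_smul_sub hk y) := by
  induction γ with | mk γ => ?_
  rw [moveClass_mk, ← Path.Homotopic.Quotient.mk_map, ← Path.Homotopic.Quotient.mk_map,
    ← Path.Homotopic.Quotient.mk_cast]
  refine congrArg _ ?_
  ext t
  exact conwayProj_smul_sub hk (γ t)

/-! ### Projection of elements over H -/

section

variable {x₀ p : PuncturedPlane}

/-- The element of the fundamental group of the Conway sphere given by an element of the
orbifold fundamental group whose group part lies in `H`. -/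
def projElt (g : OrbifoldPi1 bigConwayGroup x₀) (hg : (g.elt : latticeIsometries) ∈ conwayGroup) :
    FundamentalGroup ConwaySphere (conwayProj x₀) :=
  FundamentalGroup.fromPath
    ((g.path.map conwayProj).cast rfl (conwayProj_smul_sub hg x₀).symm)

/-- The factors change places because a product in `FundamentalGroup` traverses its right factor
first, while `OrbifoldPi1` traverses the left one first. An antihomomorphism serves equally well for
normal subgroups, powers and conjugacy. -/
theorem projElt_mul (a b : OrbifoldPi1 bigConwayGroup x₀)
    (ha : (a.elt : latticeIsometries) ∈ conwayGroup)
    (hb : (b.elt : latticeIsometries) ∈ conwayGroup)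
    (hab : ((a * b).elt : latticeIsometries) ∈ conwayGroup) :
    projElt (a * b) hab = projElt b hb * projElt a ha := by
  rw [FundamentalGroup.mul_def]
  change ((((a.path.trans (moveClass a.elt b.path)).cast rfl (mul_smul _ _ _)).map conwayProj).cast
    rfl _ : Path.Homotopic.Quotient _ _) = Path.Homotopic.Quotient.trans
      ((a.path.map conwayProj).cast rfl _) ((b.path.map conwayProj).cast rfl _)
  rw [Path.Homotopic.Quotient.map_cast, map_quotient_trans, moveClass_map_conwayProj ha]
  simp only [Path.Homotopic.Quotient.cast_cast]
  exact trans_cast_cast _ _ _ _ _ _ _ 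

theorem projElt_one (h : ((1 : OrbifoldPi1 bigConwayGroup x₀).elt : latticeIsometries) ∈
    conwayGroup) : projElt (1 : OrbifoldPi1 bigConwayGroup x₀) h = 1 := by
  have := projElt_mul (1 : OrbifoldPi1 bigConwayGroup x₀) 1 h h (by simpa using h)
  have e : projElt ((1 : OrbifoldPi1 bigConwayGroup x₀) * 1) (by simpa using h) = projElt 1 h := by
    congr 1
    exact mul_one 1
  rw [e] at this
  exact left_eq_mul.1 this

theorem projElt_congr {a b : OrbifoldPi1 bigConwayGroup x₀} (e : a = b)
    (ha : (a.elt : latticeIsometries) ∈ conwayGroup)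
    (hb : (b.elt : latticeIsometries) ∈ conwayGroup) : projElt a ha = projElt b hb := by
  subst e; rfl

theorem projElt_inv (a : OrbifoldPi1 bigConwayGroup x₀)
    (ha : (a.elt : latticeIsometries) ∈ conwayGroup)
    (ha' : ((a⁻¹).elt : latticeIsometries) ∈ conwayGroup) :
    projElt a⁻¹ ha' = (projElt a ha)⁻¹ := by
  have h1 : ((1 : OrbifoldPi1 bigConwayGroup x₀).elt : latticeIsometries) ∈ conwayGroup :=
    one_mem conwayGroup
  rw [eq_inv_iff_mul_eq_one, ← projElt_mul a a⁻¹ ha ha' (by rw [mul_inv_cancel]; exact h1),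
    projElt_congr (mul_inv_cancel a) _ h1, projElt_one]

theorem elt_pow_mem {a : OrbifoldPi1 bigConwayGroup x₀}
    (ha : (a.elt : latticeIsometries) ∈ conwayGroup) (k : ℕ) :
    ((a ^ k).elt : latticeIsometries) ∈ conwayGroup := by
  induction k with
  | zero => rw [pow_zero]; exact one_mem conwayGroup
  | succ k ih => rw [pow_succ]; exact mul_mem ih ha

theorem projElt_pow (a : OrbifoldPi1 bigConwayGroup x₀)
    (ha : (a.elt : latticeIsometries) ∈ conwayGroup) (k : ℕ) :
    projElt (a ^ k) (elt_pow_mem ha k) = projElt a ha ^ k := by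
  induction k with
  | zero =>
    rw [projElt_congr (pow_zero a) _ (one_mem conwayGroup), projElt_one, pow_zero]
  | succ k ih =>
    rw [projElt_congr (pow_succ' a k) _ (mul_mem ha (elt_pow_mem ha k)),
      projElt_mul _ _ ha (elt_pow_mem ha k), ih, pow_succ]

/-- The path `δ` and its translate by an element of H have the same image in the Conway sphere, so
the projection is a loop conjugated by the image of `δ`. -/
theorem projElt_conjPath (δ : Path.Homotopic.Quotient x₀ p) (k : bigConwayGroup)
    (ε : Path.Homotopic.Quotient p (k • p)) (hk : (k : latticeIsometries) ∈ conwayGroup) :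
    projElt (conjPath δ k ε) hk = FundamentalGroup.fromPath
      (((δ.map conwayProj).trans ((ε.map conwayProj).cast rfl (conwayProj_smul_sub hk p).symm)).trans
        (δ.map conwayProj).symm) := by
  change (((δ.trans ε).trans (moveClass k δ).symm).map conwayProj).cast rfl _ = _
  rw [map_quotient_trans, map_quotient_trans, map_quotient_symm, moveClass_map_conwayProj hk,
    symm_cast]
  exact trans_trans_cast_cast _ _ _ _ _ _ _

/-! ### Lines and loops -/

theorem mem_alphaClass_iff {s : OnePoint ℚ} (ℓ : SlopeLine s)
    (a : FundamentalGroup ConwaySphere (conwayProj x₀)) :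
    a ∈ ℓ.alphaClass x₀ ↔ ∃ δ : Path.Homotopic.Quotient (conwayProj x₀) (conwayProj (ℓ.at' 0)),
      a = FundamentalGroup.fromPath
        ((δ.trans (Path.Homotopic.Quotient.mk ℓ.alphaLoop)).trans δ.symm) := by
  constructor
  · rintro ⟨δ, rfl⟩
    exact ⟨Path.Homotopic.Quotient.mk δ, rfl⟩
  · rintro ⟨δ, rfl⟩
    induction δ with | mk δ => ?_
    exact ⟨δ, rfl⟩

theorem isConj_of_mem_alphaClass {s : OnePoint ℚ} {ℓ : SlopeLine s}
    {a b : FundamentalGroup ConwaySphere (conwayProj x₀)} (ha : a ∈ ℓ.alphaClass x₀)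
    (hb : b ∈ ℓ.alphaClass x₀) : IsConj a b := by
  obtain ⟨δ, rfl⟩ := (mem_alphaClass_iff ℓ _).1 ha
  obtain ⟨δ', rfl⟩ := (mem_alphaClass_iff ℓ _).1 hb
  rw [isConj_iff]
  -- With the right factor first, the conjugate runs δ' δ⁻¹ · δ α δ⁻¹ · δ δ'⁻¹ = δ' α δ'⁻¹.
  refine ⟨FundamentalGroup.fromPath (δ.trans δ'.symm), ?_⟩
  rw [FundamentalGroup.inv_def, FundamentalGroup.mul_def, FundamentalGroup.mul_def]
  simp only [symm_trans_rev, OrbifoldPi1.symm_symm, Path.Homotopic.Quotient.trans_assoc,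
    symm_trans_cancel_left]

theorem convex_line (p v : ℂ) : Convex ℝ {z : ℂ | ∃ t : ℝ, z = p + t * v} := by
  rintro _ ⟨t, rfl⟩ _ ⟨t', rfl⟩ a b _ _ hab
  refine ⟨a * t + b * t', ?_⟩
  obtain rfl : a = 1 - b := by linarith
  simp only [Complex.real_smul]
  push_cast; ring

theorem betaClass_elt_sq_mem {s : OnePoint ℚ} {ℓ : SlopeLine s}
    {b : OrbifoldPi1 bigConwayGroup x₀} (hb : b ∈ ℓ.betaClass x₀) :
    ((b ^ 2).elt : latticeIsometries) ∈ conwayGroup := by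
  obtain ⟨δ, rfl⟩ := hb
  have := slopeTranslation_sq_mem s
  rw [pow_two] at this ⊢
  exact this

/-- This is α_s = β_s²: the points x, τ x, τ² x lie on the line, itself a lattice-free convex set,
so the square is the straight path of length two, which projects to the loop. -/
theorem projElt_sq_mem_alphaClass {s : OnePoint ℚ} {ℓ : SlopeLine s}
    {b : OrbifoldPi1 bigConwayGroup x₀} (hb : b ∈ ℓ.betaClass x₀) :
    projElt (b ^ 2) (betaClass_elt_sq_mem hb) ∈ ℓ.alphaClass x₀ := by
  have hb' := hb
  obtain ⟨x, hx, δ, h, rfl⟩ := (mem_betaClass_iff ℓ b).1 hb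
  obtain rfl : x = ℓ.at' 0 := Subtype.ext (by simp [SlopeLine.at', hx])
  set τ : bigConwayGroup := ⟨slopeTranslation s, slopeTranslation_mem s⟩ with hτ
  have e2 : (τ * τ) • ℓ.at' 0 = ℓ.at' 2 := by
    rw [← ℓ.translate_sq_at', pow_two]; rfl
  have e1 : τ • ℓ.at' 0 = ℓ.at' 1 := ℓ.translate_at'
  have h2 : SegAvoids (ℓ.at' 0) ((τ * τ) • ℓ.at' 0) := by
    rw [e2]; exact slopeLine_segAvoids ℓ 0 2
  have hL : ∀ z ∈ {z : ℂ | ∃ t : ℝ, z = ℓ.pt + t * slopeVec s}, z ∉ planeLattice := by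
    rintro _ ⟨t, rfl⟩; exact ℓ.avoids t
  have hk : ((τ * τ : bigConwayGroup) : latticeIsometries) ∈ conwayGroup := by
    have := slopeTranslation_sq_mem s
    rwa [pow_two] at this
  have e : straightElt δ τ h ^ 2 = straightElt δ (τ * τ) h2 := by
    rw [pow_two]
    exact straightElt_mul (convex_line ℓ.pt (slopeVec s)) hL δ h h h2 ⟨0, rfl⟩
      ⟨1, by rw [e1]; rfl⟩ ⟨2, by rw [e2]; rfl⟩
  rw [projElt_congr e _ hk]
  change projElt (conjPath δ (τ * τ) (segClass h2)) hk ∈ _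
  rw [projElt_conjPath, mem_alphaClass_iff]
  refine ⟨δ.map conwayProj, ?_⟩
  have e3 : (Path.Homotopic.Quotient.mk ℓ.alphaLoop) =
      ((segClass (slopeLine_segAvoids ℓ 0 2)).map conwayProj).cast rfl ℓ.proj_at' := by
    rw [← mk_segment]; rfl
  rw [e3, segClass_congr h2 (slopeLine_segAvoids ℓ 0 2) e2, Path.Homotopic.Quotient.map_cast,
    Path.Homotopic.Quotient.cast_cast]

/-- Serves to see that each element of Ĥ either commutes with the translations or inverts them. -/
theorem bigConwayGroup_cases (k : bigConwayGroup) : ∃ a ∈ planeLattice,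
    (∀ z : ℂ, (k : latticeIsometries).1 z = z + a) ∨
    (∀ z : ℂ, (k : latticeIsometries).1 z = a - z) := by
  obtain ⟨k, hk⟩ := k
  change ∃ a ∈ planeLattice, (∀ z : ℂ, k.1 z = z + a) ∨ (∀ z : ℂ, k.1 z = a - z)
  induction hk using Subgroup.closure_induction with
  | mem x hx =>
    obtain ⟨c, hc, rfl⟩ := hx
    exact ⟨c + c, hc, .inr (halfTurn_apply c hc)⟩
  | one => exact ⟨0, zero_mem _, .inl fun z => (add_zero z).symm⟩
  | mul x y _ _ hx hy =>
    obtain ⟨a, ha, hx⟩ := hx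
    obtain ⟨b, hb, hy⟩ := hy
    have e : ∀ z, (x * y).1 z = x.1 (y.1 z) := fun z => rfl
    rcases hx with hx | hx <;> rcases hy with hy | hy
    · exact ⟨a + b, add_mem ha hb, .inl fun z => by rw [e, hy, hx]; ring⟩
    · exact ⟨a + b, add_mem ha hb, .inr fun z => by rw [e, hy, hx]; ring⟩
    · exact ⟨a - b, sub_mem ha hb, .inr fun z => by rw [e, hy, hx]; ring⟩
    · exact ⟨a - b, sub_mem ha hb, .inl fun z => by rw [e, hy, hx]; ring⟩
  | inv x _ hx =>
    obtain ⟨a, ha, hx⟩ := hx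
    have e : ∀ z, x.1 ((x⁻¹).1 z) = z := fun z => x.1.apply_symm_apply z
    rcases hx with hx | hx
    · refine ⟨-a, neg_mem ha, .inl fun z => ?_⟩
      have := e z
      rw [hx] at this
      linear_combination this
    · refine ⟨a, ha, .inr fun z => ?_⟩
      have := e z
      rw [hx] at this
      linear_combination -this

theorem slopeTranslation_sub_smul (s : OnePoint ℚ) (x : PuncturedPlane) :
    (((⟨slopeTranslation s, slopeTranslation_mem s⟩ : bigConwayGroup) • x : PuncturedPlane) : ℂ) =
      x + slopeVec s :=
  slopeTranslation_smul s x

theorem slopeTranslation_inv_smul (s : OnePoint ℚ) (x : PuncturedPlane) :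
    (((⟨slopeTranslation s, slopeTranslation_mem s⟩ : bigConwayGroup)⁻¹ • x : PuncturedPlane) : ℂ) =
      x - slopeVec s := by
  rw [eq_sub_iff_add_eq, ← slopeTranslation_sub_smul, smul_inv_smul]

/-- A conjugate of `β_s` is again represented by `β_s`, up to orientation. -/
theorem conj_mem_betaClass (g : OrbifoldPi1 bigConwayGroup x₀) {s : OnePoint ℚ} {ℓ : SlopeLine s}
    {b : OrbifoldPi1 bigConwayGroup x₀} (hb : b ∈ ℓ.betaClass x₀) : ∃ ℓ' : SlopeLine s,
      ℓ'.pt = (g.elt : latticeIsometries).1 ℓ.pt ∧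
      (g * b * g⁻¹ ∈ ℓ'.betaClass x₀ ∨ (g * b * g⁻¹)⁻¹ ∈ ℓ'.betaClass x₀) := by
  obtain ⟨x, hx, δ, h, rfl⟩ := (mem_betaClass_iff ℓ b).1 hb
  set τ : bigConwayGroup := ⟨slopeTranslation s, slopeTranslation_mem s⟩ with hτ
  have hτa : ∀ z, (τ : latticeIsometries).1 z = z + slopeVec s := slopeTranslation_apply s
  have hgx : ((g.elt • x : PuncturedPlane) : ℂ) = (g.elt : latticeIsometries).1 ℓ.pt := by
    rw [← hx]; rfl
  obtain ⟨a, ha, hg⟩ := bigConwayGroup_cases g.elt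
  have hL : ∀ z ∈ {z : ℂ | ∃ t : ℝ, z = (g.elt : latticeIsometries).1 ℓ.pt + t * slopeVec s},
      z ∉ planeLattice := by
    rintro _ ⟨t, rfl⟩ ht
    rcases hg with hg | hg
    · rw [hg] at ht
      refine ℓ.avoids t ?_
      convert sub_mem ht ha using 1; ring
    · rw [hg] at ht
      refine ℓ.avoids (-t) ?_
      convert sub_mem ha ht using 1; push_cast; ring
  have hC := convex_line ((g.elt : latticeIsometries).1 ℓ.pt) (slopeVec s)
  let ℓ' : SlopeLine s := ⟨(g.elt : latticeIsometries).1 ℓ.pt, fun t => hL _ ⟨t, rfl⟩⟩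
  have m0 : ((g.elt • x : PuncturedPlane) : ℂ) ∈
      {z : ℂ | ∃ t : ℝ, z = (g.elt : latticeIsometries).1 ℓ.pt + t * slopeVec s} :=
    ⟨0, by rw [hgx]; simp⟩
  have m1 : ((τ • g.elt • x : PuncturedPlane) : ℂ) ∈
      {z : ℂ | ∃ t : ℝ, z = (g.elt : latticeIsometries).1 ℓ.pt + t * slopeVec s} :=
    ⟨1, by rw [slopeTranslation_sub_smul, hgx]; simp⟩
  have m2 : ((τ⁻¹ • g.elt • x : PuncturedPlane) : ℂ) ∈
      {z : ℂ | ∃ t : ℝ, z = (g.elt : latticeIsometries).1 ℓ.pt + t * slopeVec s} :=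
    ⟨-1, by rw [slopeTranslation_inv_smul, hgx]; push_cast; ring⟩
  refine ⟨ℓ', rfl, ?_⟩
  -- An element over a translation commutes with τ; one over a half turn conjugates τ to τ⁻¹, and
  -- the image line is run through backwards.
  rcases hg with hg | hg
  · left
    have hk : τ * g.elt = g.elt * τ := bigConwayGroup_ext fun z => by
      change (τ : latticeIsometries).1 ((g.elt : latticeIsometries).1 z) =
        (g.elt : latticeIsometries).1 ((τ : latticeIsometries).1 z)
      rw [hg, hτa, hτa, hg]; ring
    rw [conj_straightElt g δ hk h (.of_convex hC hL m0 m1), mem_betaClass_iff]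
    exact ⟨_, hgx, _, _, rfl⟩
  · right
    have hk : τ⁻¹ * g.elt = g.elt * τ := by
      rw [inv_mul_eq_iff_eq_mul]
      refine bigConwayGroup_ext fun z => ?_
      change (g.elt : latticeIsometries).1 z = (τ : latticeIsometries).1
        ((g.elt : latticeIsometries).1 ((τ : latticeIsometries).1 z))
      rw [hg, hτa, hτa, hg]; ring
    have h1 : SegAvoids (g.elt • x) (τ⁻¹ • g.elt • x) := .of_convex hC hL m0 m2
    have h2 : SegAvoids (g.elt • x) (τ • g.elt • x) := .of_convex hC hL m0 m1
    rw [conj_straightElt g δ hk h h1, mem_betaClass_iff]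
    refine ⟨_, hgx, g.path.trans (moveClass g.elt δ), h2, ?_⟩
    have e : τ⁻¹ * τ = 1 := inv_mul_cancel τ
    have h3 : SegAvoids (g.elt • x) ((τ⁻¹ * τ) • g.elt • x) := by
      rw [e, one_smul]; exact .refl _
    refine inv_eq_of_mul_eq_one_right ?_
    rw [straightElt_mul hC hL _ h1 h2 h3 m0 m2 (by rw [e, one_smul]; exact m0),
      straightElt_congr _ e h3 (by rw [one_smul]; exact .refl _), straightElt_one]

/-- The two lines bound no lattice point between them, so the starting point slides from one to the
other inside the strip. -/
theorem betaClass_subset {s : OnePoint ℚ} {v o : planeLattice} {D : ℝ} (hD : D = 1 ∨ D = -1)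
    (hv : slopeVec s = v) (ℓ ℓ' : SlopeLine s) (h : ℓ.pt ∈ strip v o D) (h' : ℓ'.pt ∈ strip v o D) :
    ℓ.betaClass x₀ ⊆ ℓ'.betaClass x₀ := by
  intro b hb
  obtain ⟨x, hx, δ, k, rfl⟩ := (mem_betaClass_iff ℓ b).1 hb
  have hS := convex_strip v o D
  have hL := strip_avoids v.2 o.2 hD
  let y : PuncturedPlane := ⟨ℓ'.pt, hL _ h'⟩
  have add_mem : ∀ z ∈ strip v o D, z + slopeVec s ∈ strip v o D := by
    intro z hz
    have e : planeDet v (z + v - o) = planeDet v (z - o) := by simp [planeDet]; ring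
    rw [hv]
    rwa [strip, Set.mem_ofPred_eq, e]
  have mx : (x : ℂ) ∈ strip v o D := hx ▸ h
  have mx' := add_mem _ mx
  have my' := add_mem _ h'
  rw [← slopeTranslation_sub_smul] at mx'
  rw [← show ((y : PuncturedPlane) : ℂ) = ℓ'.pt from rfl, ← slopeTranslation_sub_smul] at my'
  have hxy : SegAvoids x y := .of_convex hS hL mx h'
  rw [mem_betaClass_iff]
  refine ⟨y, rfl, δ.trans (segClass hxy), .of_convex hS hL h' my', ?_⟩
  rw [straightElt_trans hS hL δ hxy k _ mx h' mx' my']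

end
end

/-! ### Independence of the chosen line, and descent of the relators to the Heckoid group -/

noncomputable section

open OrbifoldPi1

theorem isCoprime_slope (s : OnePoint ℚ) : IsCoprime (slopeNum s) (slopeDen s) := by
  induction s using OnePoint.rec with
  | infty => exact isCoprime_one_left
  | coe q => exact Rat.isCoprime_num_den q

/-- The lattice vector with coordinates `x`, `y`. -/
def latticeVec (x y : ℤ) : planeLattice := ⟨x + y * Complex.I, x, y, rfl⟩

theorem planeDet_latticeVec (x y z t : ℤ) :
    planeDet (latticeVec x y) (latticeVec z t) = ((x * t - y * z : ℤ) : ℝ) := by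
  simp [planeDet, latticeVec]

theorem latticeVec_slope (s : OnePoint ℚ) :
    (latticeVec (slopeDen s) (slopeNum s) : ℂ) = slopeVec s := rfl

theorem exists_isUnimodular_slope (s : OnePoint ℚ) :
    ∃ w : ℤ × ℤ, IsUnimodular (latticeVec (slopeDen s) (slopeNum s)) (latticeVec w.1 w.2) := by
  obtain ⟨a, b, h⟩ := isCoprime_slope s
  refine ⟨(-a, b), .inl ?_⟩
  rw [planeDet_latticeVec]
  exact_mod_cast (by linarith : slopeDen s * b - slopeNum s * (-a) = 1)

section

variable {x₀ : PuncturedPlane}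

theorem halfRot_double_mem (a : planeLattice) :
    (halfRot (a + a) : latticeIsometries) ∈ conwayGroup := by
  refine Subgroup.subset_closure ⟨a, a.2, ?_⟩
  apply Subtype.ext
  ext z
  rw [halfRot_apply, halfTurn_apply]; rfl

/-- Between two lines of the same slope, up to an isometry in `H`. -/
theorem exists_mem_conwayGroup_strip {s : OnePoint ℚ} (ℓ ℓ' : SlopeLine s) :
    ∃ k : bigConwayGroup, (k : latticeIsometries) ∈ conwayGroup ∧
      ∃ (v o : planeLattice) (D : ℝ), (D = 1 ∨ D = -1) ∧ slopeVec s = v ∧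
        (k : latticeIsometries).1 ℓ.pt ∈ strip v o D ∧ ℓ'.pt ∈ strip v o D := by
  obtain ⟨w, hw⟩ := exists_isUnimodular_slope s
  set v := latticeVec (slopeDen s) (slopeNum s) with hv
  set u := latticeVec w.1 w.2
  set D := planeDet v u with hDdef
  have hDD : D * D = 1 := by rcases hw with h | h <;> rw [hDdef, h] <;> norm_num
  -- The transverse coordinate `D * planeDet v z` lies between n and n + 1 exactly on the n-th
  -- strip.
  have mem_iff : ∀ (n : ℤ) (z : ℂ), z ∈ strip v (n • u : planeLattice) D ↔
      n < D * planeDet v z ∧ D * planeDet v z < n + 1 := by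
    intro n z
    have e : D * planeDet v (z - (n • u : planeLattice)) = D * planeDet v z - n := by
      have : planeDet v (z - (n • u : planeLattice)) = planeDet v z - n * D := by
        rw [hDdef]; simp [planeDet]; ring
      rw [this]; linear_combination (-(n : ℝ)) * hDD
    rw [strip, Set.mem_ofPred_eq, e]
    constructor <;> rintro ⟨h1, h2⟩ <;> constructor <;> linarith
  -- With an integral transverse coordinate n the line would pass through the lattice point n u.
  have hne : ∀ (ℓ : SlopeLine s) (n : ℤ), D * planeDet v ℓ.pt ≠ n := by
    intro ℓ n hn
    have h0 : planeDet v (ℓ.pt - (n • u : planeLattice)) = 0 := by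
      have : planeDet v (ℓ.pt - (n • u : planeLattice)) = planeDet v ℓ.pt - n * D := by
        rw [hDdef]; simp [planeDet]; ring
      rw [this]; linear_combination D * hn - planeDet v ℓ.pt * hDD
    obtain ⟨t, ht⟩ : ∃ t : ℝ, ℓ.pt - (n • u : planeLattice) = t * slopeVec s := by
      have hne := slopeVec_ne_zero s
      set z := ℓ.pt - (n • u : planeLattice)
      rw [hv, latticeVec_slope, planeDet] at h0
      have hn : (slopeVec s).re * (slopeVec s).re + (slopeVec s).im * (slopeVec s).im ≠ 0 := by
        intro h
        apply hne
        apply Complex.ext <;> simp <;> nlinarith [sq_nonneg (slopeVec s).re, sq_nonneg (slopeVec s).im]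
      refine ⟨(z.re * (slopeVec s).re + z.im * (slopeVec s).im) /
        ((slopeVec s).re * (slopeVec s).re + (slopeVec s).im * (slopeVec s).im), ?_⟩
      apply Complex.ext
      · simp only [Complex.re_ofReal_mul]
        rw [div_mul_eq_mul_div, eq_div_iff hn]
        linear_combination (-(slopeVec s).im) * h0
      · simp only [Complex.im_ofReal_mul]
        rw [div_mul_eq_mul_div, eq_div_iff hn]
        linear_combination ((slopeVec s).re) * h0
    refine ℓ.avoids (-t) ?_
    have : ℓ.pt + ((-t : ℝ) : ℂ) * slopeVec s = (n • u : planeLattice) := by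
      rw [Complex.ofReal_neg]; linear_combination ht
    rw [this]; exact (n • u).2
  set β := D * planeDet v ℓ.pt with hβ
  set β' := D * planeDet v ℓ'.pt with hβ'
  have floor_lt : ∀ (ℓ : SlopeLine s), (⌊D * planeDet v ℓ.pt⌋ : ℝ) < D * planeDet v ℓ.pt :=
    fun ℓ => (Int.floor_le _).lt_of_ne' (hne ℓ _)
  have h1 := floor_lt ℓ
  have h2 := floor_lt ℓ'
  have h3 := Int.lt_floor_add_one β
  have h4 := Int.lt_floor_add_one β'
  rw [← hβ] at h1
  rw [← hβ'] at h2
  -- H acts on the transverse coordinate by β ↦ β + 2j (translation by 2 j u) and β ↦ 2i - β (half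
  -- turn about i u); the parity of the difference of the strip numbers decides which one is needed.
  rcases Int.even_or_odd' (⌊β'⌋ - ⌊β⌋) with ⟨j, hj | hj⟩
  · have hjr : (⌊β'⌋ : ℝ) - ⌊β⌋ = 2 * j := by exact_mod_cast hj
    refine ⟨halfRot (j • u + j • u) * halfRot (0 + 0),
      mul_mem (halfRot_double_mem _) (halfRot_double_mem _), v, ⌊β'⌋ • u, D, hw, rfl, ?_,
      (mem_iff _ _).2 ⟨h2, h4⟩⟩
    have e : ((halfRot (j • u + j • u) * halfRot (0 + 0) : bigConwayGroup) : latticeIsometries).1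
        ℓ.pt = ℓ.pt + 2 * j * u := by
      change (halfRot (j • u + j • u) : latticeIsometries).1
        ((halfRot (0 + 0) : latticeIsometries).1 ℓ.pt) = _
      rw [halfRot_apply, halfRot_apply]; simp; ring
    have e' : D * planeDet v (ℓ.pt + 2 * j * u) = β + 2 * j := by
      have : planeDet v (ℓ.pt + 2 * j * u) = planeDet v ℓ.pt + 2 * j * D := by
        rw [hDdef]; simp [planeDet]; ring
      rw [this]; linear_combination (2 * (j : ℝ)) * hDD
    rw [e, mem_iff, e']
    constructor <;> linarith
  · have hjr : (⌊β'⌋ : ℝ) - ⌊β⌋ = 2 * j + 1 := by exact_mod_cast hj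
    -- The half turn takes strip number ⌊β⌋ to strip number 2i - ⌊β⌋ - 1, which must be ⌊β'⌋.
    set i := ⌊β'⌋ - j
    have hir : (i : ℝ) = ⌊β'⌋ - j := by simp [i]
    refine ⟨halfRot (i • u + i • u), halfRot_double_mem _, v, ⌊β'⌋ • u, D, hw, rfl, ?_,
      (mem_iff _ _).2 ⟨h2, h4⟩⟩
    have e : (halfRot (i • u + i • u) : latticeIsometries).1 ℓ.pt = 2 * i * u - ℓ.pt := by
      rw [halfRot_apply]; simp; ring
    have e' : D * planeDet v (2 * i * u - ℓ.pt) = 2 * i - β := by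
      have : planeDet v (2 * i * u - ℓ.pt) = 2 * i * D - planeDet v ℓ.pt := by
        rw [hDdef]; simp [planeDet]; ring
      rw [this]; linear_combination (2 * (i : ℝ)) * hDD
    rw [e, mem_iff, e', hir]
    constructor <;> linarith

theorem betaClass_nonempty (x₀ : PuncturedPlane) {s : OnePoint ℚ} (ℓ : SlopeLine s) :
    (ℓ.betaClass x₀).Nonempty := by
  obtain ⟨δ⟩ := PathConnectedSpace.joined x₀ (ℓ.at' 0)
  exact ⟨_, δ, rfl⟩

theorem sq_conj {G : Type*} [Group G] (g b : G) : (g * b * g⁻¹) ^ 2 = g * b ^ 2 * g⁻¹ := by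
  rw [conj_pow]

theorem elt_conj_mem {g b : OrbifoldPi1 bigConwayGroup x₀}
    (hg : (g.elt : latticeIsometries) ∈ conwayGroup)
    (hb : (b.elt : latticeIsometries) ∈ conwayGroup) :
    ((g * b * g⁻¹).elt : latticeIsometries) ∈ conwayGroup :=
  mul_mem (mul_mem hg hb) (inv_mem hg)

theorem isConj_projElt_conj {g b : OrbifoldPi1 bigConwayGroup x₀}
    (hg : (g.elt : latticeIsometries) ∈ conwayGroup)
    (hb : (b.elt : latticeIsometries) ∈ conwayGroup)
    (h : ((g * b * g⁻¹).elt : latticeIsometries) ∈ conwayGroup) :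
    IsConj (projElt b hb) (projElt (g * b * g⁻¹) h) := by
  have hg' : ((g⁻¹).elt : latticeIsometries) ∈ conwayGroup := inv_mem hg
  rw [isConj_iff]
  refine ⟨(projElt g hg)⁻¹, ?_⟩
  rw [projElt_mul (g * b) g⁻¹ (mul_mem hg hb) hg', projElt_mul g b hg hb, projElt_inv g hg]
  group

theorem isConj_inv {G : Type*} [Group G] {a b : G} (h : IsConj a b) : IsConj a⁻¹ b⁻¹ := by
  obtain ⟨c, rfl⟩ := isConj_iff.1 h
  exact isConj_iff.2 ⟨c, by group⟩

/-- The classes of two lines of the same slope agree up to conjugation and inversion. -/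
theorem isConj_of_same_slope {s : OnePoint ℚ} (ℓ ℓ' : SlopeLine s)
    {a b : FundamentalGroup ConwaySphere (conwayProj x₀)} (ha : a ∈ ℓ.alphaClass x₀)
    (hb : b ∈ ℓ'.alphaClass x₀) : IsConj a b ∨ IsConj a b⁻¹ := by
  -- An isometry in H brings `ℓ` into the strip of `ℓ'`. Lifted to `g`, it conjugates β to β or β⁻¹
  -- of the moved line, and since k lies in H this projects to a conjugation in the Conway sphere.
  obtain ⟨k, hk, v, o, D, hD, hv, h1, h2⟩ := exists_mem_conwayGroup_strip ℓ ℓ'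
  obtain ⟨β, hβ⟩ := betaClass_nonempty x₀ ℓ
  obtain ⟨γ⟩ := PathConnectedSpace.joined x₀ (k • x₀)
  set g : OrbifoldPi1 bigConwayGroup x₀ := ⟨k, Path.Homotopic.Quotient.mk γ⟩
  have hg : (g.elt : latticeIsometries) ∈ conwayGroup := hk
  obtain ⟨ℓ₁, e, h⟩ := conj_mem_betaClass g hβ
  have sub := betaClass_subset (x₀ := x₀) hD hv ℓ₁ ℓ' (e ▸ h1) h2
  have hβ2 := betaClass_elt_sq_mem hβ
  have c1 := isConj_of_mem_alphaClass ha (projElt_sq_mem_alphaClass hβ)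
  have c2 := isConj_projElt_conj hg hβ2 (elt_conj_mem hg hβ2)
  rcases h with h | h
  · left
    have c3 := isConj_of_mem_alphaClass (projElt_sq_mem_alphaClass (sub h)) hb
    rw [projElt_congr (sq_conj g β) _ (elt_conj_mem hg hβ2)] at c3
    exact (c1.trans c2).trans c3
  · right
    have c3 := isConj_inv (isConj_of_mem_alphaClass (projElt_sq_mem_alphaClass (sub h)) hb)
    have e : ((g * β * g⁻¹)⁻¹) ^ 2 = (g * β ^ 2 * g⁻¹)⁻¹ := by rw [inv_pow, sq_conj]
    rw [projElt_congr e _ (inv_mem (elt_conj_mem hg hβ2)),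
      projElt_inv _ (elt_conj_mem hg hβ2), inv_inv] at c3
    exact (c1.trans c2).trans c3

/-- The relators of the quotient orbifold project to the kernel of the map to the Heckoid
group. -/
theorem projElt_mem_heckoidKernel {r : ℚ} {m : ℕ} {g : OrbifoldPi1 bigConwayGroup x₀}
    (hg : g ∈ quotientOrbifoldRelators r m x₀)
    (h : (g.elt : latticeIsometries) ∈ conwayGroup) :
    projElt g h ∈ heckoidKernel r m x₀ := by
  by_cases hm : Even m
  -- Membership in H is made part of the claim: a factor of a product over H need not lie over H by
  -- itself.
  · suffices ∃ h, projElt g h ∈ heckoidKernel r m x₀ from this.2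
    have sq_aux : ∀ {s : OnePoint ℚ} {ℓ : SlopeLine s} {b : OrbifoldPi1 bigConwayGroup x₀}
        (g : OrbifoldPi1 bigConwayGroup x₀), b ∈ ℓ.betaClass x₀ → ∃ (ℓ' : SlopeLine s)
        (h : (((g * b * g⁻¹) ^ 2).elt : latticeIsometries) ∈ conwayGroup),
        projElt ((g * b * g⁻¹) ^ 2) h ∈ ℓ'.alphaClass x₀ ∨
        (projElt ((g * b * g⁻¹) ^ 2) h)⁻¹ ∈ ℓ'.alphaClass x₀ := by
      intro s ℓ b g hb
      obtain ⟨ℓ', _, h | h⟩ := conj_mem_betaClass g hb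
      · exact ⟨ℓ', betaClass_elt_sq_mem h, .inl (projElt_sq_mem_alphaClass h)⟩
      · have e : (g * b * g⁻¹) ^ 2 = (((g * b * g⁻¹)⁻¹) ^ 2)⁻¹ := by rw [inv_pow, inv_inv]
        have h1 := betaClass_elt_sq_mem h
        have h2 : (((g * b * g⁻¹) ^ 2).elt : latticeIsometries) ∈ conwayGroup := by
          rw [e]; exact inv_mem h1
        refine ⟨ℓ', h2, .inr ?_⟩
        rw [projElt_congr e h2 (inv_mem h1), projElt_inv _ h1, inv_inv]
        exact projElt_sq_mem_alphaClass h
    have hK : heckoidKernel r m x₀ = Subgroup.normalClosure (evenRelators r (m / 2) x₀) := by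
      rw [heckoidKernel, if_pos hm]
    clear h
    refine Subgroup.closure_induction (p := fun g _ => ∃ h, projElt g h ∈ heckoidKernel r m x₀)
      ?_ ?_ ?_ ?_ hg
    · intro y hy
      obtain ⟨b, hb, hy⟩ := Group.mem_conjugatesOfSet_iff.1 hy
      obtain ⟨g, rfl⟩ := isConj_iff.1 hy
      rcases hb with ⟨ℓ, b, hb, rfl⟩ | ⟨ℓ, b, hb, rfl⟩
      · obtain ⟨ℓ', h, h'⟩ := sq_aux g hb
        have h1 : ((g * b ^ 2 * g⁻¹).elt : latticeIsometries) ∈ conwayGroup := by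
          rw [← sq_conj]; exact h
        refine ⟨h1, ?_⟩
        rw [projElt_congr (sq_conj g b).symm h1 h, hK]
        rcases h' with h' | h'
        · exact Subgroup.subset_normalClosure (.inl ⟨ℓ', h'⟩)
        · rw [← inv_mem_iff]
          exact Subgroup.subset_normalClosure (.inl ⟨ℓ', h'⟩)
      · obtain ⟨ℓ', h, h'⟩ := sq_aux g hb
        obtain ⟨n, hn⟩ := hm.two_dvd
        have hn' : m / 2 = n := by omega
        have e : g * b ^ m * g⁻¹ = ((g * b * g⁻¹) ^ 2) ^ n := by
          rw [← pow_mul, ← hn, conj_pow]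
        have h1 : ((g * b ^ m * g⁻¹).elt : latticeIsometries) ∈ conwayGroup := by
          rw [e]; exact elt_pow_mem h n
        refine ⟨h1, ?_⟩
        rw [projElt_congr e h1 (elt_pow_mem h n), projElt_pow _ h, hK, hn']
        rcases h' with h' | h'
        · exact Subgroup.subset_normalClosure (.inr ⟨ℓ', _, h', rfl⟩)
        · rw [← inv_mem_iff, ← inv_pow]
          exact Subgroup.subset_normalClosure (.inr ⟨ℓ', _, h', rfl⟩)
    · exact ⟨one_mem conwayGroup, by rw [projElt_one]; exact one_mem _⟩
    · rintro a b _ _ ⟨ha, ha'⟩ ⟨hb, hb'⟩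
      exact ⟨mul_mem ha hb, by rw [projElt_mul a b ha hb]; exact mul_mem hb' ha'⟩
    · rintro a _ ⟨ha, ha'⟩
      exact ⟨inv_mem ha, by rw [projElt_inv a ha]; exact inv_mem ha'⟩
  · rw [heckoidKernel, if_neg hm]
    obtain ⟨k, γ⟩ := g
    induction γ with | mk γ => ?_
    -- For odd m the projected element is a relator by definition.
    exact Subgroup.subset_normalClosure ⟨k, h, γ, hg, rfl⟩

instance (r : ℚ) (m : ℕ) (x₀ : PuncturedPlane) : (quotientOrbifoldRelators r m x₀).Normal :=
  Subgroup.normalClosure_normal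

/-- The loops of slopes `s` and `s'` are conjugate up to inversion in the Heckoid group, for all
choices of representatives. -/
def LoopsConj (r : ℚ) (m : ℕ) (x₀ : PuncturedPlane) (s s' : OnePoint ℚ) : Prop :=
  ∀ (ℓ : SlopeLine s) (ℓ' : SlopeLine s'), ∀ a ∈ ℓ.alphaClass x₀, ∀ b ∈ ℓ'.alphaClass x₀,
    IsConj (QuotientGroup.mk a : HeckoidGroup r m x₀) (QuotientGroup.mk b) ∨
    IsConj (QuotientGroup.mk a : HeckoidGroup r m x₀) (QuotientGroup.mk b)⁻¹

theorem alphaClass_nonempty (x₀ : PuncturedPlane) {s : OnePoint ℚ} (ℓ : SlopeLine s) :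
    (ℓ.alphaClass x₀).Nonempty := by
  obtain ⟨b, hb⟩ := betaClass_nonempty x₀ ℓ
  exact ⟨_, projElt_sq_mem_alphaClass hb⟩

theorem isConj_or_trans {G : Type*} [Group G] {a b c : G} (h : IsConj a b ∨ IsConj a b⁻¹)
    (h' : IsConj b c ∨ IsConj b c⁻¹) : IsConj a c ∨ IsConj a c⁻¹ := by
  rcases h with h | h <;> rcases h' with h' | h'
  · exact .inl (h.trans h')
  · exact .inr (h.trans h')
  · exact .inr (h.trans (isConj_inv h'))
  · exact .inl (h.trans (by simpa using isConj_inv h'))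

theorem isConj_or_symm {G : Type*} [Group G] {a b : G} (h : IsConj a b ∨ IsConj a b⁻¹) :
    IsConj b a ∨ IsConj b a⁻¹ := by
  rcases h with h | h
  · exact .inl h.symm
  · exact .inr (by simpa using isConj_inv h.symm)

variable {r : ℚ} {m : ℕ}

theorem isConj_or_mk {a b : FundamentalGroup ConwaySphere (conwayProj x₀)}
    (h : IsConj a b ∨ IsConj a b⁻¹) :
    IsConj (QuotientGroup.mk a : HeckoidGroup r m x₀) (QuotientGroup.mk b) ∨
    IsConj (QuotientGroup.mk a : HeckoidGroup r m x₀) (QuotientGroup.mk b)⁻¹ := by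
  rcases h with h | h
  · exact .inl ((QuotientGroup.mk' (heckoidKernel r m x₀)).map_isConj h)
  · right
    have := (QuotientGroup.mk' (heckoidKernel r m x₀)).map_isConj h
    rwa [map_inv] at this

theorem LoopsConj.refl (s : OnePoint ℚ) : LoopsConj r m x₀ s s :=
  fun ℓ ℓ' _ ha _ hb => isConj_or_mk (isConj_of_same_slope ℓ ℓ' ha hb)

theorem LoopsConj.symm {s s' : OnePoint ℚ} (h : LoopsConj r m x₀ s s') : LoopsConj r m x₀ s' s :=
  fun ℓ ℓ' a ha b hb => isConj_or_symm (h ℓ' ℓ b hb a ha)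

/-- Quantifying over all representatives makes the relation transitive, given that a line of the
middle slope exists. -/
theorem LoopsConj.trans {s s' s'' : OnePoint ℚ} (h : LoopsConj r m x₀ s s')
    (h' : LoopsConj r m x₀ s' s'') : LoopsConj r m x₀ s s'' := by
  intro ℓ ℓ' a ha b hb
  obtain ⟨ℓ₁⟩ := (inferInstance : Nonempty (SlopeLine s'))
  obtain ⟨c, hc⟩ := alphaClass_nonempty x₀ ℓ₁
  exact isConj_or_trans (h ℓ ℓ₁ a ha c hc) (h' ℓ₁ ℓ' c hc b hb)

theorem LoopsConj.homotopic {s s' : OnePoint ℚ} (h : LoopsConj r m x₀ s s') :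
    HomotopicInHeckoid r m x₀ s s' := by
  intro ℓ ℓ'
  obtain ⟨a, ha⟩ := alphaClass_nonempty x₀ ℓ
  obtain ⟨b, hb⟩ := alphaClass_nonempty x₀ ℓ'
  exact ⟨a, ha, b, hb, h ℓ ℓ' a ha b hb⟩

/-- α_∞ = β_∞² lies in the kernel for either parity of m, and only the identity is conjugate to the
identity. -/
theorem LoopsConj.nullHomotopic {s : OnePoint ℚ} (h : LoopsConj r m x₀ s ∞) :
    NullHomotopicInHeckoid r m x₀ s := by
  intro ℓ
  obtain ⟨ℓ'⟩ := (inferInstance : Nonempty (SlopeLine ∞))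
  obtain ⟨a, ha⟩ := alphaClass_nonempty x₀ ℓ
  obtain ⟨β, hβ⟩ := betaClass_nonempty x₀ ℓ'
  refine ⟨a, ha, ?_⟩
  have h1 : (QuotientGroup.mk (projElt (β ^ 2) (betaClass_elt_sq_mem hβ)) :
      HeckoidGroup r m x₀) = 1 :=
    (QuotientGroup.eq_one_iff _).2 (projElt_mem_heckoidKernel
      (Subgroup.subset_normalClosure (.inl ⟨ℓ', β, hβ, rfl⟩)) _)
  have := h ℓ ℓ' a ha _ (projElt_sq_mem_alphaClass hβ)
  rw [h1, inv_one, or_self] at this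
  exact isConj_one_left.1 this

/-- The squares lie over H and are congruent up to inversion; the relation between them projects
into the kernel. -/
theorem LoopsConj.of_betaClass {s s' : OnePoint ℚ} {ℓ : SlopeLine s} {ℓ' : SlopeLine s'}
    {x y : OrbifoldPi1 bigConwayGroup x₀} (hx : x ∈ ℓ.betaClass x₀) (hy : y ∈ ℓ'.betaClass x₀)
    (h : (x : OrbifoldPi1 bigConwayGroup x₀ ⧸ quotientOrbifoldRelators r m x₀) = y ∨
      (x : OrbifoldPi1 bigConwayGroup x₀ ⧸ quotientOrbifoldRelators r m x₀) =
        (y : OrbifoldPi1 bigConwayGroup x₀ ⧸ quotientOrbifoldRelators r m x₀)⁻¹) :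
    LoopsConj r m x₀ s s' := by
  have hx2 := betaClass_elt_sq_mem hx
  have hy2 := betaClass_elt_sq_mem hy
  have key : (QuotientGroup.mk (projElt (x ^ 2) hx2) : HeckoidGroup r m x₀) =
      QuotientGroup.mk (projElt (y ^ 2) hy2) ∨
      (QuotientGroup.mk (projElt (x ^ 2) hx2) : HeckoidGroup r m x₀) =
      (QuotientGroup.mk (projElt (y ^ 2) hy2))⁻¹ := by
    rcases h with h | h
    · left
      have h1 : (x ^ 2)⁻¹ * y ^ 2 ∈ quotientOrbifoldRelators r m x₀ := by
        rw [← QuotientGroup.eq, QuotientGroup.mk_pow, QuotientGroup.mk_pow, h]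
      have h2 := projElt_mem_heckoidKernel h1 (mul_mem (inv_mem hx2) hy2)
      rw [projElt_mul (x ^ 2)⁻¹ _ (inv_mem hx2) hy2, projElt_inv _ hx2,
        ← QuotientGroup.eq_one_iff, QuotientGroup.mk_mul, QuotientGroup.mk_inv,
        mul_inv_eq_one] at h2
      exact h2.symm
    · right
      have h1 : x ^ 2 * y ^ 2 ∈ quotientOrbifoldRelators r m x₀ := by
        rw [← QuotientGroup.eq_one_iff, QuotientGroup.mk_mul, QuotientGroup.mk_pow,
          QuotientGroup.mk_pow, h, inv_pow, inv_mul_cancel]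
      have h2 := projElt_mem_heckoidKernel h1 (mul_mem hx2 hy2)
      rw [projElt_mul _ _ hx2 hy2, ← QuotientGroup.eq_one_iff, QuotientGroup.mk_mul,
        mul_eq_one_iff_eq_inv] at h2
      rw [h2, inv_inv]
  have key' : IsConj (QuotientGroup.mk (projElt (x ^ 2) hx2) : HeckoidGroup r m x₀)
      (QuotientGroup.mk (projElt (y ^ 2) hy2)) ∨
      IsConj (QuotientGroup.mk (projElt (x ^ 2) hx2) : HeckoidGroup r m x₀)
      (QuotientGroup.mk (projElt (y ^ 2) hy2))⁻¹ :=
    key.imp (fun h => by rw [h]) (fun h => by rw [h])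
  intro ℓ₁ ℓ₁' a ha b hb
  exact isConj_or_trans (LoopsConj.refl s ℓ₁ ℓ a ha _ (projElt_sq_mem_alphaClass hx))
    (isConj_or_trans key' (LoopsConj.refl s' ℓ' ℓ₁' _ (projElt_sq_mem_alphaClass hy) b hb))

end
end

noncomputable section

open OrbifoldPi1

/-! ## The action of integral matrices on slopes -/

/-- The slope `x / y`. -/
def slopeOf (x y : ℤ) : OnePoint ℚ := if y = 0 then ∞ else ((x / y : ℚ) : OnePoint ℚ)

theorem slopeOf_num_den (s : OnePoint ℚ) : slopeOf (slopeNum s) (slopeDen s) = s := by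
  induction s using OnePoint.rec with
  | infty => simp [slopeOf, slopeDen]
  | coe q => simp [slopeOf, slopeDen, slopeNum, Rat.num_div_den]

theorem slopeVec_slopeOf {x y : ℤ} (h : IsCoprime x y) :
    slopeVec (slopeOf x y) = latticeVec y x ∨ slopeVec (slopeOf x y) = -(latticeVec y x : ℂ) := by
  by_cases hy : y = 0
  · subst hy
    rw [isCoprime_zero_right, Int.isUnit_iff] at h
    rcases h with rfl | rfl
    · left; simp [slopeOf, slopeVec, slopeNum, slopeDen, latticeVec]
    · right; simp [slopeOf, slopeVec, slopeNum, slopeDen, latticeVec]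
  · have key : ∀ x y : ℤ, IsCoprime x y → 0 < y →
        slopeNum (slopeOf x y) = x ∧ slopeDen (slopeOf x y) = y := by
      intro x y h hy
      rw [slopeOf, if_neg hy.ne']
      exact ⟨Rat.num_div_eq_of_coprime hy (Int.isCoprime_iff_nat_coprime.1 h),
        Rat.den_div_eq_of_coprime hy (Int.isCoprime_iff_nat_coprime.1 h)⟩
    rcases lt_or_gt_of_ne hy with hy | hy
    · right
      have e : slopeOf x y = slopeOf (-x) (-y) := by
        simp [slopeOf]
      obtain ⟨h1, h2⟩ := key (-x) (-y) h.neg_neg (by omega)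
      rw [e, slopeVec, h1, h2]; simp [latticeVec]; ring
    · left
      obtain ⟨h1, h2⟩ := key x y h hy
      rw [slopeVec, h1, h2]; rfl

theorem smul_slopeOf {g : GL (Fin 2) ℚ} {M : Matrix (Fin 2) (Fin 2) ℤ}
    (hg : ∀ i j, g i j = M i j) {x y : ℤ} (h : IsCoprime x y) :
    g • slopeOf x y = slopeOf (M 0 0 * x + M 0 1 * y) (M 1 0 * x + M 1 1 * y) := by
  by_cases hy : y = 0
  · subst hy
    have hx : (x : ℚ) ≠ 0 := by
      rintro hx
      have hx : x = 0 := by exact_mod_cast hx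
      subst hx
      exact not_isCoprime_zero_zero h
    have hx' : x ≠ 0 := by exact_mod_cast hx
    simp only [slopeOf, if_true, OnePoint.smul_infty_eq_ite, hg, mul_zero, add_zero,
      Int.cast_eq_zero, mul_eq_zero, hx', or_false]
    split_ifs with h1
    · rfl
    · congr 1
      push_cast
      rw [mul_div_mul_right _ _ hx]
  · have hy' : (y : ℚ) ≠ 0 := by exact_mod_cast hy
    rw [slopeOf, if_neg hy, OnePoint.smul_some_eq_ite]
    simp only [hg, slopeOf]
    have e : (M 1 0 : ℚ) * (x / y) + M 1 1 = ((M 1 0 * x + M 1 1 * y : ℤ) : ℚ) / y := by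
      push_cast; field_simp
    have e' : (M 0 0 : ℚ) * (x / y) + M 0 1 = ((M 0 0 * x + M 0 1 * y : ℤ) : ℚ) / y := by
      push_cast; field_simp
    rw [e, e']
    simp only [div_eq_zero_iff, hy', or_false, Int.cast_eq_zero]
    split_ifs with h1
    · rfl
    · rw [div_div_div_cancel_right₀ hy']

theorem coe_conj_T_pow (A : SL(2, ℤ)) (m : ℕ) :
    ((A * ModularGroup.T ^ m * A⁻¹ : SL(2, ℤ)) : Matrix (Fin 2) (Fin 2) ℤ) =
      !![1 - m * A 0 0 * A 1 0, m * A 0 0 * A 0 0;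
        -m * A 1 0 * A 1 0, 1 + m * A 0 0 * A 1 0] := by
  have hd := A.det_coe
  rw [Matrix.det_fin_two] at hd
  rw [Matrix.SpecialLinearGroup.coe_mul, Matrix.SpecialLinearGroup.coe_mul, ← zpow_natCast,
    ModularGroup.coe_T_zpow, Matrix.SpecialLinearGroup.coe_inv, Matrix.adjugate_fin_two]
  ext i j
  fin_cases i <;> fin_cases j <;> simp [Matrix.mul_apply, Fin.sum_univ_two]
  · linear_combination hd
  · ring
  · ring
  · linear_combination hd

theorem isCoprime_mulVec {M : Matrix (Fin 2) (Fin 2) ℤ} (hM : M.det = 1 ∨ M.det = -1) {x y : ℤ}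
    (h : IsCoprime x y) :
    IsCoprime (M 0 0 * x + M 0 1 * y) (M 1 0 * x + M 1 1 * y) := by
  obtain ⟨a, b, h⟩ := h
  rw [Matrix.det_fin_two] at hM
  have hD : (M 0 0 * M 1 1 - M 0 1 * M 1 0) * (M 0 0 * M 1 1 - M 0 1 * M 1 0) = 1 := by
    rcases hM with h | h <;> rw [h] <;> norm_num
  set D := M 0 0 * M 1 1 - M 0 1 * M 1 0 with hDdef
  -- The Bézout row (a, b) times the inverse matrix, which is D times the adjugate.
  refine ⟨D * (a * M 1 1 - b * M 1 0), D * (-a * M 0 1 + b * M 0 0), ?_⟩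
  linear_combination D * D * h + hD - (a * x + b * y) * D * hDdef

theorem slopeVec_smul {g : GL (Fin 2) ℚ} {M : Matrix (Fin 2) (Fin 2) ℤ}
    (hg : ∀ i j, g i j = M i j) (hM : M.det = 1 ∨ M.det = -1) (s : OnePoint ℚ) :
    slopeVec (g • s) = latticeVec (M 1 0 * slopeNum s + M 1 1 * slopeDen s)
        (M 0 0 * slopeNum s + M 0 1 * slopeDen s) ∨
      slopeVec (g • s) = -(latticeVec (M 1 0 * slopeNum s + M 1 1 * slopeDen s)
        (M 0 0 * slopeNum s + M 0 1 * slopeDen s) : ℂ) := by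
  have := slopeVec_slopeOf (isCoprime_mulVec hM (isCoprime_slope s))
  rwa [← smul_slopeOf hg (isCoprime_slope s), slopeOf_num_den] at this

/-- The matrix of a reflection in the edge joining `∞` to the integer `k`. -/
theorem fareyReflections_infty_entries {g : GL (Fin 2) ℚ} (hg : g ∈ fareyReflections ∞) :
    ∃ (A : Matrix (Fin 2) (Fin 2) ℤ) (k : ℤ), (∀ i j, g i j = A i j) ∧ A.det = -1 ∧ A 1 0 = 0 ∧
      A 0 0 * A 1 1 = -1 ∧ A 0 0 * k + A 0 1 = k * A 1 1 := by
  obtain ⟨⟨A, hA, rfl⟩, hinf, v, hv, hgv⟩ := hg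
  have hentry : ∀ i j, (Matrix.GeneralLinearGroup.map (Int.castRingHom ℚ) A) i j =
      ((A : Matrix (Fin 2) (Fin 2) ℤ) i j : ℚ) := fun i j => rfl
  have hdet : (A : Matrix (Fin 2) (Fin 2) ℤ).det = -1 := by
    rw [← Matrix.GeneralLinearGroup.val_det_apply, hA]; rfl
  rw [OnePoint.smul_infty_eq_self_iff, hentry] at hinf
  have h10 : (A : Matrix (Fin 2) (Fin 2) ℤ) 1 0 = 0 := by exact_mod_cast hinf
  have hd := hdet
  rw [Matrix.det_fin_two, h10, mul_zero, sub_zero] at hd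
  obtain ⟨k, rfl⟩ : ∃ k : ℤ, v = ((k : ℚ) : OnePoint ℚ) := by
    induction v using OnePoint.rec with
    | infty => simp [FareyAdj, slopeDen, slopeNum] at hv
    | coe q =>
      simp only [FareyAdj, slopeNum, slopeDen, OnePoint.elim_infty, OnePoint.elim_some, one_mul,
        mul_zero, sub_zero, Nat.abs_cast] at hv
      exact ⟨q.num, by
        rw [(Rat.den_eq_one_iff q).1 (by exact_mod_cast hv)]⟩
  have h11 : (A : Matrix (Fin 2) (Fin 2) ℤ) 1 1 ≠ 0 := by
    intro h; rw [h] at hd; simp at hd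
  have h11' : (((A : Matrix (Fin 2) (Fin 2) ℤ) 1 1 : ℤ) : ℚ) ≠ 0 := by exact_mod_cast h11
  rw [OnePoint.smul_some_eq_ite] at hgv
  simp only [hentry, h10, Int.cast_zero, zero_mul, zero_add, h11', if_false,
    OnePoint.coe_eq_coe] at hgv
  rw [div_eq_iff h11'] at hgv
  exact ⟨A, k, hentry, hdet, h10, hd, by exact_mod_cast hgv⟩

/-! ### The generators of Γ(r;n) preserve the loops -/

section

variable {x₀ : PuncturedPlane} {r : ℚ} {m : ℕ}

/-- Completing (p, q) to a matrix in SL(2,ℤ) with this first column turns the combinations into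
first vectors of bases with congruent triples. -/
theorem LoopsConj.of_tripleCongr {u w u' w' : planeLattice}
    (h : TripleCongr (quotientOrbifoldRelators r m x₀) u w u' w') {p q : ℤ} (hpq : IsCoprime p q)
    {s s' : OnePoint ℚ}
    (hs : slopeVec s = (p • u + q • w : planeLattice) ∨
      slopeVec s = -((p • u + q • w : planeLattice) : ℂ))
    (hs' : slopeVec s' = (p • u' + q • w' : planeLattice) ∨
      slopeVec s' = -((p • u' + q • w' : planeLattice) : ℂ)) : LoopsConj r m x₀ s s' := by
  obtain ⟨a, b, hab⟩ := hpq
  have h' := h.specialLinear ⟨!![p, -b; q, a], by rw [Matrix.det_fin_two_of]; linarith⟩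
  simp only [Matrix.of_apply, Matrix.cons_val', Matrix.cons_val_zero, Matrix.cons_val_one,
    Matrix.cons_val_fin_one] at h'
  obtain ⟨ℓ, ℓ', x, hx, y, hy, e⟩ := h'.exists_betaClass hs hs'
  exact .of_betaClass hx hy e

theorem IsTriple.pow_mem_iff_neg {N : Subgroup (OrbifoldPi1 bigConwayGroup x₀)}
    {u w : planeLattice} {a b c : OrbifoldPi1 bigConwayGroup x₀} (t : IsTriple u w a b c) (k : ℕ) :
    (c * b) ^ k ∈ N ↔ (b * c) ^ k ∈ N := by
  obtain ⟨hb, hc⟩ := t.sq_eq_one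
  have e : b * c = (c * b)⁻¹ := by
    rw [mul_inv_rev, inv_eq_of_mul_eq_one_right hb, inv_eq_of_mul_eq_one_right hc]
  rw [e, inv_pow, inv_mem_iff]

/-- A reflection in a Farey edge with endpoint `∞` preserves the homotopy class of `α_s`. -/
theorem LoopsConj.reflection {g : GL (Fin 2) ℚ} (hg : g ∈ fareyReflections ∞) (s : OnePoint ℚ) :
    LoopsConj r m x₀ s (g • s) := by
  obtain ⟨A, k, hentry, hdet, h10, hd, h01⟩ := fareyReflections_infty_entries hg
  have hu : slopeVec ∞ = latticeVec 0 1 := by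
    simp [slopeVec, latticeVec, slopeNum, slopeDen]
  -- The basis vectors have slopes ∞ and k; up to sign, the reflection negates the first and fixes
  -- the second.
  have huw : IsUnimodular (latticeVec 0 1) (latticeVec 1 k) := by
    right; rw [planeDet_latticeVec]; simp
  obtain ⟨a, b, c, t⟩ := exists_isTriple x₀ huw
  have hN : (c * b) ^ 2 ∈ quotientOrbifoldRelators r m x₀ := by
    obtain ⟨ℓ, hℓ⟩ := t.mul_mem_betaClass hu
    exact Subgroup.subset_normalClosure (.inl ⟨ℓ, _, hℓ, rfl⟩)
  -- These are the coordinates of the vector of s in this basis.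
  have hcop : IsCoprime (slopeNum s - k * slopeDen s) (slopeDen s) := by
    obtain ⟨a, b, h⟩ := isCoprime_slope s
    exact ⟨a, b + a * k, by linear_combination h⟩
  refine .of_tripleCongr (TripleCongr.of_sq_mem t hN) hcop (.inl ?_) ?_
  · simp [slopeVec, latticeVec]; ring
  · have h := slopeVec_smul hentry (.inr hdet) s
    rw [h10] at h
    set A00 := A 0 0
    set A01 := A 0 1
    set A11 := A 1 1
    have e01 : A01 = k * A11 - A00 * k := by linarith
    rcases Int.eq_one_or_neg_one_of_mul_eq_neg_one hd with h0 | h0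
    · have h1 : A11 = -1 := by rw [h0] at hd; linarith
      rw [e01, h0, h1] at h
      rcases h with h | h
      · right; rw [h]; simp [latticeVec]; ring
      · left; rw [h]; simp [latticeVec]; ring
    · have h1 : A11 = 1 := by rw [h0] at hd; linarith
      rw [e01, h0, h1] at h
      rcases h with h | h
      · left; rw [h]; simp [latticeVec]; ring
      · right; rw [h]; simp [latticeVec]; ring

/-- The parabolic transformation centred at `r` by `m` units preserves the homotopy class of
`α_s`. -/
theorem LoopsConj.parabolic {g : GL (Fin 2) ℚ} (hg : g ∈ parabolicShift (r : OnePoint ℚ) m)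
    (s : OnePoint ℚ) : LoopsConj r m x₀ s (g • s) := by
  obtain ⟨A, hA, rfl⟩ := hg
  have hdet := A.det_coe
  have hd := hdet
  rw [Matrix.det_fin_two] at hd
  have hu : slopeVec r = latticeVec (A 1 0) (A 0 0) ∨
      slopeVec r = -(latticeVec (A 1 0) (A 0 0) : ℂ) := by
    have := slopeVec_smul (g := Matrix.SpecialLinearGroup.mapGL ℚ A) (M := A) (fun i j => rfl)
      (.inl hdet) ∞
    rw [hA] at this
    simpa [slopeNum, slopeDen] using this
  -- The basis consists of the columns of A, denominator first. A T^m A⁻¹ fixes the first and adds m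
  -- times the first to the second.
  have huw : IsUnimodular (latticeVec (A 1 0) (A 0 0)) (latticeVec (A 1 1) (A 0 1)) := by
    right; rw [planeDet_latticeVec]
    exact_mod_cast (by linarith : A 1 0 * A 0 1 - A 0 0 * A 1 1 = -1)
  obtain ⟨a, b, c, t⟩ := exists_isTriple x₀ huw
  have hN : (c * b) ^ m ∈ quotientOrbifoldRelators r m x₀ := by
    rcases hu with hu | hu
    · obtain ⟨ℓ, hℓ⟩ := t.mul_mem_betaClass hu
      exact Subgroup.subset_normalClosure (.inr ⟨ℓ, _, hℓ, rfl⟩)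
    · obtain ⟨ℓ, hℓ⟩ := t.mul_mem_betaClass_neg hu
      rw [t.pow_mem_iff_neg]
      exact Subgroup.subset_normalClosure (.inr ⟨ℓ, _, hℓ, rfl⟩)
  -- The coordinates of the vector of s in this basis, given by A⁻¹.
  have hcop : IsCoprime (A 1 1 * slopeNum s - A 0 1 * slopeDen s)
      (-A 1 0 * slopeNum s + A 0 0 * slopeDen s) := by
    obtain ⟨x, y, h⟩ := isCoprime_slope s
    refine ⟨x * A 0 0 + y * A 1 0, x * A 0 1 + y * A 1 1, ?_⟩
    linear_combination h + (x * slopeNum s + y * slopeDen s) * hd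
  have hdC : ((A 0 0 * A 1 1 - A 0 1 * A 1 0 : ℤ) : ℂ) = 1 := by rw [hd]; norm_num
  push_cast at hdC
  refine .of_tripleCongr (TripleCongr.of_pow_mem t hN) hcop (.inl ?_) ?_
  · simp [slopeVec, latticeVec]
    linear_combination -(slopeDen s + slopeNum s * Complex.I) * hdC
  · have h := slopeVec_smul (g := Matrix.SpecialLinearGroup.mapGL ℚ (A * ModularGroup.T ^ m * A⁻¹))
      (M := (A * ModularGroup.T ^ m * A⁻¹ : SL(2, ℤ))) (fun i j => rfl)
      (.inl (Matrix.SpecialLinearGroup.det_coe _)) s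
    rw [coe_conj_T_pow] at h
    simp only [Matrix.of_apply, Matrix.cons_val', Matrix.cons_val_zero, Matrix.cons_val_one,
      Matrix.cons_val_fin_one] at h
    refine h.imp (fun h => ?_) (fun h => ?_)
    · rw [h]; simp [latticeVec]
      linear_combination -(slopeDen s + slopeNum s * Complex.I) * hdC
    · rw [h, neg_inj]; simp [latticeVec]
      linear_combination -(slopeDen s + slopeNum s * Complex.I) * hdC

theorem LoopsConj.of_mem {g : GL (Fin 2) ℚ} (hg : g ∈ heckoidFareyGroup r m) (s : OnePoint ℚ) :
    LoopsConj r m x₀ s (g • s) := by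
  let K : Subgroup (GL (Fin 2) ℚ) :=
    { carrier := {g | ∀ s, LoopsConj r m x₀ s (g • s)}
      one_mem' := fun s => by rw [one_smul]; exact .refl s
      mul_mem' := fun {a b} ha hb s => by rw [mul_smul]; exact (hb s).trans (ha _)
      inv_mem' := fun {a} ha s => by
        have := ha (a⁻¹ • s)
        rw [smul_inv_smul] at this
        exact this.symm }
  have : heckoidFareyGroup r m ≤ K :=
    sup_le ((Subgroup.closure_le K).2 fun g hg s => .reflection hg s)
      ((Subgroup.closure_le K).2 fun g hg s => .parabolic hg s)
  exact this hg s

end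
end

noncomputable section

/-! ## Two commuting retractions and their common fixed points -/

section Retraction

variable {α : Type*} {φ ψ : α → α} {F J : Set α}

/-- Some iterates of two points under a map agree. -/
def EventuallyEq (f : α → α) (x y : α) : Prop := ∃ k l : ℕ, f^[k] x = f^[l] y

theorem EventuallyEq.symm {f : α → α} {x y : α} (h : EventuallyEq f x y) : EventuallyEq f y x :=
  let ⟨k, l, h⟩ := h; ⟨l, k, h.symm⟩

theorem EventuallyEq.trans {f : α → α} {x y z : α} (h : EventuallyEq f x y)
    (h' : EventuallyEq f y z) : EventuallyEq f x z := by
  obtain ⟨k, l, h⟩ := h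
  obtain ⟨k', l', h'⟩ := h'
  refine ⟨k' + k, l + l', ?_⟩
  rw [Function.iterate_add_apply, h, ← Function.iterate_add_apply, add_comm k' l,
    Function.iterate_add_apply, h', ← Function.iterate_add_apply]

theorem EventuallyEq.eq_of_fixed {f : α → α} {x y : α} (h : EventuallyEq f x y) (hx : f x = x)
    (hy : f y = y) : x = y := by
  obtain ⟨k, l, h⟩ := h
  rwa [Function.iterate_fixed hx, Function.iterate_fixed hy] at h

theorem eventuallyEq_right (hψ : ∀ x, ψ x ∈ J) (hψJ : ∀ x ∈ J, ψ x = x) (x : α) :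
    EventuallyEq (φ ∘ ψ) x (ψ x) :=
  ⟨1, 1, by simp [hψJ _ (hψ x)]⟩

/-- A point of F is fixed by φ. Any other point lies in J, so ψ fixes it and one step of φ ∘ ψ is φ.
-/
theorem eventuallyEq_left (hφF : ∀ x ∈ F, φ x = x) (hψJ : ∀ x ∈ J, ψ x = x)
    (hFJ : ∀ x, x ∉ F → x ∈ J) (x : α) : EventuallyEq (φ ∘ ψ) x (φ x) := by
  by_cases hx : x ∈ F
  · rw [hφF x hx]; exact ⟨0, 0, rfl⟩
  · exact ⟨1, 0, by simp [hψJ x (hFJ x hx)]⟩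

end Retraction

/-! ## Folding along the reflections in the edges at `∞` -/

/-- Folding of the line onto `[f, f + 1]`. -/
def foldRat (f : ℤ) (x : ℚ) : ℚ := f + 1 - |2 * Int.fract ((x - f) / 2) - 1|

theorem foldRat_mem (f : ℤ) (x : ℚ) : foldRat f x ∈ Set.Icc (f : ℚ) (f + 1) := by
  have h0 := Int.fract_nonneg ((x - f) / 2)
  have h1 := Int.fract_lt_one ((x - f) / 2)
  have h2 : |2 * Int.fract ((x - f) / 2) - 1| ≤ 1 := abs_le.2 ⟨by linarith, by linarith⟩
  have h3 := abs_nonneg (2 * Int.fract ((x - f) / 2) - 1)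
  exact ⟨by unfold foldRat; linarith, by unfold foldRat; linarith⟩

theorem foldRat_of_mem {f : ℤ} {x : ℚ} (h : x ∈ Set.Icc (f : ℚ) (f + 1)) : foldRat f x = x := by
  obtain ⟨h0, h1⟩ := h
  rw [foldRat, Int.fract_eq_self.2 ⟨by linarith, by linarith⟩, abs_of_nonpos (by linarith)]
  ring

theorem foldRat_reflect (f k : ℤ) (x : ℚ) : foldRat f (2 * k - x) = foldRat f x := by
  have e : (2 * k - x - f) / 2 = -((x - f) / 2) + ((k - f : ℤ) : ℚ) := by push_cast; ring
  rw [foldRat, foldRat, e, Int.fract_add_intCast]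
  by_cases h : Int.fract ((x - f) / 2) = 0
  · rw [h, Int.fract_neg_eq_zero.2 h]
  · rw [Int.fract_neg h, abs_sub_comm]
    congr 2; ring

theorem foldRat_cases (f : ℤ) (x : ℚ) :
    (∃ j : ℤ, foldRat f x = x - 2 * j) ∨ ∃ k : ℤ, foldRat f x = 2 * k - x := by
  have e := Int.self_sub_floor ((x - f) / 2)
  rcases le_total (2 * Int.fract ((x - f) / 2) - 1) 0 with h | h
  · left
    refine ⟨⌊(x - f) / 2⌋, ?_⟩
    rw [foldRat, abs_of_nonpos h, ← e]; ring
  · right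
    refine ⟨f + 1 + ⌊(x - f) / 2⌋, ?_⟩
    rw [foldRat, abs_of_nonneg h, ← e]; push_cast; ring

theorem foldRat_den (f : ℤ) (x : ℚ) : (foldRat f x).den = x.den := by
  rcases foldRat_cases f x with ⟨j, h⟩ | ⟨k, h⟩
  · rw [h, show (2 * j : ℚ) = ((2 * j : ℤ) : ℚ) by push_cast; ring, Rat.sub_intCast_den]
  · rw [h, show (2 * k : ℚ) = ((2 * k : ℤ) : ℚ) by push_cast; ring, Rat.intCast_sub_den]

/-- A point x > f + 1 is folded to a point at most f + 1 and at least the mirror image 2(f + 1) - x,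
which is nearer to r than x because r < f + 1. The left side is symmetric. -/
theorem abs_foldRat_sub_lt {f : ℤ} {r x : ℚ} (h0 : f < r) (h1 : r < f + 1)
    (hx : x ∉ Set.Icc (f : ℚ) (f + 1)) : |foldRat f x - r| < |x - r| := by
  have key : ∀ y : ℚ, f + 1 < y → f + 1 - (y - (f + 1)) ≤ foldRat f y := by
    intro y hy
    have e := Int.self_sub_floor ((y - f) / 2)
    have hfl : (0 : ℤ) ≤ ⌊(y - f) / 2⌋ := Int.floor_nonneg.2 (by linarith)
    have hfl' : (0 : ℚ) ≤ ⌊(y - f) / 2⌋ := by exact_mod_cast hfl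
    have h0 := Int.fract_nonneg ((y - f) / 2)
    rw [foldRat]
    have : |2 * Int.fract ((y - f) / 2) - 1| ≤ y - (f + 1) := by
      rw [abs_le]
      refine ⟨?_, by linarith⟩
      rcases hfl.eq_or_lt with h | h
      · rw [← h] at e; push_cast at e; linarith
      · have : (1 : ℚ) ≤ ⌊(y - f) / 2⌋ := by exact_mod_cast h
        have := Int.floor_le ((y - f) / 2)
        linarith
    linarith
  obtain ⟨m0, m1⟩ := foldRat_mem f x
  rw [Set.mem_Icc, not_and_or, not_le, not_le] at hx
  rcases hx with hx | hx
  · have h2 : foldRat f x ≤ f + (f - x) := by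
      have e := Int.self_sub_floor ((2 * f - x - f) / 2)
      have hfl' : (0 : ℤ) ≤ ⌊((2 : ℚ) * f - x - f) / 2⌋ := Int.floor_nonneg.2 (by linarith)
      have hfl : (0 : ℚ) ≤ ⌊((2 : ℚ) * f - x - f) / 2⌋ := Int.cast_nonneg hfl'
      have h3 := neg_le_abs (2 * Int.fract ((2 * f - x - f) / 2) - 1)
      rw [← foldRat_reflect f f x, foldRat]
      linarith
    rw [abs_of_neg (by linarith : x - r < 0), abs_lt]
    constructor <;> linarith
  · have := key x hx
    rw [abs_of_pos (by linarith : 0 < x - r), abs_lt]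
    constructor <;> linarith

/-- Folding of `ℚ ∪ {∞}` onto `[f, f + 1] ∪ {∞}`. -/
def fold (f : ℤ) (s : OnePoint ℚ) : OnePoint ℚ := s.map (foldRat f)

theorem smul_eq_of_mem_fareyReflections {g : GL (Fin 2) ℚ} (hg : g ∈ fareyReflections ∞) :
    g • (∞ : OnePoint ℚ) = ∞ ∧ ∃ k : ℤ, ∀ x : ℚ, g • (x : OnePoint ℚ) = ((2 * k - x : ℚ) : OnePoint ℚ) := by
  obtain ⟨A, k, hentry, hdet, h10, hd, h01⟩ := fareyReflections_infty_entries hg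
  refine ⟨hg.2.1, k, fun x => ?_⟩
  have e01 : A 0 1 = k * A 1 1 - A 0 0 * k := by linarith
  rw [OnePoint.smul_some_eq_ite]
  simp only [hentry, h10, e01]
  rcases Int.eq_one_or_neg_one_of_mul_eq_neg_one hd with h0 | h0
  · have h1 : A 1 1 = -1 := by rw [h0] at hd; linarith
    rw [h0, h1]; simp; ring
  · have h1 : A 1 1 = 1 := by rw [h0] at hd; linarith
    rw [h0, h1]; simp; ring

theorem exists_mem_fareyReflections (k : ℤ) : ∃ g ∈ fareyReflections ∞,
    ∀ x : ℚ, g • (x : OnePoint ℚ) = ((2 * k - x : ℚ) : OnePoint ℚ) := by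
  let A : GL (Fin 2) ℤ := Matrix.GeneralLinearGroup.mk'' !![-1, 2 * k; 0, 1]
    (by rw [Matrix.det_fin_two_of]; simp)
  have hentry : ∀ i j, (Matrix.GeneralLinearGroup.map (Int.castRingHom ℚ) A) i j =
      (!![-1, 2 * k; 0, 1] i j : ℤ) := fun i j => rfl
  have key : ∀ x : ℚ, (Matrix.GeneralLinearGroup.map (Int.castRingHom ℚ) A) • (x : OnePoint ℚ) =
      ((2 * k - x : ℚ) : OnePoint ℚ) := by
    intro x
    rw [OnePoint.smul_some_eq_ite]
    simp only [hentry]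
    simp; ring
  refine ⟨_, ⟨⟨A, ?_, rfl⟩, ?_, ((k : ℚ) : OnePoint ℚ), ?_, ?_⟩, key⟩
  · apply Units.ext
    rw [Matrix.GeneralLinearGroup.val_det_apply]
    change Matrix.det !![-1, 2 * k; 0, 1] = -1
    rw [Matrix.det_fin_two_of]; simp
  · rw [OnePoint.smul_infty_eq_self_iff, hentry]; simp
  · simp [FareyAdj, slopeNum, slopeDen]
  · rw [key]; congr 1; ring

theorem exists_reflectionGroup_smul_eq_fold (f : ℤ) (s : OnePoint ℚ) :
    ∃ g ∈ reflectionGroup ∞, g • s = fold f s := by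
  induction s using OnePoint.rec with
  | infty => exact ⟨1, one_mem _, by simp [fold]⟩
  | coe x =>
    rcases foldRat_cases f x with ⟨j, h⟩ | ⟨k, h⟩
    -- The translation by -2j is the reflection in 0 followed by the reflection in -j.
    · obtain ⟨g, hg, hgx⟩ := exists_mem_fareyReflections 0
      obtain ⟨g', hg', hgx'⟩ := exists_mem_fareyReflections (-j)
      refine ⟨g' * g, mul_mem (Subgroup.subset_closure hg') (Subgroup.subset_closure hg), ?_⟩
      rw [mul_smul, hgx, hgx', fold, OnePoint.map_some, h]
      congr 1; push_cast; ring
    · obtain ⟨g, hg, hgx⟩ := exists_mem_fareyReflections k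
      exact ⟨g, Subgroup.subset_closure hg, by rw [hgx, fold, OnePoint.map_some, h]⟩

theorem fold_smul {f : ℤ} {g : GL (Fin 2) ℚ} (hg : g ∈ fareyReflections ∞) (s : OnePoint ℚ) :
    fold f (g • s) = fold f s := by
  obtain ⟨h, k, hk⟩ := smul_eq_of_mem_fareyReflections hg
  induction s using OnePoint.rec with
  | infty => rw [h]
  | coe x => rw [hk, fold, fold, OnePoint.map_some, OnePoint.map_some, foldRat_reflect]

/-! ## The coordinate in which the parabolic transformations at `r` are translations -/

/-- The coordinate `1 / (r - s)`. -/
def zeta (r : ℚ) (s : OnePoint ℚ) : ℚ := s.elim 0 (fun x => (r - x)⁻¹)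

/-- The point with a given coordinate. -/
def unzeta (r ζ : ℚ) : OnePoint ℚ := if ζ = 0 then ∞ else ((r - ζ⁻¹ : ℚ) : OnePoint ℚ)

theorem zeta_unzeta (r ζ : ℚ) : zeta r (unzeta r ζ) = ζ := by
  rw [unzeta]
  split_ifs with h
  · rw [h]; rfl
  · simp [zeta]

theorem unzeta_ne (r ζ : ℚ) : unzeta r ζ ≠ (r : OnePoint ℚ) := by
  rw [unzeta]
  split_ifs with h
  · exact OnePoint.infty_ne_coe r
  · rw [Ne, OnePoint.coe_eq_coe, sub_eq_self, inv_eq_zero]; exact h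

/-- The point r is excluded because the convention 0⁻¹ = 0 gives it the coordinate of ∞. -/
theorem unzeta_zeta {r : ℚ} {s : OnePoint ℚ} (h : s ≠ (r : OnePoint ℚ)) :
    unzeta r (zeta r s) = s := by
  induction s using OnePoint.rec with
  | infty => simp [zeta, unzeta]
  | coe x =>
    have h' : r - x ≠ 0 := by
      rw [Ne, sub_eq_zero]; rintro rfl; exact h rfl
    simp [zeta, unzeta, h']

/-- The first column of A is ±(num, den), and the conjugate of T^m is quadratic in it, so neither
the sign nor the second column matters. -/
theorem parabolicShift_entries {r : ℚ} {m : ℕ} {g : GL (Fin 2) ℚ}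
    (hg : g ∈ parabolicShift (r : OnePoint ℚ) m) :
    ∃ M : Matrix (Fin 2) (Fin 2) ℤ, (∀ i j, g i j = M i j) ∧ M.det = 1 ∧
      M = !![1 - m * r.num * r.den, m * r.num * r.num; -m * r.den * r.den, 1 + m * r.num * r.den] := by
  obtain ⟨A, hA, rfl⟩ := hg
  refine ⟨(A * ModularGroup.T ^ m * A⁻¹ : SL(2, ℤ)), fun i j => rfl,
    Matrix.SpecialLinearGroup.det_coe _, ?_⟩
  have h := slopeVec_smul (g := Matrix.SpecialLinearGroup.mapGL ℚ A) (M := A) (fun i j => rfl)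
      (.inl A.det_coe) ∞
  rw [hA] at h
  simp only [slopeVec, latticeVec, slopeNum, slopeDen, OnePoint.elim_some, OnePoint.elim_infty] at h
  rw [coe_conj_T_pow]
  rcases h with h | h
  · have h1 := congrArg Complex.re h
    have h2 := congrArg Complex.im h
    simp at h1 h2
    norm_cast at h1 h2
    rw [← h1, ← h2]
  · have h1 := congrArg Complex.re h
    have h2 := congrArg Complex.im h
    simp at h1 h2
    norm_cast at h1 h2
    simp only [show A 1 0 = -(r.den : ℤ) by omega, show A 0 0 = -r.num by omega, neg_mul, mul_neg,
      neg_neg]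

/-- A parabolic map fixing r becomes a translation once r is sent to infinity. The factor den²
appears because consecutive Farey neighbours of r differ by den² in this coordinate. -/
theorem zeta_smul {r : ℚ} {m : ℕ} (hm : 0 < m) {g : GL (Fin 2) ℚ}
    (hg : g ∈ parabolicShift (r : OnePoint ℚ) m) {s : OnePoint ℚ} (hs : s ≠ (r : OnePoint ℚ)) :
    g • s ≠ (r : OnePoint ℚ) ∧ zeta r (g • s) = zeta r s + m * r.den ^ 2 := by
  obtain ⟨M, hM, -, rfl⟩ := parabolicShift_entries hg
  have hb : (r.den : ℚ) ≠ 0 := by exact_mod_cast r.den_ne_zero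
  have hm' : (m : ℚ) ≠ 0 := by exact_mod_cast hm.ne'
  have ha : (r.num : ℚ) = r * r.den := (Rat.mul_den_eq_num r).symm
  have h10 : g 1 0 = -(m * r.den ^ 2 : ℚ) := by rw [hM]; simp; ring
  have h00 : g 0 0 = 1 - m * r.den ^ 2 * r := by rw [hM]; simp; rw [ha]; ring
  have h01 : g 0 1 = m * r.den ^ 2 * r ^ 2 := by rw [hM]; simp; rw [ha]; ring
  have h11 : g 1 1 = 1 + m * r.den ^ 2 * r := by rw [hM]; simp; rw [ha]; ring
  have hP : (m * r.den ^ 2 : ℚ) ≠ 0 := mul_ne_zero hm' (pow_ne_zero 2 hb)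
  generalize (m * r.den ^ 2 : ℚ) = P at *
  suffices g • s = unzeta r (zeta r s + P) by
    rw [this]; exact ⟨unzeta_ne _ _, zeta_unzeta _ _⟩
  induction s using OnePoint.rec with
  | infty =>
    rw [OnePoint.smul_infty_eq_ite, h10, h00]
    simp only [neg_eq_zero, hP, if_false, zeta, OnePoint.elim_infty, zero_add, unzeta]
    congr 1
    field_simp; ring
  | coe x =>
    have hx : r - x ≠ 0 := by
      rw [Ne, sub_eq_zero]; rintro rfl; exact hs rfl
    have e : zeta r x + P = (-P * x + (1 + P * r)) / (r - x) := by
      simp only [zeta, OnePoint.elim_some]; field_simp; ring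
    rw [OnePoint.smul_some_eq_ite, h10, h00, h01, h11, unzeta, e]
    simp only [div_eq_zero_iff, hx, or_false]
    split_ifs with h
    · rfl
    · congr 1
      rw [inv_div, div_eq_iff h, sub_mul r, div_mul_cancel₀ _ h]
      ring

theorem smul_center {r : ℚ} {m : ℕ} {g : GL (Fin 2) ℚ}
    (hg : g ∈ parabolicShift (r : OnePoint ℚ) m) : g • (r : OnePoint ℚ) = r := by
  obtain ⟨A, hA, rfl⟩ := hg
  have hT : Matrix.SpecialLinearGroup.mapGL ℚ (ModularGroup.T ^ m) • (∞ : OnePoint ℚ) = ∞ := by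
    rw [OnePoint.smul_infty_eq_self_iff]
    change (((ModularGroup.T ^ m : SL(2, ℤ)) 1 0 : ℤ) : ℚ) = 0
    rw [← zpow_natCast, ModularGroup.coe_T_zpow]; simp
  have hA' : (Matrix.SpecialLinearGroup.mapGL ℚ A)⁻¹ • (r : OnePoint ℚ) = ∞ := by
    rw [← hA, inv_smul_smul]
  rw [map_mul, map_mul, map_inv, mul_smul, mul_smul, hA', hT, hA]

theorem zeta_zpow_smul {r : ℚ} {m : ℕ} (hm : 0 < m) {g : GL (Fin 2) ℚ}
    (hg : g ∈ parabolicShift (r : OnePoint ℚ) m) {s : OnePoint ℚ} (hs : s ≠ (r : OnePoint ℚ))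
    (k : ℤ) :
    g ^ k • s ≠ (r : OnePoint ℚ) ∧ zeta r (g ^ k • s) = zeta r s + k * (m * r.den ^ 2) := by
  have hne : ∀ k : ℤ, g ^ k • s ≠ (r : OnePoint ℚ) := by
    intro k h
    have h1 : g ^ k ∈ MulAction.stabilizer (GL (Fin 2) ℚ) (r : OnePoint ℚ) :=
      zpow_mem (smul_center hg) k
    rw [← show g ^ k • (r : OnePoint ℚ) = r from h1] at h
    exact hs (MulAction.injective _ h)
  refine ⟨hne k, ?_⟩
  induction k using Int.induction_on with
  | zero => simp
  | succ k ih =>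
    rw [add_comm (k : ℤ) 1, zpow_one_add, mul_smul, (zeta_smul hm hg (hne k)).2, ih]
    push_cast; ring
  | pred k ih =>
    have h := (zeta_smul hm hg (hne (-k - 1))).2
    rw [← mul_smul, ← zpow_one_add, show (1 + (-(k : ℤ) - 1)) = -k by ring, ih] at h
    push_cast at h ⊢
    linear_combination -h

/-- The size of the determinant of the slope vectors of `s` and `r`. -/
def detSize (r : ℚ) (s : OnePoint ℚ) : ℕ := (slopeNum s * r.den - r.num * slopeDen s).natAbs

/-- The shift has determinant 1 and fixes the vector of r; the absolute value absorbs the sign of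
the vector of s. -/
theorem detSize_smul {r : ℚ} {m : ℕ} {g : GL (Fin 2) ℚ}
    (hg : g ∈ parabolicShift (r : OnePoint ℚ) m) (s : OnePoint ℚ) :
    detSize r (g • s) = detSize r s := by
  obtain ⟨M, hM, hdet, hM'⟩ := parabolicShift_entries hg
  have h := slopeVec_smul hM (.inl hdet) s
  rw [hM'] at h
  simp only [slopeVec, latticeVec, Matrix.of_apply, Matrix.cons_val', Matrix.cons_val_zero,
    Matrix.cons_val_one, Matrix.cons_val_fin_one] at h
  unfold detSize
  rcases h with h | h
  · have h1 := congrArg Complex.re h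
    have h2 := congrArg Complex.im h
    simp at h1 h2
    norm_cast at h1 h2
    rw [h1, h2]
    congr 1
    push_cast; ring
  · have h1 := congrArg Complex.re h
    have h2 := congrArg Complex.im h
    simp at h1 h2
    norm_cast at h1 h2
    rw [h1, h2, ← Int.natAbs_neg]
    congr 1
    push_cast; ring

theorem detSize_zpow_smul {r : ℚ} {m : ℕ} {g : GL (Fin 2) ℚ}
    (hg : g ∈ parabolicShift (r : OnePoint ℚ) m) (s : OnePoint ℚ) (k : ℤ) :
    detSize r (g ^ k • s) = detSize r s := by
  induction k using Int.induction_on with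
  | zero => simp
  | succ k ih => rw [add_comm (k : ℤ) 1, zpow_one_add, mul_smul, detSize_smul hg, ih]
  | pred k ih =>
    rw [← detSize_smul hg, ← mul_smul, ← zpow_one_add, show (1 + (-(k : ℤ) - 1)) = -k by ring, ih]

/-- For rational z the determinant is den z · den r · |z - r|, so at equal denominators it measures
the distance to r. -/
theorem detSize_lt {r x y : ℚ} (hd : y.den = x.den) (h : |y - r| < |x - r|) :
    detSize r y < detSize r x := by
  have key : ∀ z : ℚ, ((detSize r z : ℕ) : ℚ) = z.den * r.den * |z - r| := by
    intro z
    rw [detSize, Nat.cast_natAbs]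
    simp only [slopeNum, slopeDen, OnePoint.elim_some]
    push_cast
    rw [← Rat.mul_den_eq_num z, ← Rat.mul_den_eq_num r,
      show z * z.den * r.den - r * r.den * z.den = z.den * r.den * (z - r) by ring, abs_mul,
      abs_of_nonneg (by positivity : (0 : ℚ) ≤ z.den * r.den)]
  have : ((detSize r y : ℕ) : ℚ) < (detSize r x : ℕ) := by
    rw [key, key, hd]
    have h1 : (0 : ℚ) < x.den := by exact_mod_cast x.den_pos
    have h2 : (0 : ℚ) < r.den := by exact_mod_cast r.den_pos
    gcongr
  exact_mod_cast this

/-- A fundamental domain for translation by `P`: an interval with one endpoint removed. -/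
theorem exists_periodic_retraction {lo hi P e : ℚ} (hP : 0 < P) (h : hi = lo + P)
    (he : e = lo ∨ e = hi) : ∃ ν : ℚ → ℚ, (∀ x, ν (x + P) = ν x) ∧ (∀ x, ∃ k : ℤ, ν x = x + k * P) ∧
      (∀ x, lo ≤ ν x ∧ ν x ≤ hi ∧ ν x ≠ e) ∧ ∀ x, lo ≤ x → x ≤ hi → x ≠ e → ν x = x := by
  subst h
  rcases he with rfl | rfl
  · refine ⟨toIocMod hP e, fun x => toIocMod_add_right hP e x, fun x => ⟨-toIocDiv hP e x, ?_⟩,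
      fun x => ?_, fun x h1 h2 h3 => ?_⟩
    · rw [← self_sub_toIocDiv_zsmul, zsmul_eq_mul]; push_cast; ring
    · obtain ⟨h1, h2⟩ := toIocMod_mem_Ioc hP e x
      exact ⟨h1.le, h2, h1.ne'⟩
    · exact (toIocMod_eq_self hP).2 ⟨lt_of_le_of_ne h1 h3.symm, h2⟩
  · refine ⟨toIcoMod hP lo, fun x => toIcoMod_add_right hP lo x, fun x => ⟨-toIcoDiv hP lo x, ?_⟩,
      fun x => ?_, fun x h1 h2 h3 => ?_⟩
    · rw [← self_sub_toIcoDiv_zsmul, zsmul_eq_mul]; push_cast; ring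
    · obtain ⟨h1, h2⟩ := toIcoMod_mem_Ico hP lo x
      exact ⟨h1, h2.le, h2.ne⟩
    · exact (toIcoMod_eq_self hP).2 ⟨h1, lt_of_le_of_ne h2 h3⟩

end

noncomputable section

/-! ## The fundamental domain -/

section

variable {r r₁ r₂ e : ℚ} {m : ℕ}

/-- Farey edges do not cross: if r₁ < f < r, the determinant of r and r₁ is at least den r + den r₁
≥ 2. -/
theorem IsHeckoidPair.le_left (h : IsHeckoidPair r m r₁ r₂) {f : ℤ} (hf : (f : ℚ) < r) :
    (f : ℚ) ≤ r₁ := by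
  by_contra! hlt
  have h1 := h.adj_left
  have h2 := h.left_lt
  simp only [FareyAdj, slopeNum, slopeDen, OnePoint.elim_some] at h1
  rw [Rat.lt_iff] at h2 hlt hf
  simp only [Rat.num_intCast, Rat.den_intCast, Nat.cast_one, mul_one] at hlt hf
  have d1 : (0 : ℤ) < r₁.den := by exact_mod_cast r₁.den_pos
  have d2 : (0 : ℤ) < r.den := by exact_mod_cast r.den_pos
  rw [abs_of_pos (by linarith)] at h1
  nlinarith

theorem IsHeckoidPair.right_le (h : IsHeckoidPair r m r₁ r₂) {f : ℤ} (hf : r < f) :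
    r₂ ≤ (f : ℚ) := by
  by_contra! hlt
  have h1 := h.adj_right
  have h2 := h.lt_right
  simp only [FareyAdj, slopeNum, slopeDen, OnePoint.elim_some] at h1
  rw [Rat.lt_iff] at h2 hlt hf
  simp only [Rat.num_intCast, Rat.den_intCast, Nat.cast_one, mul_one] at hlt hf
  have d1 : (0 : ℤ) < r₂.den := by exact_mod_cast r₂.den_pos
  have d2 : (0 : ℤ) < r.den := by exact_mod_cast r.den_pos
  rw [abs_of_neg (by linarith)] at h1
  nlinarith

theorem zeta_coe (r x : ℚ) : zeta r (x : OnePoint ℚ) = (r - x)⁻¹ := rfl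

theorem zeta_infty (r : ℚ) : zeta r ∞ = 0 := rfl

theorem zeta_injective {x y : ℚ} (h : zeta r x = zeta r y) : x = y := by
  rw [zeta_coe, zeta_coe, inv_inj] at h; linarith

theorem IsHeckoidPair.zeta_left_pos (h : IsHeckoidPair r m r₁ r₂) : 0 < zeta r r₁ := by
  have := h.left_lt
  rw [zeta_coe, inv_pos]; linarith

theorem IsHeckoidPair.zeta_right_neg (h : IsHeckoidPair r m r₁ r₂) : zeta r r₂ < 0 := by
  have := h.lt_right
  rw [zeta_coe, inv_neg'']; linarith

/-- The shift increases the coordinate, and r₂ has a negative one, r₁ a positive one, so only r₂ ↦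
r₁ is possible. -/
theorem IsHeckoidPair.zeta_left_eq (h : IsHeckoidPair r m r₁ r₂) (hm : 0 < m) :
    zeta r r₁ = zeta r r₂ + m * r.den ^ 2 := by
  have h1 := h.zeta_left_pos
  have h2 := h.zeta_right_neg
  obtain ⟨g, hg, h3 | h3⟩ := h.paired
  · have := (zeta_smul hm hg (s := r₁) (by rw [Ne, OnePoint.coe_eq_coe]; exact h.left_lt.ne)).2
    rw [h3] at this
    have : (0 : ℚ) ≤ m * r.den ^ 2 := by positivity
    linarith
  · have := (zeta_smul hm hg (s := r₂) (by rw [Ne, OnePoint.coe_eq_coe]; exact h.lt_right.ne')).2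
    rwa [h3] at this

/-- The coordinate 1/(r - x) is increasing on each side of r, positive on the left and negative on
the right. -/
theorem IsHeckoidPair.zeta_mem_iff (h : IsHeckoidPair r m r₁ r₂) {x : ℚ} (hx : x ≠ r) :
    (zeta r r₂ ≤ zeta r x ∧ zeta r x ≤ zeta r r₁) ↔ x ≤ r₁ ∨ r₂ ≤ x := by
  have h1 := h.zeta_left_pos
  have h2 := h.zeta_right_neg
  have h3 := h.left_lt
  have h4 := h.lt_right
  rcases lt_or_gt_of_ne hx with hx | hx
  · have h5 : 0 < zeta r x := by rw [zeta_coe, inv_pos]; linarith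
    have h6 : zeta r x ≤ zeta r r₁ ↔ x ≤ r₁ := by
      rw [zeta_coe, zeta_coe, inv_le_inv₀ (by linarith) (by linarith)]
      constructor <;> intro <;> linarith
    rw [h6]
    constructor
    · exact fun h => .inl h.2
    · rintro (h | h)
      · exact ⟨by linarith, h⟩
      · linarith
  · have h5 : zeta r x < 0 := by rw [zeta_coe, inv_neg'']; linarith
    have h6 : zeta r r₂ ≤ zeta r x ↔ r₂ ≤ x := by
      rw [zeta_coe, zeta_coe, inv_le_inv_of_neg (by linarith) (by linarith)]
      constructor <;> intro <;> linarith
    rw [h6]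
    constructor
    · exact fun h => .inr h.1
    · rintro (h | h)
      · linarith
      · exact ⟨h, by linarith⟩

/-- The points of the fundamental domain of the reflection group at `∞`. -/
def foldDomain (f : ℤ) : Set (OnePoint ℚ) := {s | ∀ x : ℚ, s = x → x ∈ Set.Icc (f : ℚ) (f + 1)}

/-- The points of the fundamental domain of the parabolic group at `r`. -/
def shiftDomain (r r₁ r₂ e : ℚ) : Set (OnePoint ℚ) :=
  {s | s ≠ r → zeta r r₂ ≤ zeta r s ∧ zeta r s ≤ zeta r r₁ ∧ zeta r s ≠ zeta r e}

theorem mem_foldDomain_coe {f : ℤ} {x : ℚ} :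
    (x : OnePoint ℚ) ∈ foldDomain f ↔ x ∈ Set.Icc (f : ℚ) (f + 1) :=
  ⟨fun h => h x rfl, fun h y hy => by rwa [← OnePoint.coe_eq_coe.1 hy]⟩

theorem infty_mem_foldDomain (f : ℤ) : ∞ ∈ foldDomain f :=
  fun x hx => absurd hx (OnePoint.infty_ne_coe x)

theorem fold_of_mem {f : ℤ} {s : OnePoint ℚ} (h : s ∈ foldDomain f) : fold f s = s := by
  induction s using OnePoint.rec with
  | infty => rfl
  | coe x => rw [fold, OnePoint.map_some, foldRat_of_mem (mem_foldDomain_coe.1 h)]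

theorem IsHeckoidPair.infty_mem_shiftDomain (h : IsHeckoidPair r m r₁ r₂) (he : e = r₁ ∨ e = r₂) :
    ∞ ∈ shiftDomain r r₁ r₂ e := by
  intro _
  have h1 := h.zeta_left_pos
  have h2 := h.zeta_right_neg
  rw [zeta_infty]
  refine ⟨h2.le, h1.le, ?_⟩
  rcases he with rfl | rfl
  · exact h1.ne
  · exact h2.ne'

theorem IsHeckoidPair.coe_mem_shiftDomain (h : IsHeckoidPair r m r₁ r₂) {x : ℚ} (hx : x ≠ r) :
    (x : OnePoint ℚ) ∈ shiftDomain r r₁ r₂ e ↔ (x ≤ r₁ ∨ r₂ ≤ x) ∧ x ≠ e := by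
  have hx' : (x : OnePoint ℚ) ≠ r := by rwa [Ne, OnePoint.coe_eq_coe]
  rw [← h.zeta_mem_iff hx, shiftDomain, Set.mem_ofPred_eq, and_assoc]
  have : zeta r x ≠ zeta r e ↔ x ≠ e :=
    ⟨fun h h' => h (by rw [h']), fun h h' => h (zeta_injective h')⟩
  rw [this]
  exact ⟨fun h => h hx', fun h _ => h⟩

theorem IsHeckoidPair.mem_domain_iff (h : IsHeckoidPair r m r₁ r₂) (he : e = r₁ ∨ e = r₂)
    (s : OnePoint ℚ) : s ∈ heckoidInterval r r₁ r₂ e ∪ {∞, (r : OnePoint ℚ)} ↔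
      s ∈ foldDomain ⌊r⌋ ∧ s ∈ shiftDomain r r₁ r₂ e := by
  have hfl := Int.floor_le r
  have hfl' := Int.lt_floor_add_one r
  have h3 := h.left_lt
  have h4 := h.lt_right
  induction s using OnePoint.rec with
  | infty => simp [infty_mem_foldDomain, h.infty_mem_shiftDomain he]
  | coe x =>
    rw [mem_foldDomain_coe]
    by_cases hx : x = r
    · subst hx
      simp only [Set.mem_union, Set.mem_insert_iff, Set.mem_singleton_iff, or_true, true_iff]
      exact ⟨⟨hfl, hfl'.le⟩, fun h => absurd rfl h⟩
    · rw [h.coe_mem_shiftDomain hx]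
      simp only [heckoidInterval, Set.mem_union, Set.mem_insert_iff, Set.mem_singleton_iff,
        OnePoint.coe_ne_infty, OnePoint.coe_eq_coe, hx, or_false, Set.mem_image, Set.mem_sdiff,
        exists_eq_right, Set.mem_Icc]
      constructor
      · rintro ⟨⟨h1, h2⟩ | ⟨h1, h2⟩, h5⟩
        · exact ⟨⟨h1, by linarith⟩, .inl h2, h5⟩
        · exact ⟨⟨by linarith, h2⟩, .inr h1, h5⟩
      · rintro ⟨⟨h1, h2⟩, h5 | h5, h6⟩
        · exact ⟨.inl ⟨h1, h5⟩, h6⟩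
        · exact ⟨.inr ⟨h5, h2⟩, h6⟩

/-- As ⌊r⌋ ≤ r₁ and r₂ ≤ ⌊r⌋ + 1, a point outside the unit interval lies strictly beyond r₁ or r₂,
in particular away from the removed endpoint. -/
theorem IsHeckoidPair.mem_shiftDomain_of_notMem (h : IsHeckoidPair r m r₁ r₂)
    (he : e = r₁ ∨ e = r₂) (hr : ∀ k : ℤ, r ≠ k) {s : OnePoint ℚ} (hs : s ∉ foldDomain ⌊r⌋) :
    s ∈ shiftDomain r r₁ r₂ e := by
  have hfl := Int.floor_le r
  have hfl' := Int.lt_floor_add_one r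
  have h1 := h.le_left (lt_of_le_of_ne hfl (hr _).symm)
  have h2 := h.right_le (f := ⌊r⌋ + 1) (by push_cast; exact hfl')
  have h3 := h.left_lt
  have h4 := h.lt_right
  push_cast at h2
  induction s using OnePoint.rec with
  | infty => exact absurd (infty_mem_foldDomain _) hs
  | coe x =>
    rw [mem_foldDomain_coe, Set.mem_Icc, not_and_or, not_le, not_le] at hs
    have hx : x ≠ r := by rintro rfl; rcases hs with hs | hs <;> linarith
    rw [h.coe_mem_shiftDomain hx]
    refine ⟨?_, ?_⟩
    · rcases hs with hs | hs
      · left; linarith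
      · right; linarith
    · rintro rfl
      rcases hs with hs | hs <;> rcases he with he | he <;> linarith

/-- The retraction onto the fundamental domain of the parabolic group at `r`. -/
theorem IsHeckoidPair.exists_retraction (h : IsHeckoidPair r m r₁ r₂) (he : e = r₁ ∨ e = r₂)
    (hm : 0 < m) : ∃ ψ : OnePoint ℚ → OnePoint ℚ,
      (∀ s, ψ s ∈ shiftDomain r r₁ r₂ e) ∧ (∀ s ∈ shiftDomain r r₁ r₂ e, ψ s = s) ∧
      (∀ g ∈ parabolicShift (r : OnePoint ℚ) m, ∀ s, ψ (g • s) = ψ s) ∧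
      ∀ s, ∃ g ∈ parabolicGroup (r : OnePoint ℚ) m, g • s = ψ s ∧
        detSize r (ψ s) = detSize r s := by
  classical
  have hP : (0 : ℚ) < m * r.den ^ 2 := by
    have h1 : (0 : ℚ) < m := by exact_mod_cast hm
    have h2 : (0 : ℚ) < r.den := by exact_mod_cast r.den_pos
    positivity
  obtain ⟨ν, hν, hν1, hν2, hν3⟩ := exists_periodic_retraction (e := zeta r e) hP
    (h.zeta_left_eq hm) (by rcases he with rfl | rfl <;> simp)
  refine ⟨fun s => if s = r then r else unzeta r (ν (zeta r s)), fun s => ?_, fun s hs => ?_,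
    fun g hg s => ?_, fun s => ?_⟩
  · by_cases hs : s = (r : OnePoint ℚ)
    · simp [hs, shiftDomain]
    · simp only [hs, if_false]
      intro _
      rw [zeta_unzeta]
      exact hν2 _
  · by_cases hs' : s = (r : OnePoint ℚ)
    · simp [hs']
    · obtain ⟨h1, h2, h3⟩ := hs hs'
      simp only [hs', if_false]
      rw [hν3 _ h1 h2 h3, unzeta_zeta hs']
  · by_cases hs : s = (r : OnePoint ℚ)
    · rw [hs, smul_center hg]
    · obtain ⟨h1, h2⟩ := zeta_smul hm hg hs
      simp only [hs, h1, if_false]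
      rw [h2, hν]
  · by_cases hs : s = (r : OnePoint ℚ)
    · exact ⟨1, one_mem _, by simp [hs], by simp [hs]⟩
    · obtain ⟨g, hg, -⟩ := h.paired
      obtain ⟨k, hk⟩ := hν1 (zeta r s)
      obtain ⟨h1, h2⟩ := zeta_zpow_smul hm hg hs k
      have e1 : g ^ k • s = unzeta r (ν (zeta r s)) := by
        rw [← unzeta_zeta h1, h2, hk]
      simp only [hs, if_false]
      exact ⟨g ^ k, zpow_mem (Subgroup.subset_closure hg) k, e1,
        by rw [← e1, detSize_zpow_smul hg]⟩

/-! ### Existence and uniqueness of the representative -/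

theorem IsHeckoidPair.exists_domain_mem (h : IsHeckoidPair r m r₁ r₂) (he : e = r₁ ∨ e = r₂)
    (hr : ∀ k : ℤ, r ≠ k) (hm : 0 < m) (s : OnePoint ℚ) :
    ∃ g ∈ heckoidFareyGroup r m, g • s ∈ foldDomain ⌊r⌋ ∧ g • s ∈ shiftDomain r r₁ r₂ e := by
  obtain ⟨ψ, hψ, -, -, hψ'⟩ := h.exists_retraction he hm
  -- Shifting keeps the determinant with r; if the result is outside the unit interval, folding
  -- keeps the denominator and strictly lowers the determinant.
  induction hn : detSize r s using Nat.strong_induction_on generalizing s with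
  | _ n ih =>
    obtain ⟨g, hg, hgs, hsize⟩ := hψ' s
    have hg' : g ∈ heckoidFareyGroup r m := Subgroup.mem_sup_right hg
    by_cases hF : ψ s ∈ foldDomain ⌊r⌋
    · exact ⟨g, hg', hgs ▸ hF, hgs ▸ hψ s⟩
    · obtain ⟨x, hx⟩ : ∃ x : ℚ, ψ s = x := by
        by_contra! hne
        exact hF fun x hx => absurd hx (hne x)
      obtain ⟨g', hg1, hg2⟩ := exists_reflectionGroup_smul_eq_fold ⌊r⌋ (ψ s)
      have hlt : detSize r (fold ⌊r⌋ (ψ s)) < n := by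
        rw [← hn, ← hsize, hx, fold, OnePoint.map_some]
        refine detSize_lt (foldRat_den _ _) (abs_foldRat_sub_lt
          (lt_of_le_of_ne (Int.floor_le r) (hr _).symm) (Int.lt_floor_add_one r) ?_)
        rwa [← mem_foldDomain_coe, ← hx]
      obtain ⟨g₁, h1, h2, h3⟩ := ih _ hlt _ rfl
      rw [← hg2, ← hgs, ← mul_smul, ← mul_smul] at h2 h3
      exact ⟨_, mul_mem (mul_mem h1 (Subgroup.mem_sup_left hg1)) hg', h2, h3⟩

theorem IsHeckoidPair.eq_of_mem_domain (h : IsHeckoidPair r m r₁ r₂) (he : e = r₁ ∨ e = r₂)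
    (hr : ∀ k : ℤ, r ≠ k) (hm : 0 < m) {s : OnePoint ℚ} {g : GL (Fin 2) ℚ}
    (hg : g ∈ heckoidFareyGroup r m) (h1 : s ∈ foldDomain ⌊r⌋) (h2 : s ∈ shiftDomain r r₁ r₂ e)
    (h3 : g • s ∈ foldDomain ⌊r⌋) (h4 : g • s ∈ shiftDomain r r₁ r₂ e) : g • s = s := by
  obtain ⟨ψ, hψ, hψJ, hψg, -⟩ := h.exists_retraction he hm
  set φ := fold ⌊r⌋
  have left := eventuallyEq_left (φ := φ) (ψ := ψ) (fun _ h => fold_of_mem h) hψJ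
    (fun _ => h.mem_shiftDomain_of_notMem he hr)
  have right := eventuallyEq_right (φ := φ) hψ hψJ
  -- The elements moving every point within its class of eventual equality form a subgroup; it
  -- contains both kinds of generators because φ and ψ are invariant under them.
  let K : Subgroup (GL (Fin 2) ℚ) :=
    { carrier := {g | ∀ s, EventuallyEq (φ ∘ ψ) s (g • s)}
      one_mem' := fun s => ⟨0, 0, by simp⟩
      mul_mem' := fun {a b} ha hb s => by rw [mul_smul]; exact (hb s).trans (ha _)
      inv_mem' := fun {a} ha s => by
        have := ha (a⁻¹ • s)
        rw [smul_inv_smul] at this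
        exact this.symm }
  have hK : heckoidFareyGroup r m ≤ K := by
    refine sup_le ((Subgroup.closure_le K).2 fun g hg s => ?_)
      ((Subgroup.closure_le K).2 fun g hg s => ?_)
    · have := left (g • s)
      rw [show φ (g • s) = φ s from fold_smul hg s] at this
      exact (left s).trans this.symm
    · have := right (g • s)
      rw [hψg g hg s] at this
      exact (right s).trans this.symm
  have fixed : ∀ t ∈ foldDomain ⌊r⌋, t ∈ shiftDomain r r₁ r₂ e → (φ ∘ ψ) t = t := by
    intro t ht ht'
    rw [Function.comp_apply, hψJ t ht']
    exact fold_of_mem ht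
  exact ((hK hg s).eq_of_fixed (fixed _ h1 h2) (fixed _ h3 h4)).symm

end
end

theorem mainTheorem4 (r : ℚ) (hr : ∀ k : ℤ, r ≠ k) (n : ℚ) (hn : 1 < n)
    (m : ℕ) (hm : (m : ℚ) = 2 * n)
    (r₁ r₂ : ℚ) (hpair : IsHeckoidPair r m r₁ r₂) (e : ℚ) (he : e = r₁ ∨ e = r₂)
    (x₀ : PuncturedPlane) (s : OnePoint ℚ) :
    (∃! s₀ : OnePoint ℚ, s₀ ∈ heckoidInterval r r₁ r₂ e ∪ {∞, (r : OnePoint ℚ)} ∧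
      s ∈ MulAction.orbit (heckoidFareyGroup r m) s₀) ∧
    (∀ s₀ ∈ heckoidInterval r r₁ r₂ e ∪ {∞, (r : OnePoint ℚ)},
      s ∈ MulAction.orbit (heckoidFareyGroup r m) s₀ →
        HomotopicInHeckoid r m x₀ s s₀ ∧
        (s₀ = ∞ → NullHomotopicInHeckoid r m x₀ s)) := by
  have hm0 : 0 < m := by
    have : (0 : ℚ) < m := by rw [hm]; linarith
    exact_mod_cast this
  refine ⟨?_, ?_⟩
  · obtain ⟨g, hg, h1, h2⟩ := hpair.exists_domain_mem he hr hm0 s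
    refine ⟨g • s, ⟨(hpair.mem_domain_iff he _).2 ⟨h1, h2⟩, ⟨⟨g, hg⟩⁻¹, inv_smul_smul g s⟩⟩, ?_⟩
    rintro t ⟨ht, ⟨⟨k, hk⟩, hkt⟩⟩
    obtain ⟨h3, h4⟩ := (hpair.mem_domain_iff he _).1 ht
    have hkt' : k • t = s := hkt
    rw [← hkt', ← mul_smul] at h1 h2 ⊢
    exact (hpair.eq_of_mem_domain he hr hm0 (mul_mem hg hk) h3 h4 h1 h2).symm
  · rintro s₀ - ⟨⟨g, hg⟩, hgs⟩
    have hgs' : g • s₀ = s := hgs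
    have h : LoopsConj r m x₀ s s₀ := by
      rw [← hgs']
      exact (LoopsConj.of_mem hg s₀).symm
    refine ⟨h.homotopic, ?_⟩
    rintro rfl
    exact h.nullHomotopic
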